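/- Let $R:[0,\infty)\to[0,\infty)$ be locally integrable (integrable on $[0,k]$ for every $k$). Assume that $\pi$ is a probability measure on $(0,\infty)$, absolutely continuous with respect to Lebesgue measure, whose distribution function $F$ is stationary for the growth-fragmentation equation, i.e. for all $t,x\ge 0$ $$F(x)=F(e^{-t}x)+\int_0^t (e^{s-t}x)^2\Big[\int_{e^{s-t}x}^\infty \frac{R(z)}{z}\,dF(z)\Big]ds .$$ Let $U_1,U_2,\dots$ be i.i.d. uniform on $(0,1)$, put $J_k=\sqrt{U_{2k}}$ and $S_z(t)=\exp\big(-\int_z^{ze^t}R(u)\,du\big)$ for $z>0$, $t\ge0$, with generalized inverse $S_z^{-1}(u)=\inf\{t\ge 0:S_z(t)\le u\}\in[0,\infty]$. For $x>0$ set recursively $\tau_0=0$, $Y_k=xe^{\tau_k}\prod_{j=1}^kJ_j$ (so $Y_0=x$), $\tau_{k+1}=\tau_k+S_{Y_k}^{-1}(U_{2k+1})$ (and $\tau_{k+1}=\infty$ if $\tau_k=\infty$). The cell process started at $x$ is $X^x_t=xe^t\prod_{j=1}^kJ_j$ if $\tau_k\le t<\tau_{k+1}$, and $X^x_t=0$ if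 $t\ge\lim_k\tau_k$. Let $P_tf(x)=\mathbb E[f(X^x_t)]$. For every $t\ge0$ the operator $P_t$ is well defined on $L^1(\pi)$ (for $f\in L^1(\pi)$, $f(X_t^x)$ is integrable for $\pi$-a.e. $x$, and $P_tf\in L^1(\pi)$) and satisfies $\|P_tf\|_{L^1(\pi)}\le\|f\|_{L^1(\pi)}$. Let $\mathscr L$ be the $L^1(\pi)$-generator of $(P_t)_{t\ge0}$: its domain $D_{\mathscr L}$ is the set of $f\in L^1(\pi)$ for which $\lim_{t\downarrow0}t^{-1}(P_tf-f)$ exists in $L^1(\pi)$, and $\mathscr Lf$ is this limit. Then $C_c^1(0,\infty)$ is a core for $\mathscr L$. That is, $C_c^1(0,\infty)\subset D_{\mathscr L}$, with $$\mathscr Lf(x)=xf'(x)+xR(x)\Big[\int_0^x\frac{2u}{x^2}f(u)\,du-f(x)\Big]\qquad (f\in C_c^1(0,\infty)),$$ and for every $f\in D_{\mathscr L}$ there is a sequence $(f_n)$ in $C_c^1(0,\infty)$ such that $f_n\to f$ and $\mathscr Lf_n\to\mathscr Lf$ in $L^1(\pi)$ as $n\to\infty$. -/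

import Mathlib

open MeasureTheory Set Filter Topology
open scoped ENNReal NNReal

noncomputable section

namespace CellProcess

/-! ### The stationary law -/

/-- The growth-fragmentation operator
`𝓡(F)_t(x) = F_0(e^{-t} x) + ∫_0^t (e^{s-t} x)^2 (∫_{e^{s-t} x}^∞ R(z)/z dF_s(z)) ds`
evaluated at a family `μ s = dF_s` of measures on `[0,∞)`. All the terms are nonnegative, and the
operator takes its values in `[0,∞]`. -/
def fragmentationOperator (R : ℝ → ℝ) (μ : ℝ → Measure ℝ) (t x : ℝ) : ℝ≥0∞ :=
  μ 0 (Iic (Real.exp (-t) * x)) +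
    ∫⁻ s in Ioc 0 t, ENNReal.ofReal ((Real.exp (s - t) * x) ^ 2) *
      ∫⁻ z in Ioi (Real.exp (s - t) * x), ENNReal.ofReal (R z / z) ∂(μ s)

/-- `π` is a stationary law: a probability measure on `(0,∞)`, absolutely continuous with respect
to Lebesgue measure, whose distribution function `F`, as the constant family `F_t = F`, is a fixed
point of the operator `𝓡`. -/
structure IsStationaryLaw (R : ℝ → ℝ) (π : Measure ℝ) : Prop where
  isProbabilityMeasure : IsProbabilityMeasure π
  null_nonpos : π (Iic 0) = 0
  absolutelyContinuous : π ≪ volume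
  fixed : ∀ t x : ℝ, 0 ≤ t → 0 ≤ x → π (Iic x) = fragmentationOperator R (fun _ => π) t x

/-! ### The cell process -/

/-- The uniform distribution on `(0,1)`. -/
def uniform01 : Measure ℝ := volume.restrict (Ioo 0 1)

instance : IsProbabilityMeasure uniform01 := ⟨by simp [uniform01]⟩

/-- The law of an i.i.d. sequence of uniform random variables on `(0,1)`. The sequence
`U_1, U_2, …` is `ω 0, ω 1, …`. -/
def uniformSeq : Measure (ℕ → ℝ) := Measure.infinitePi (fun _ : ℕ => uniform01)

/-- The survivor function `S_z(t) = exp (-∫_z^{z e^t} R(u) du)`. -/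
def survivor (R : ℝ → ℝ) (z t : ℝ) : ℝ :=
  Real.exp (-∫ u in z..(z * Real.exp t), R u)

/-- The generalized inverse `inf {t ≥ 0 : S_z(t) ≤ u}` of the nonincreasing function `S_z`, with
`inf ∅ = ∞`. -/
def survivorInv (R : ℝ → ℝ) (z u : ℝ) : ℝ≥0∞ :=
  ⨅ (t : ℝ≥0) (_ : survivor R z (t : ℝ) ≤ u), (t : ℝ≥0∞)

/-- The product `J_1 ⋯ J_k` of the first `k` jump factors, where `J_j = √U_{2j}`. -/
def jumpProd (ω : ℕ → ℝ) (k : ℕ) : ℝ :=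
  ∏ j ∈ Finset.range k, √(ω (2 * j + 1))

/-- The jump times `τ_k ∈ [0,∞]` of the process started at `x`: `τ_0 = 0` and
`τ_k = τ_{k-1} + S_{Y_{k-1}}^{-1}(U_{2k-1})`, where `Y_k = x e^{τ_k} J_1 ⋯ J_k` is the
position after the `k`-th jump (so `Y_0 = x`). If `τ_{k-1} = ∞`, then `τ_k = ∞`. -/
def jumpTime (R : ℝ → ℝ) (x : ℝ) (ω : ℕ → ℝ) : ℕ → ℝ≥0∞
  | 0 => 0
  | k + 1 => jumpTime R x ω k +
      survivorInv R (x * Real.exp (jumpTime R x ω k).toReal * jumpProd ω k) (ω (2 * k))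

open Classical in
/-- The cell process `X^x_t` started at `x`: it is `x e^t J_1 ⋯ J_k` if `τ_k ≤ t < τ_{k+1}`, and
`0` (the absorbing state) if `t ≥ lim τ_k`. -/
def cell (R : ℝ → ℝ) (x t : ℝ) (ω : ℕ → ℝ) : ℝ :=
  if h : ∃ k, jumpTime R x ω k ≤ ENNReal.ofReal t ∧ ENNReal.ofReal t < jumpTime R x ω (k + 1) then
    x * Real.exp t * jumpProd ω (Nat.find h)
  else 0

/-- The transition operator `P_t f(x) = E_x [f(X_t)]`. -/
def transition (R : ℝ → ℝ) (t : ℝ) (f : ℝ → ℝ) (x : ℝ) : ℝ :=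
  ∫ ω, f (cell R x t ω) ∂uniformSeq

/-! ### The generator -/

/-- `f` is in the domain of the `L¹(π)`-generator of `(P_t)` and `g` is the value of the generator
at `f`: `f, g ∈ L¹(π)` and `t⁻¹ (P_t f - f) → g` in `L¹(π)` as `t ↓ 0`. -/
def HasGenerator (R : ℝ → ℝ) (π : Measure ℝ) (f g : ℝ → ℝ) : Prop :=
  Integrable f π ∧ Integrable g π ∧
    Tendsto (fun t : ℝ => eLpNorm (fun x => t⁻¹ * (transition R t f x - f x) - g x) 1 π)
      (𝓝[>] 0) (𝓝 0)

/-- The space `C_c^1(0,∞)`, its elements being extended by `0` to `ℝ`. -/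
def testFunctions : Set (ℝ → ℝ) :=
  {f | ContDiff ℝ 1 f ∧ HasCompactSupport f ∧ tsupport f ⊆ Ioi 0}

/-- The integro-differential operator
`𝓛 f(x) = x f'(x) + x R(x) (∫_0^x (2u/x²) f(u) du - f(x))`. -/
def generatorFormula (R : ℝ → ℝ) (f : ℝ → ℝ) (x : ℝ) : ℝ :=
  x * deriv f x + x * R x * ((∫ u in (0 : ℝ)..x, 2 * u / x ^ 2 * f u) - f x)

end CellProcess

end

noncomputable section

namespace CellProcess

/-! ### Absolutely continuous functions and the cumulative rate -/

/-! Write `H` for the cumulative rate. Stationarity is solved explicitly: it says that `π` has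
density `y φ(y)` with `φ(y) = ∫_y^∞ R(z)/z dπ(z)`, hence `φ' = -R φ`, so `π` has density `c x
e^{-H(x)}`, and finiteness of the mass forces `H → ∞` (`exists_eq_explicitLaw`).

On test functions the generator splits as `𝓛 = B + A`, where `B f = x f' - x R f` generates the flow
killed at the jump rate and `A f = x R · jumpMean f` is the gain from jumps. Two exact identities
under `π` drive everything: the killed flow at time `s` multiplies the integral of a nonnegative
function by `e^{-2s}` (`lintegral_flow`), and the gain multiplies it by `2` (`lintegral_gain`).
Decomposing at the first jump, the paths with exactly `n` jumps up to time `t` contribute the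
Poisson weight of parameter `2t` times `∫ g dπ` (`lintegral_nJump`). Since the weights sum to `1`,
the process does not explode for `π`-almost every starting point and `π` is invariant, so `P_t` is a
contraction of `L¹(π)`. The same weights show that two jumps before `t` have `π`-averaged
probability `O(t²)`, although `x R(x)` may be unbounded; this gives `𝓛` on test functions
(`hasGenerator_testFunction`).

For the core it suffices that `(1 - 𝓛)(C_c^1)` is dense in `L¹(π)`: contractivity gives `‖u‖ ≤ ‖u -
𝓛u‖` on the domain, so approximating `f - 𝓛f` by `F - 𝓛F` approximates `f` in graph norm. Density is
a perturbation argument. The decay `e^{-2s}` gives `‖F - BF‖ ≥ 3‖F‖`, while `‖AF‖ ≤ 2‖F‖`, so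
approximately solving `F - BF = f` leaves a residual for `1 - 𝓛` of norm about `2/3 ‖f‖`, and this
is iterated. The first-order equation `F - BF = f` is solved explicitly, with a small correction
near `0` to keep the support compact (`exists_testFunction_flow_of_continuous`). -/

theorem absolutelyContinuousOnInterval_lipschitzOn_comp {f g : ℝ → ℝ} {a b : ℝ} {K : ℝ≥0}
    (hg : LipschitzOnWith K g (f '' uIcc a b)) (hf : AbsolutelyContinuousOnInterval f a b) :
    AbsolutelyContinuousOnInterval (fun x => g (f x)) a b := by
  have hf' := Tendsto.const_mul (K : ℝ) hf
  rw [mul_zero] at hf'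
  refine squeeze_zero' (Eventually.of_forall fun E => Finset.sum_nonneg fun _ _ => dist_nonneg)
    ?_ hf'
  filter_upwards [mem_inf_of_right (mem_principal_self _)] with E hE
  rw [Finset.mul_sum]
  refine Finset.sum_le_sum fun i hi => ?_
  exact hg.dist_le_mul _ (mem_image_of_mem _ (hE.1 i hi).1) _ (mem_image_of_mem _ (hE.1 i hi).2)

/-- A measurable, nonnegative, locally integrable function on the real line. -/
structure IsRate (R : ℝ → ℝ) : Prop where
  measurable : Measurable R
  nonneg : ∀ x, 0 ≤ R x
  locallyIntegrable : LocallyIntegrable R volume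

/-- The cumulative rate `∫_0^x R(u) du`. -/
def cumulative (R : ℝ → ℝ) (x : ℝ) : ℝ := ∫ u in (0 : ℝ)..x, R u

namespace IsRate

theorem intervalIntegrable {R : ℝ → ℝ} (hR : IsRate R) (a b : ℝ) : IntervalIntegrable R volume a b :=
  intervalIntegrable_iff.mpr <|
    (hR.locallyIntegrable.integrableOn_isCompact isCompact_uIcc).mono_set uIoc_subset_uIcc

theorem cumulative_sub {R : ℝ → ℝ} (hR : IsRate R) (a b : ℝ) : cumulative R b - cumulative R a = ∫ u in a..b, R u :=
  intervalIntegral.integral_interval_sub_left (hR.intervalIntegrable _ _)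
    (hR.intervalIntegrable _ _)

theorem monotone_cumulative {R : ℝ → ℝ} (hR : IsRate R) : Monotone (cumulative R) := fun a b hab => by
  rw [← sub_nonneg, hR.cumulative_sub]
  exact intervalIntegral.integral_nonneg hab fun u _ => hR.nonneg u

theorem continuous_cumulative {R : ℝ → ℝ} (hR : IsRate R) : Continuous (cumulative R) :=
  intervalIntegral.continuous_primitive hR.intervalIntegrable 0

theorem measurable_cumulative {R : ℝ → ℝ} (hR : IsRate R) : Measurable (cumulative R) :=
  hR.continuous_cumulative.measurable

@[simp] theorem cumulative_zero {R : ℝ → ℝ} : cumulative R 0 = 0 := by simp [cumulative]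

theorem cumulative_nonneg {R : ℝ → ℝ} (hR : IsRate R) {x : ℝ} (hx : 0 ≤ x) : 0 ≤ cumulative R x := by
  simpa using hR.monotone_cumulative hx

theorem survivor_eq {R : ℝ → ℝ} (hR : IsRate R) (z t : ℝ) :
    survivor R z t = Real.exp (cumulative R z - cumulative R (z * Real.exp t)) := by
  rw [survivor, ← hR.cumulative_sub, neg_sub]

theorem ae_hasDerivAt_cumulative {R : ℝ → ℝ} (hR : IsRate R) : ∀ᵐ x, HasDerivAt (cumulative R) (R x) x := by
  filter_upwards [LocallyIntegrable.ae_hasDerivAt_integral hR.locallyIntegrable] with x hx using hx 0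

theorem absolutelyContinuous_cumulative {R : ℝ → ℝ} (hR : IsRate R) (a b : ℝ) :
    AbsolutelyContinuousOnInterval (cumulative R) a b := by
  -- The interval is enlarged to contain the base point `0` of the primitive.
  refine ((hR.intervalIntegrable (min (min a b) 0) (max (max a b) 0))
    |>.absolutelyContinuousOnInterval_intervalIntegral (c := 0) ?_).mono ?_
  · rw [mem_uIcc]; left; simp
  · rw [uIcc_of_le (a := min (min a b) 0) (by simp)]
    refine uIcc_subset_Icc ?_ ?_ <;> simp

/-- For a merely integrable rate `e^{cH}` need not be `C¹`; absolute continuity is what allows the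
fundamental theorem of calculus. The exponential is Lipschitz on the compact image of the interval
under `H`. -/
theorem absolutelyContinuous_exp_cumulative {R : ℝ → ℝ} (hR : IsRate R) (a b : ℝ) (c : ℝ) :
    AbsolutelyContinuousOnInterval (fun x => Real.exp (c * cumulative R x)) a b := by
  have hcd : ContDiff ℝ 1 (fun y : ℝ => Real.exp (c * y)) := by fun_prop
  have hcomp : IsCompact (cumulative R '' uIcc a b) :=
    isCompact_uIcc.image hR.continuous_cumulative
  obtain ⟨K, hK⟩ := hcd.locallyLipschitz.locallyLipschitzOn.exists_lipschitzOnWith_of_compact hcomp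
  exact absolutelyContinuousOnInterval_lipschitzOn_comp (g := fun y => Real.exp (c * y)) hK
    (hR.absolutelyContinuous_cumulative a b)

/-- The fundamental theorem of calculus for the product of `exp (-H)` and a `C¹` function. -/
theorem exp_mul_sub_exp_mul {R : ℝ → ℝ} (hR : IsRate R) {f : ℝ → ℝ} (hf : ContDiff ℝ 1 f) (a b : ℝ) :
    Real.exp (-cumulative R b) * f b - Real.exp (-cumulative R a) * f a =
      ∫ x in a..b, Real.exp (-cumulative R x) * (deriv f x - R x * f x) := by
  have h1 := hR.absolutelyContinuous_exp_cumulative a b (-1)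
  have h2 : AbsolutelyContinuousOnInterval f a b :=
    ContDiffOn.absolutelyContinuousOnInterval hf.contDiffOn
  have h3 := (h1.fun_mul h2).integral_deriv_eq_sub
  simp only [neg_mul, one_mul] at h3
  rw [← h3]
  refine intervalIntegral.integral_congr_ae ?_
  filter_upwards [hR.ae_hasDerivAt_cumulative] with x hx _
  have h4 := (hx.neg.exp.mul (hf.differentiable one_ne_zero x).hasDerivAt).deriv
  have h5 : (fun y => Real.exp (-cumulative R y) * f y) =
    (fun y => Real.exp ((-cumulative R) y)) * f := rfl
  rw [h5, h4]
  simp only [Pi.neg_apply]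
  ring

theorem integral_rate_mul_exp {R : ℝ → ℝ} (hR : IsRate R) (a b : ℝ) :
    ∫ x in a..b, R x * Real.exp (-cumulative R x) =
      Real.exp (-cumulative R a) - Real.exp (-cumulative R b) := by
  have h := hR.exp_mul_sub_exp_mul (contDiff_const (c := (1 : ℝ))) a b
  simp only [mul_one, deriv_const, zero_sub, mul_neg, intervalIntegral.integral_neg] at h
  simp_rw [mul_comm (R _)]
  linarith

theorem intervalIntegrable_rate_mul {R : ℝ → ℝ} (hR : IsRate R) {g : ℝ → ℝ} (hg : Continuous g) (a b : ℝ) :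
    IntervalIntegrable (fun x => R x * g x) volume a b :=
  (hR.intervalIntegrable a b).mul_continuousOn hg.continuousOn

theorem setLIntegral_Ioc_rate_mul_exp {R : ℝ → ℝ} (hR : IsRate R) {a b : ℝ} (hab : a ≤ b) :
    ∫⁻ x in Ioc a b, ENNReal.ofReal (R x * Real.exp (-cumulative R x)) =
      ENNReal.ofReal (Real.exp (-cumulative R a) - Real.exp (-cumulative R b)) := by
  rw [← hR.integral_rate_mul_exp, intervalIntegral.integral_of_le hab,
    ofReal_integral_eq_lintegral_ofReal]
  · have := hR.intervalIntegrable_rate_mul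
      (Real.continuous_exp.comp hR.continuous_cumulative.neg) a b
    exact (intervalIntegrable_iff_integrableOn_Ioc_of_le hab).1 this
  · exact Eventually.of_forall fun x => mul_nonneg (hR.nonneg x) (Real.exp_pos _).le

theorem setLIntegral_Ioi_rate_mul_exp {R : ℝ → ℝ} (hR : IsRate R) (hH : Tendsto (cumulative R) atTop atTop) (a : ℝ) :
    ∫⁻ x in Ioi a, ENNReal.ofReal (R x * Real.exp (-cumulative R x)) =
      ENNReal.ofReal (Real.exp (-cumulative R a)) := by
  have hmeas : Measurable fun x => ENNReal.ofReal (R x * Real.exp (-cumulative R x)) := by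
    have := hR.measurable; have := hR.measurable_cumulative; fun_prop
  have h1 := (aecover_Iic (μ := volume.restrict (Ioi a)) tendsto_id)
    |>.lintegral_tendsto_of_countably_generated hmeas.aemeasurable
  refine tendsto_nhds_unique h1 ?_
  have h2 : Tendsto (fun b => ENNReal.ofReal (Real.exp (-cumulative R a) -
      Real.exp (-cumulative R b))) atTop (𝓝 (ENNReal.ofReal (Real.exp (-cumulative R a) - 0))) :=
    ENNReal.tendsto_ofReal (tendsto_const_nhds.sub
      (Real.tendsto_exp_atBot.comp (tendsto_neg_atTop_atBot.comp hH)))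
  rw [sub_zero] at h2
  refine h2.congr' ?_
  filter_upwards [eventually_ge_atTop a] with b hb
  rw [← hR.setLIntegral_Ioc_rate_mul_exp hb, Measure.restrict_restrict measurableSet_Iic,
    inter_comm, Ioi_inter_Iic]
  rfl

end IsRate

/-! ### The explicit form of the stationary law -/

/-- The measure on `(0,∞)` with density `c x exp (-∫_0^x R(u) du)`. -/
def explicitLaw (R : ℝ → ℝ) (c : ℝ) : Measure ℝ :=
  (volume.restrict (Ioi 0)).withDensity
    (fun x => ENNReal.ofReal (c * x * Real.exp (-cumulative R x)))

theorem image_mul_exp_Ioc {x : ℝ} (hx : 0 < x) (t : ℝ) :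
    (fun s => x * Real.exp s) '' Ioc 0 t = Ioc x (x * Real.exp t) := by
  ext y
  simp only [mem_image, mem_Ioc]
  constructor
  · rintro ⟨s, ⟨h0, h1⟩, rfl⟩
    exact ⟨by nlinarith [Real.add_one_lt_exp h0.ne'],
      mul_le_mul_of_nonneg_left (Real.exp_le_exp.2 h1) hx.le⟩
  · rintro ⟨h0, h1⟩
    have hy : 0 < y := hx.trans h0
    refine ⟨Real.log (y / x), ⟨Real.log_pos ((one_lt_div hx).2 h0), ?_⟩, ?_⟩
    · rw [Real.log_le_iff_le_exp (by positivity), div_le_iff₀ hx]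
      linarith
    · rw [Real.exp_log (by positivity)]
      field_simp

theorem setLIntegral_Ioc_mul_exp {x : ℝ} (hx : 0 < x) (t : ℝ) (G : ℝ → ℝ≥0∞) :
    ∫⁻ y in Ioc x (x * Real.exp t), G y =
      ∫⁻ s in Ioc 0 t, ENNReal.ofReal (x * Real.exp s) * G (x * Real.exp s) := by
  have hd : ∀ s ∈ Ioc 0 t, HasDerivWithinAt (fun s => x * Real.exp s) (x * Real.exp s)
      (Ioc 0 t) s := fun s _ => ((Real.hasDerivAt_exp s).const_mul x).hasDerivWithinAt
  have hinj : InjOn (fun s => x * Real.exp s) (Ioc 0 t) := fun s _ s' _ h =>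
    Real.exp_injective (mul_left_cancel₀ hx.ne' h)
  rw [← image_mul_exp_Ioc hx t,
    lintegral_image_eq_lintegral_abs_deriv_mul measurableSet_Ioc hd hinj]
  refine lintegral_congr fun s => ?_
  rw [abs_of_pos (by positivity)]

theorem measure_eq_of_Ioc_pos {μ ν : Measure ℝ} [IsFiniteMeasure μ] (hμ : μ (Iic 0) = 0)
    (hν : ν (Iic 0) = 0) (h : ∀ a b, 0 < a → a < b → μ (Ioc a b) = ν (Ioc a b)) : μ = ν := by
  refine Measure.ext_of_Iic _ _ fun x => ?_
  rcases le_or_gt x 0 with hx | hx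
  · rw [measure_mono_null (Iic_subset_Iic.2 hx) hμ, measure_mono_null (Iic_subset_Iic.2 hx) hν]
  have hU : Ioc 0 x = ⋃ n : ℕ, Ioc (x / (n + 2)) x := by
    ext y
    simp only [mem_Ioc, mem_iUnion]
    constructor
    · rintro ⟨h0, h1⟩
      obtain ⟨n, hn⟩ := exists_nat_gt (x / y)
      refine ⟨n, ?_, h1⟩
      rw [div_lt_iff₀ (by positivity)]
      rw [div_lt_iff₀ h0] at hn
      nlinarith
    · rintro ⟨n, h0, h1⟩
      exact ⟨lt_trans (by positivity) h0, h1⟩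
  have hm : Monotone fun n : ℕ => Ioc (x / (n + 2)) x := fun m n hmn =>
    Ioc_subset_Ioc_left (by gcongr)
  have key : μ (Ioc 0 x) = ν (Ioc 0 x) := by
    rw [hU, hm.measure_iUnion, hm.measure_iUnion]
    refine iSup_congr fun n => h _ _ (by positivity) ?_
    rw [div_lt_iff₀ (by positivity)]
    nlinarith [(Nat.cast_nonneg n : (0 : ℝ) ≤ n)]
  have hI : Iic x = Iic 0 ∪ Ioc 0 x := (Iic_union_Ioc_eq_Iic hx.le).symm
  have hdisj : Disjoint (Iic (0 : ℝ)) (Ioc 0 x) := by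
    rw [Set.disjoint_left]; intro y hy hy'; exact absurd hy'.1 (not_lt.2 hy)
  rw [hI, measure_union hdisj measurableSet_Ioc, measure_union hdisj measurableSet_Ioc, hμ, hν, key]

/-- The function `y ↦ ∫_y^∞ R(z)/z dπ(z)`. -/
def rateTail (R : ℝ → ℝ) (π : Measure ℝ) (y : ℝ) : ℝ≥0∞ :=
  ∫⁻ z in Ioi y, ENNReal.ofReal (R z / z) ∂π

theorem antitone_rateTail (R : ℝ → ℝ) (π : Measure ℝ) : Antitone (rateTail R π) :=
  fun _ _ h => lintegral_mono_set (Ioi_subset_Ioi h)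

theorem measurable_rateTail (R : ℝ → ℝ) (π : Measure ℝ) : Measurable (rateTail R π) :=
  (antitone_rateTail R π).measurable

namespace IsStationaryLaw

/-- Stationarity at the point `b` and time `log (b / a)` has first term `π (Iic a)`, which cancels;
the substitution `y = a e^s` turns the time integral into an integral over `(a, b]`. -/
theorem measure_Ioc {R : ℝ → ℝ} {π : Measure ℝ} (hπ : IsStationaryLaw R π) {a b : ℝ}
    (ha : 0 < a) (hab : a < b) :
    π (Ioc a b) = ∫⁻ y in Ioc a b, ENNReal.ofReal y * rateTail R π y := by
  have := hπ.isProbabilityMeasure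
  have hb : 0 < b := ha.trans hab
  have ht : 0 ≤ Real.log (b / a) := Real.log_nonneg ((one_le_div ha).2 hab.le)
  have hexp : Real.exp (Real.log (b / a)) = b / a := Real.exp_log (by positivity)
  have hfix := hπ.fixed (Real.log (b / a)) b ht hb.le
  have hs : ∀ s, Real.exp (s - Real.log (b / a)) * b = a * Real.exp s := fun s => by
    rw [Real.exp_sub, hexp]; field_simp
  have h0 : Real.exp (-Real.log (b / a)) * b = a := by
    have := hs 0
    simpa using this
  simp only [fragmentationOperator, hs, h0] at hfix
  have hI : Iic b = Iic a ∪ Ioc a b := (Iic_union_Ioc_eq_Iic hab.le).symm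
  rw [hI, measure_union (by
    rw [Set.disjoint_left]; intro x hx hx'; exact absurd hx'.1 (not_lt.2 hx)) measurableSet_Ioc]
    at hfix
  rw [(ENNReal.add_right_inj (measure_ne_top π _)).1 hfix]
  have hb' : b = a * Real.exp (Real.log (b / a)) := by rw [hexp]; field_simp
  conv_rhs => rw [hb']
  rw [setLIntegral_Ioc_mul_exp ha]
  refine lintegral_congr fun s => ?_
  rw [← mul_assoc, ← ENNReal.ofReal_mul (by positivity), sq]
  rfl

theorem eq_withDensity {R : ℝ → ℝ} {π : Measure ℝ} (hπ : IsStationaryLaw R π) :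
    π = (volume.restrict (Ioi 0)).withDensity
      (fun y => ENNReal.ofReal y * rateTail R π y) := by
  have := hπ.isProbabilityMeasure
  refine measure_eq_of_Ioc_pos hπ.null_nonpos ?_ fun a b ha hab => ?_
  · refine withDensity_absolutelyContinuous _ _ ?_
    rw [Measure.restrict_apply measurableSet_Iic, Iic_inter_Ioi, Ioc_self, measure_empty]
  · rw [withDensity_apply _ measurableSet_Ioc, Measure.restrict_restrict measurableSet_Ioc,
      inter_eq_left.2 (show Ioc a b ⊆ Ioi 0 from fun x hx => ha.trans hx.1)]
    exact hπ.measure_Ioc ha hab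

/-- The factor `z` of the density cancels the `1/z` in `rateTail`, leaving the integrated form of
`φ' = -R φ`. -/
theorem rateTail_eq {R : ℝ → ℝ} {π : Measure ℝ} (hπ : IsStationaryLaw R π) (hR : IsRate R)
    {y : ℝ} (hy : 0 ≤ y) :
    rateTail R π y = ∫⁻ z in Ioi y, ENNReal.ofReal (R z) * rateTail R π z := by
  have hm : Measurable fun z => ENNReal.ofReal (R z / z) := by
    have := hR.measurable; fun_prop
  have hm' : Measurable fun z => ENNReal.ofReal z * rateTail R π z := by
    have := measurable_rateTail R π; fun_prop
  conv_lhs => rw [rateTail, hπ.eq_withDensity]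
  rw [setLIntegral_withDensity_eq_setLIntegral_mul _ hm' hm measurableSet_Ioi,
    Measure.restrict_restrict measurableSet_Ioi, inter_eq_left.2 (Ioi_subset_Ioi hy)]
  refine setLIntegral_congr_fun measurableSet_Ioi fun z hz => ?_
  have hz' : 0 < z := hy.trans_lt hz
  simp only [Pi.mul_apply]
  rw [mul_right_comm, ← ENNReal.ofReal_mul hz'.le, mul_div_cancel₀ _ hz'.ne']

/-- By monotonicity an infinite value at `y` would persist on `(y/2, y]` and give that interval
infinite mass. -/
theorem rateTail_ne_top {R : ℝ → ℝ} {π : Measure ℝ} (hπ : IsStationaryLaw R π) {y : ℝ}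
    (hy : 0 < y) : rateTail R π y ≠ ∞ := by
  intro htop
  have := hπ.isProbabilityMeasure
  have h1 := hπ.measure_Ioc (half_pos hy) (half_lt_self hy)
  have h2 : ∫⁻ _ in Ioc (y / 2) y, ∞ ≤
      ∫⁻ z in Ioc (y / 2) y, ENNReal.ofReal z * rateTail R π z := by
    refine setLIntegral_mono' measurableSet_Ioc fun z hz => ?_
    have hz' : 0 < z := (half_pos hy).trans hz.1
    have hz2 : rateTail R π z = ∞ := top_le_iff.1 (htop ▸ antitone_rateTail R π hz.2)
    rw [hz2, ENNReal.mul_top]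
    simpa using hz'
  rw [← h1, setLIntegral_const, ENNReal.top_mul] at h2
  · exact absurd (top_le_iff.1 h2) (measure_ne_top π _)
  · rw [Real.volume_Ioc]
    simp [hy]

/-- The product `e^H φ` is absolutely continuous with zero derivative almost everywhere, because `φ'
= -R φ`. In the proof `φ` is rewritten as a constant minus a primitive, which makes its absolute
continuity visible. -/
theorem exp_mul_rateTail_eq {R : ℝ → ℝ} {π : Measure ℝ} (hπ : IsStationaryLaw R π)
    (hR : IsRate R) {a b : ℝ} (ha : 0 < a) (hab : a ≤ b) :
    Real.exp (cumulative R a) * (rateTail R π a).toReal =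
      Real.exp (cumulative R b) * (rateTail R π b).toReal := by
  set φ : ℝ → ℝ := fun y => (rateTail R π y).toReal with hφ
  have hmeas : Measurable fun z => ENNReal.ofReal (R z) * rateTail R π z := by
    have := hR.measurable; have := measurable_rateTail R π; fun_prop
  have hsplit : ∀ x, a ≤ x → rateTail R π a =
      (∫⁻ z in Ioc a x, ENNReal.ofReal (R z) * rateTail R π z) + rateTail R π x := by
    intro x hx
    rw [hπ.rateTail_eq hR ha.le, hπ.rateTail_eq hR (ha.le.trans hx), ← Ioc_union_Ioi_eq_Ioi hx,
      lintegral_union measurableSet_Ioi]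
    rw [Set.disjoint_left]; intro z hz hz'; exact absurd hz.2 (not_le.2 hz')
  have hfin : ∀ x, a ≤ x → ∫⁻ z in Ioc a x, ENNReal.ofReal (R z) * rateTail R π z ≠ ∞ := by
    intro x hx h
    have := hsplit x hx
    rw [h, top_add] at this
    exact hπ.rateTail_ne_top ha this
  have hcongr : ∀ x, ∫⁻ z in Ioc a x, ENNReal.ofReal (R z * φ z) =
      ∫⁻ z in Ioc a x, ENNReal.ofReal (R z) * rateTail R π z := fun x => by
    refine setLIntegral_congr_fun measurableSet_Ioc fun z hz => ?_
    simp only [hφ]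
    rw [ENNReal.ofReal_mul (hR.nonneg z), ENNReal.ofReal_toReal
      (hπ.rateTail_ne_top (ha.trans hz.1))]
  have hφm : Measurable fun z => R z * φ z := by
    have := hR.measurable; have := measurable_rateTail R π; fun_prop
  have hnn : ∀ z, 0 ≤ R z * φ z := fun z => mul_nonneg (hR.nonneg z) ENNReal.toReal_nonneg
  have hint : IntervalIntegrable (fun z => R z * φ z) volume a b := by
    rw [intervalIntegrable_iff_integrableOn_Ioc_of_le hab]
    refine ⟨hφm.aestronglyMeasurable, ?_⟩
    rw [hasFiniteIntegral_iff_ofReal (Eventually.of_forall hnn), hcongr]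
    exact (hfin b hab).lt_top
  have hφeq : ∀ x ∈ uIcc a b, φ a - ∫ z in a..x, R z * φ z = φ x := by
    intro x hx
    rw [uIcc_of_le hab] at hx
    rw [intervalIntegral.integral_of_le hx.1, integral_eq_lintegral_of_nonneg_ae
      (Eventually.of_forall hnn) hφm.aestronglyMeasurable, hcongr]
    simp only [hφ]
    rw [hsplit x hx.1, ENNReal.toReal_add (hfin x hx.1)
      (hπ.rateTail_ne_top (ha.trans_le hx.1))]
    ring
  have hac : AbsolutelyContinuousOnInterval
      (fun x => Real.exp (1 * cumulative R x) * (φ a - ∫ z in a..x, R z * φ z)) a b := by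
    refine (hR.absolutelyContinuous_exp_cumulative a b 1).fun_mul ?_
    refine AbsolutelyContinuousOnInterval.fun_sub ?_
      (hint.absolutelyContinuousOnInterval_intervalIntegral left_mem_uIcc)
    exact ContDiffOn.absolutelyContinuousOnInterval contDiffOn_const
  obtain ⟨C, hC⟩ := hac.const_of_ae_hasDerivAt_zero (by
    filter_upwards [hR.ae_hasDerivAt_cumulative, hint.ae_hasDerivAt_integral] with x h1 h2 hx
    have h3 := (h1.const_mul 1).exp.mul ((h2 hx a left_mem_uIcc).const_sub (φ a))
    convert! h3 using 1
    rw [hφeq x hx]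
    ring)
  have h1 := hC a left_mem_uIcc
  have h2 := hC b right_mem_uIcc
  rw [hφeq a left_mem_uIcc, one_mul] at h1
  rw [hφeq b right_mem_uIcc, one_mul] at h2
  rw [h1, h2]

/-- A stationary law has the density `c x exp (-∫_0^x R(u) du)`, and the cumulative rate diverges. -/
theorem exists_eq_explicitLaw {R : ℝ → ℝ} {π : Measure ℝ} (hπ : IsStationaryLaw R π)
    (hR : IsRate R) :
    ∃ c, 0 < c ∧ Tendsto (cumulative R) atTop atTop ∧ π = explicitLaw R c := by
  have := hπ.isProbabilityMeasure
  set c : ℝ := Real.exp (cumulative R 1) * (rateTail R π 1).toReal with hc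
  have hφ : ∀ y, 0 < y → (rateTail R π y).toReal = c * Real.exp (-cumulative R y) := by
    intro y hy
    have h : Real.exp (cumulative R y) * (rateTail R π y).toReal = c := by
      rcases le_total y 1 with h | h
      · exact hπ.exp_mul_rateTail_eq hR hy h
      · exact (hπ.exp_mul_rateTail_eq hR one_pos h).symm
    rw [← h, Real.exp_neg]
    field_simp
  have heq : π = explicitLaw R c := by
    conv_lhs => rw [hπ.eq_withDensity]
    refine withDensity_congr_ae ?_
    filter_upwards [ae_restrict_mem measurableSet_Ioi] with y hy
    have hy' : (0 : ℝ) < y := hy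
    rw [← ENNReal.ofReal_toReal (hπ.rateTail_ne_top hy'), hφ y hy', ← ENNReal.ofReal_mul hy'.le]
    congr 1; ring
  have hc0 : 0 < c := by
    rcases (show 0 ≤ c by positivity).eq_or_lt with h | h
    · exfalso
      have h1 : π univ = 1 := measure_univ
      rw [heq, ← h] at h1
      simp [explicitLaw] at h1
    · exact h
  refine ⟨c, hc0, ?_, heq⟩
  rcases tendsto_atTop_of_monotone hR.monotone_cumulative with h | ⟨l, hl⟩
  · exact h
  exfalso
  -- A bounded `H` would keep the density above `c e^{-l}` on `(1, ∞)`.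
  have hle : ∀ y, cumulative R y ≤ l := hR.monotone_cumulative.ge_of_tendsto hl
  have h1 : π (Ioi 1) = ∞ := by
    rw [heq, explicitLaw, withDensity_apply _ measurableSet_Ioi,
      Measure.restrict_restrict measurableSet_Ioi,
      inter_eq_left.2 (Ioi_subset_Ioi zero_le_one), ← top_le_iff]
    calc ∞ = ∫⁻ _ in Ioi (1 : ℝ), ENNReal.ofReal (c * Real.exp (-l)) := by
          rw [setLIntegral_const, Real.volume_Ioi, ENNReal.mul_top]
          simp only [ne_eq, ENNReal.ofReal_eq_zero, not_le]
          positivity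
      _ ≤ _ := by
          refine setLIntegral_mono' measurableSet_Ioi fun y hy => ENNReal.ofReal_le_ofReal ?_
          have hy' : (1 : ℝ) < y := hy
          have h2 : Real.exp (-l) ≤ Real.exp (-cumulative R y) :=
            Real.exp_le_exp.2 (neg_le_neg (hle y))
          have h3 : c ≤ c * y := by nlinarith
          exact mul_le_mul h3 h2 (Real.exp_pos _).le (by positivity)
  exact measure_ne_top π _ h1

end IsStationaryLaw

/-! ### The flow with killing and the fragmentation kernel -/

/-- The expectation of `g` at the position at time `s`, on the event of no jump before `s`. -/
def flow (R : ℝ → ℝ) (s : ℝ) (g : ℝ → ℝ≥0∞) (x : ℝ) : ℝ≥0∞ :=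
  ENNReal.ofReal (survivor R x s) * g (x * Real.exp s)

/-- The expectation of `g` at the position after a jump from `x`. -/
def jump (g : ℝ → ℝ≥0∞) (x : ℝ) : ℝ≥0∞ := ∫⁻ u, g (x * √u) ∂uniform01

/-- The jump kernel, weighted by the jump rate `x R(x)`. -/
def gain (R : ℝ → ℝ) (g : ℝ → ℝ≥0∞) (x : ℝ) : ℝ≥0∞ := ENNReal.ofReal (x * R x) * jump g x

theorem image_div_sq_Ioo {x : ℝ} (hx : 0 < x) : (fun y => (y / x) ^ 2) '' Ioo 0 x = Ioo 0 1 := by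
  ext u
  simp only [mem_image, mem_Ioo]
  constructor
  · rintro ⟨y, ⟨h0, h1⟩, rfl⟩
    have h2 : y / x < 1 := (div_lt_one hx).2 h1
    have h3 : 0 < y / x := by positivity
    exact ⟨by positivity, by nlinarith⟩
  · rintro ⟨h0, h1⟩
    have h2 : √u < 1 := by rw [Real.sqrt_lt' one_pos]; simpa using h1
    refine ⟨x * √u, ⟨by positivity, by nlinarith⟩, ?_⟩
    rw [mul_div_cancel_left₀ _ hx.ne', Real.sq_sqrt h0.le]

theorem hasDerivWithinAt_div_sq {x : ℝ} (s : Set ℝ) (y : ℝ) :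
    HasDerivWithinAt (fun y => (y / x) ^ 2) (2 * y / x ^ 2) s y := by
  have h := (((hasDerivAt_id y).div_const x).pow 2).hasDerivWithinAt (s := s)
  convert! h using 1
  simp only [id]
  push_cast
  ring

theorem injOn_div_sq {x : ℝ} (hx : 0 < x) : InjOn (fun y => (y / x) ^ 2) (Ioo 0 x) := by
  intro y hy z hz h
  have hy' := hy.1; have hz' := hz.1
  have h2 : y / x = z / x := (pow_left_inj₀ (by positivity) (by positivity) two_ne_zero).1 h
  field_simp at h2
  exact h2

/-- Substitution `u = (y / x)²`: for uniform `u`, the position `x √u` has density `2y/x²` on `(0,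
x)`. -/
theorem jump_eq {x : ℝ} (hx : 0 < x) (g : ℝ → ℝ≥0∞) :
    jump g x = ∫⁻ y in Ioo 0 x, ENNReal.ofReal (2 * y / x ^ 2) * g y := by
  rw [jump, uniform01, ← image_div_sq_Ioo hx, lintegral_image_eq_lintegral_abs_deriv_mul
    measurableSet_Ioo (fun y _ => hasDerivWithinAt_div_sq _ y) (injOn_div_sq hx)]
  refine setLIntegral_congr_fun measurableSet_Ioo fun y hy => ?_
  have hy' := hy.1
  rw [abs_of_pos (by positivity), Real.sqrt_sq (by positivity), mul_div_cancel₀ _ hx.ne']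

theorem measurable_jump {g : ℝ → ℝ≥0∞} (hg : Measurable g) : Measurable (jump g) := by
  unfold jump
  refine Measurable.lintegral_prod_right' (f := fun p : ℝ × ℝ => g (p.1 * √p.2)) ?_
  fun_prop

theorem measurable_gain {R : ℝ → ℝ} (hR : IsRate R) {g : ℝ → ℝ≥0∞} (hg : Measurable g) :
    Measurable (gain R g) := by
  have := hR.measurable
  have := measurable_jump hg
  unfold gain
  fun_prop

theorem IsRate.measurable_survivor {R : ℝ → ℝ} (hR : IsRate R) :
    Measurable (fun p : ℝ × ℝ => survivor R p.1 p.2) := by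
  simp only [hR.survivor_eq]
  have := hR.measurable_cumulative
  fun_prop

theorem IsRate.measurable_survivor_left {R : ℝ → ℝ} (hR : IsRate R) (t : ℝ) :
    Measurable (fun x : ℝ => survivor R x t) :=
  hR.measurable_survivor.comp (measurable_id.prodMk measurable_const)

theorem IsRate.measurable_density {R : ℝ → ℝ} (hR : IsRate R) (c : ℝ) :
    Measurable fun x => ENNReal.ofReal (c * x * Real.exp (-cumulative R x)) := by
  have := hR.measurable_cumulative
  fun_prop

theorem measurable_flow {R : ℝ → ℝ} (hR : IsRate R) (s : ℝ) {g : ℝ → ℝ≥0∞} (hg : Measurable g) :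
    Measurable (flow R s g) := by
  have := hR.measurable_survivor_left s
  unfold flow
  fun_prop

theorem lintegral_explicitLaw {R : ℝ → ℝ} (hR : IsRate R) (c : ℝ) {g : ℝ → ℝ≥0∞}
    (hg : Measurable g) :
    ∫⁻ x, g x ∂(explicitLaw R c) =
      ∫⁻ x in Ioi 0, ENNReal.ofReal (c * x * Real.exp (-cumulative R x)) * g x :=
  lintegral_withDensity_eq_lintegral_mul _ (hR.measurable_density c) hg

theorem setLIntegral_Ioi_mul_exp (s : ℝ) (G : ℝ → ℝ≥0∞) :
    ∫⁻ y in Ioi 0, G y = ∫⁻ x in Ioi 0, ENNReal.ofReal (Real.exp s) * G (x * Real.exp s) := by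
  have himg : (fun x => x * Real.exp s) '' Ioi 0 = Ioi 0 := by
    ext y
    simp only [mem_image, mem_Ioi]
    constructor
    · rintro ⟨x, hx, rfl⟩
      positivity
    · intro hy
      exact ⟨y * Real.exp (-s), by positivity, by rw [mul_assoc, ← Real.exp_add]; simp⟩
  conv_lhs => rw [← himg]
  rw [lintegral_image_eq_lintegral_abs_deriv_mul measurableSet_Ioi
    (f' := fun _ => Real.exp s)
    (fun x _ => (by simpa using (hasDerivAt_id x).mul_const (Real.exp s) :
      HasDerivAt (fun x => x * Real.exp s) (Real.exp s) x).hasDerivWithinAt)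
    (fun x _ y _ h => mul_right_cancel₀ (Real.exp_pos s).ne' h)]
  simp only [Real.abs_exp]

/-- The survivor function transports the exponential part of the density, `S_x(s) e^{-H(x)} =
e^{-H(x e^s)}`, and `x dx = e^{-2s} y dy` for `y = x e^s`. -/
theorem lintegral_flow {R : ℝ → ℝ} (hR : IsRate R) (c s : ℝ) (hc : 0 ≤ c) {g : ℝ → ℝ≥0∞}
    (hg : Measurable g) :
    ∫⁻ x, flow R s g x ∂(explicitLaw R c) =
      ENNReal.ofReal (Real.exp (-2 * s)) * ∫⁻ x, g x ∂(explicitLaw R c) := by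
  rw [lintegral_explicitLaw hR c (measurable_flow hR s hg), lintegral_explicitLaw hR c hg]
  conv_rhs => rw [setLIntegral_Ioi_mul_exp s,
    ← lintegral_const_mul' _ _ ENNReal.ofReal_ne_top]
  refine setLIntegral_congr_fun measurableSet_Ioi fun x hx => ?_
  have hx' : (0 : ℝ) < x := hx
  simp only [flow, hR.survivor_eq]
  rw [← mul_assoc, ← mul_assoc, ← mul_assoc, ← ENNReal.ofReal_mul (by positivity),
    ← ENNReal.ofReal_mul (by positivity), ← ENNReal.ofReal_mul (by positivity)]
  congr 2
  rw [show -2 * s = -s + -s by ring, Real.exp_add, Real.exp_sub, Real.exp_neg, Real.exp_neg,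
    Real.exp_neg]
  field_simp

/-- After exchanging the integrals, the powers of `x` cancel and the inner integral is `∫_y^∞ R
e^{-H} = e^{-H(y)}`, by divergence of `H`. The `2` is that of the jump density `2y/x²`. -/
theorem lintegral_gain {R : ℝ → ℝ} (hR : IsRate R) (hH : Tendsto (cumulative R) atTop atTop)
    (c : ℝ) (hc : 0 ≤ c) {g : ℝ → ℝ≥0∞} (hg : Measurable g) :
    ∫⁻ x, gain R g x ∂(explicitLaw R c) = 2 * ∫⁻ x, g x ∂(explicitLaw R c) := by
  have hRm := hR.measurable
  have hHm := hR.measurable_cumulative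
  rw [lintegral_explicitLaw hR c (measurable_gain hR hg), lintegral_explicitLaw hR c hg]
  set k : ℝ → ℝ≥0∞ := fun x => ENNReal.ofReal (R x * Real.exp (-cumulative R x)) with hk
  have hkm : Measurable k := by fun_prop
  calc _ = ∫⁻ x in Ioi 0, ∫⁻ y in Ioi 0,
        (Ioi y).indicator k x * (ENNReal.ofReal (2 * c * y) * g y) := by
        refine setLIntegral_congr_fun measurableSet_Ioi fun x hx => ?_
        have hx' : (0 : ℝ) < x := hx
        simp only [gain]
        rw [jump_eq hx', ← mul_assoc, ← ENNReal.ofReal_mul (by positivity),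
          ← lintegral_const_mul' _ _ ENNReal.ofReal_ne_top, ← Ioi_inter_Iio,
          inter_comm, ← Measure.restrict_restrict measurableSet_Iio,
          ← lintegral_indicator measurableSet_Iio]
        refine setLIntegral_congr_fun measurableSet_Ioi fun y hy => ?_
        have hy' : (0 : ℝ) < y := hy
        by_cases hxy : y < x
        · rw [indicator_of_mem (show y ∈ Iio x from hxy),
            indicator_of_mem (show x ∈ Ioi y from hxy), ← mul_assoc, ← mul_assoc, ← mul_assoc,
            show k x = ENNReal.ofReal (R x * Real.exp (-cumulative R x)) from rfl,
            ← ENNReal.ofReal_mul (by have := hR.nonneg x; positivity),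
            ← ENNReal.ofReal_mul (mul_nonneg (hR.nonneg x) (Real.exp_pos _).le)]
          congr 2
          field_simp
        · rw [indicator_of_notMem (show y ∉ Iio x from hxy),
            indicator_of_notMem (show x ∉ Ioi y from hxy), zero_mul]
    _ = ∫⁻ y in Ioi 0, ∫⁻ x in Ioi 0,
        (Ioi y).indicator k x * (ENNReal.ofReal (2 * c * y) * g y) := by
        refine lintegral_lintegral_swap ?_
        refine Measurable.aemeasurable ?_
        have hs : MeasurableSet {p : ℝ × ℝ | p.2 < p.1} :=
          measurableSet_lt measurable_snd measurable_fst
        have h1 : Measurable (fun p : ℝ × ℝ => {p : ℝ × ℝ | p.2 < p.1}.indicator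
          (fun p => k p.1) p) := (hkm.comp measurable_fst).indicator hs
        exact h1.mul (by fun_prop)
    _ = _ := by
        rw [← lintegral_const_mul' _ _ ENNReal.ofNat_ne_top]
        refine setLIntegral_congr_fun measurableSet_Ioi fun y hy => ?_
        have hy' : (0 : ℝ) < y := hy
        rw [lintegral_mul_const _ (hkm.indicator measurableSet_Ioi),
          lintegral_indicator measurableSet_Ioi, Measure.restrict_restrict measurableSet_Ioi,
          inter_eq_left.2 (Ioi_subset_Ioi hy'.le), hR.setLIntegral_Ioi_rate_mul_exp hH,
          ← mul_assoc, ← mul_assoc, ← ENNReal.ofReal_mul (by positivity)]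
        congr 1
        rw [show (2 : ℝ≥0∞) = ENNReal.ofReal 2 by simp, ← ENNReal.ofReal_mul (by positivity)]
        congr 1
        ring

/-! ### The sequence of uniform variables -/

instance : IsProbabilityMeasure uniformSeq := by unfold uniformSeq; infer_instance

/-- The sequence `a, ω 0, ω 1, …`. -/
def seqCons (a : ℝ) (ω : ℕ → ℝ) : ℕ → ℝ
  | 0 => a
  | n + 1 => ω n

theorem measurable_seqCons : Measurable fun p : ℝ × (ℕ → ℝ) => seqCons p.1 p.2 := by
  refine measurable_pi_iff.2 fun n => ?_
  cases n with
  | zero => exact measurable_fst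
  | succ n => exact (measurable_pi_apply n).comp measurable_snd

theorem map_seqCons :
    (uniform01.prod uniformSeq).map (fun p => seqCons p.1 p.2) = uniformSeq := by
  refine Measure.eq_infinitePi _ fun s t ht => ?_
  obtain ⟨n, hn⟩ := s.exists_nat_subset_range
  classical
  -- Padding with `univ` turns the index set into an initial segment, on which removing the first
  -- coordinate is a shift.
  set t' : ℕ → Set ℝ := fun i => if i ∈ s then t i else univ with ht'
  have hm' : ∀ i, MeasurableSet (t' i) := fun i => by
    simp only [ht']; split_ifs
    · exact ht i
    · exact MeasurableSet.univ
  have hset : (Set.pi (s : Set ℕ) t) = Set.pi (Finset.range (n + 1) : Set ℕ) t' := by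
    ext ω
    simp only [Set.mem_pi, Finset.mem_coe, ht', Finset.mem_range]
    constructor
    · intro h i _
      split_ifs with hi
      · exact h i hi
      · trivial
    · intro h i hi
      have := h i ((Finset.mem_range.1 (hn hi)).trans (Nat.lt_succ_self n))
      rwa [if_pos hi] at this
  have hprod : ∏ i ∈ s, uniform01 (t i) = ∏ i ∈ Finset.range (n + 1), uniform01 (t' i) := by
    have h1 : s ⊆ Finset.range (n + 1) :=
      hn.trans (Finset.range_mono (Nat.le_succ n))
    rw [← Finset.prod_subset h1 (f := fun i => uniform01 (t' i))]
    · exact Finset.prod_congr rfl fun i hi => by simp [ht', hi]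
    · intro i _ hi
      simp [ht', hi]
  have hpre : (fun p : ℝ × (ℕ → ℝ) => seqCons p.1 p.2) ⁻¹'
      Set.pi (Finset.range (n + 1) : Set ℕ) t' =
      t' 0 ×ˢ Set.pi (Finset.range n : Set ℕ) (fun i => t' (i + 1)) := by
    ext p
    simp only [mem_preimage, Set.mem_pi, Finset.mem_coe, Finset.mem_range, mem_prod]
    constructor
    · intro h
      exact ⟨h 0 (Nat.succ_pos n), fun i hi => h (i + 1) (Nat.succ_lt_succ hi)⟩
    · rintro ⟨h0, h1⟩ i hi
      cases i with
      | zero => exact h0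
      | succ i => exact h1 i (Nat.lt_of_succ_lt_succ hi)
  rw [hset, hprod, Measure.map_apply measurable_seqCons
    (MeasurableSet.pi (Finset.countable_toSet _) fun i _ => hm' i), hpre, Measure.prod_prod,
    uniformSeq, Measure.infinitePi_pi _ (fun i _ => hm' (i + 1)), Finset.prod_range_succ', mul_comm]

/-- The first jump uses exactly the first two uniforms, one for its time and one for its size; the
rest is again an i.i.d. sequence. -/
theorem lintegral_uniformSeq {G : (ℕ → ℝ) → ℝ≥0∞} (hG : Measurable G) :
    ∫⁻ ω, G ω ∂uniformSeq =
      ∫⁻ u, ∫⁻ v, ∫⁻ ω, G (seqCons u (seqCons v ω)) ∂uniformSeq ∂uniform01 ∂uniform01 := by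
  have key : ∀ {G : (ℕ → ℝ) → ℝ≥0∞}, Measurable G → ∫⁻ ω, G ω ∂uniformSeq =
      ∫⁻ u, ∫⁻ ω, G (seqCons u ω) ∂uniformSeq ∂uniform01 := fun {G} hG => by
    conv_lhs => rw [← map_seqCons]
    rw [lintegral_map hG measurable_seqCons,
      lintegral_prod (fun p : ℝ × (ℕ → ℝ) => G (seqCons p.1 p.2))
        (hG.comp measurable_seqCons).aemeasurable]
  rw [key hG]
  refine lintegral_congr fun u => key (hG.comp (measurable_seqCons.comp
    (measurable_const.prodMk measurable_id)))

theorem ae_uniform01_mem : ∀ᵐ u ∂uniform01, u ∈ Ioo (0 : ℝ) 1 := ae_restrict_mem measurableSet_Ioo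

/-! ### The time of the first jump -/

namespace IsRate

theorem continuous_survivor {R : ℝ → ℝ} (hR : IsRate R) :
    Continuous fun p : ℝ × ℝ => survivor R p.1 p.2 := by
  simp only [hR.survivor_eq]
  have := hR.continuous_cumulative
  fun_prop

theorem antitone_survivor {R : ℝ → ℝ} (hR : IsRate R) {z : ℝ} (hz : 0 ≤ z) :
    Antitone (survivor R z) := fun s t hst => by
  rw [hR.survivor_eq, hR.survivor_eq]
  have := hR.monotone_cumulative (mul_le_mul_of_nonneg_left (Real.exp_le_exp.2 hst) hz)
  exact Real.exp_le_exp.2 (by linarith)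

theorem survivor_zero {R : ℝ → ℝ} (hR : IsRate R) (z : ℝ) : survivor R z 0 = 1 := by
  simp [hR.survivor_eq]

theorem survivor_pos {R : ℝ → ℝ} (z t : ℝ) : 0 < survivor R z t := Real.exp_pos _

theorem survivor_le_one {R : ℝ → ℝ} (hR : IsRate R) {z t : ℝ} (hz : 0 ≤ z) (ht : 0 ≤ t) :
    survivor R z t ≤ 1 := by
  rw [← hR.survivor_zero z]
  exact hR.antitone_survivor hz ht

theorem survivorInv_lt_iff {R : ℝ → ℝ} {z u : ℝ} {c : ℝ≥0∞} :
    survivorInv R z u < c ↔ ∃ t : ℝ≥0, survivor R z t ≤ u ∧ (t : ℝ≥0∞) < c := by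
  simp only [survivorInv, iInf_lt_iff, exists_prop]

theorem survivorInv_le {R : ℝ → ℝ} {z u : ℝ} {t : ℝ≥0} (h : survivor R z t ≤ u) :
    survivorInv R z u ≤ t := iInf₂_le t h

/-- Continuity of the survivor function excludes an infimum that is approached but not attained. -/
theorem survivorInv_le_iff {R : ℝ → ℝ} (hR : IsRate R) {z u : ℝ} (hz : 0 ≤ z) {t : ℝ≥0} :
    survivorInv R z u ≤ t ↔ survivor R z t ≤ u := by
  refine ⟨fun h => ?_, survivorInv_le⟩
  by_contra! hlt
  have hcont : ContinuousAt (fun s => survivor R z s) (t : ℝ) :=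
    (hR.continuous_survivor.comp (Continuous.prodMk_right z)).continuousAt
  obtain ⟨δ, hδ, hball⟩ := Metric.eventually_nhds_iff.1 (hcont.eventually_const_lt hlt)
  have hlt' : (t : ℝ≥0∞) < (t + (δ / 2).toNNReal : ℝ≥0) := by
    rw [ENNReal.coe_lt_coe]
    exact lt_add_of_pos_right t (Real.toNNReal_pos.2 (half_pos hδ))
  obtain ⟨s, hs, hs'⟩ := survivorInv_lt_iff.1 (h.trans_lt hlt')
  rw [ENNReal.coe_lt_coe, ← NNReal.coe_lt_coe] at hs'
  have h1 := hball (y := (t : ℝ) + δ / 2) (by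
    rw [Real.dist_eq, add_sub_cancel_left, abs_of_pos (half_pos hδ)]; exact half_lt_self hδ)
  have h2 := hR.antitone_survivor hz hs'.le
  rw [NNReal.coe_add, Real.coe_toNNReal _ (half_pos hδ).le] at h2
  linarith

/-- A strict sublevel set is a countable union, over rational time bounds `q`, of projections along
the compact `[0, q]` of closed sets, and such projections are closed. -/
theorem measurable_survivorInv {R : ℝ → ℝ} (hR : IsRate R) :
    Measurable fun p : ℝ × ℝ => survivorInv R p.1 p.2 := by
  refine measurable_of_Iio fun c => ?_
  have hset : (fun p : ℝ × ℝ => survivorInv R p.1 p.2) ⁻¹' Iio c =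
      ⋃ q : {q : ℚ // ENNReal.ofReal q < c},
        Prod.snd '' {x : Icc (0 : ℝ) q × (ℝ × ℝ) | survivor R x.2.1 x.1 ≤ x.2.2} := by
    ext p
    simp only [mem_preimage, mem_Iio, survivorInv_lt_iff, mem_iUnion, mem_image, mem_ofPred_eq]
    constructor
    · rintro ⟨t, ht, htc⟩
      obtain ⟨q, hq0, htq, hqc⟩ := ENNReal.lt_iff_exists_rat_btwn.1 htc
      refine ⟨⟨q, hqc⟩, ⟨⟨⟨t, t.2, ?_⟩, p⟩, ht, rfl⟩⟩
      have h1 : (t : ℝ≥0∞) < ENNReal.ofReal q := htq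
      rw [ENNReal.lt_ofReal_iff_toReal_lt ENNReal.coe_ne_top] at h1
      exact h1.le
    · rintro ⟨⟨q, hqc⟩, ⟨⟨⟨t, ht0, htq⟩, p'⟩, ht, rfl⟩⟩
      refine ⟨t.toNNReal, by rwa [Real.coe_toNNReal _ ht0], lt_of_le_of_lt ?_ hqc⟩
      exact ENNReal.ofReal_le_ofReal htq
  rw [hset]
  refine MeasurableSet.iUnion fun q => IsClosed.measurableSet ?_
  refine isClosedMap_snd_of_compactSpace _ (isClosed_le ?_ (by fun_prop))
  exact hR.continuous_survivor.comp (f := fun x : Icc (0 : ℝ) q.1 × (ℝ × ℝ) =>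
    ((x.2.1, (x.1 : ℝ)) : ℝ × ℝ)) (by fun_prop)

theorem survivorInv_ne_top {R : ℝ → ℝ} (hR : IsRate R)
    (hH : Tendsto (cumulative R) atTop atTop) {z u : ℝ} (hz : 0 < z) (hu : 0 < u) :
    survivorInv R z u ≠ ∞ := by
  have h1 : Tendsto (fun t => survivor R z t) atTop (𝓝 0) := by
    simp only [hR.survivor_eq]
    refine Real.tendsto_exp_atBot.comp ?_
    refine tendsto_atBot_add_const_left _ _ (tendsto_neg_atTop_atBot.comp (hH.comp ?_))
    exact Real.tendsto_exp_atTop.const_mul_atTop hz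
  obtain ⟨t, ht, ht0⟩ := ((h1.eventually_lt_const hu).and (eventually_ge_atTop 0)).exists
  rw [← Real.coe_toNNReal t ht0] at ht
  exact ((survivorInv_le ht.le).trans_lt ENNReal.coe_lt_top).ne

/-- The density of the first jump time of the process started at `x`. -/
def firstJumpDensity (R : ℝ → ℝ) (x s : ℝ) : ℝ≥0∞ :=
  ENNReal.ofReal (x * Real.exp s * R (x * Real.exp s) * survivor R x s)

theorem measurable_firstJumpDensity {R : ℝ → ℝ} (hR : IsRate R) (x : ℝ) :
    Measurable (firstJumpDensity R x) := by
  have h1 : Measurable (survivor R x) :=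
    hR.measurable_survivor.comp (measurable_const.prodMk measurable_id)
  have := hR.measurable
  unfold firstJumpDensity
  fun_prop

theorem setLIntegral_firstJumpDensity {R : ℝ → ℝ} (hR : IsRate R) {x t : ℝ} (hx : 0 < x)
    (ht : 0 ≤ t) :
    ∫⁻ s in Ioc 0 t, firstJumpDensity R x s = ENNReal.ofReal (1 - survivor R x t) := by
  have hm : Measurable fun y => ENNReal.ofReal (R y * Real.exp (-cumulative R y)) := by
    have := hR.measurable; have := hR.measurable_cumulative; fun_prop
  have hle : x ≤ x * Real.exp t := le_mul_of_one_le_right hx.le (Real.one_le_exp ht)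
  calc _ = ∫⁻ y in Ioc x (x * Real.exp t),
        ENNReal.ofReal (Real.exp (cumulative R x)) *
          ENNReal.ofReal (R y * Real.exp (-cumulative R y)) := by
        rw [setLIntegral_Ioc_mul_exp hx]
        refine lintegral_congr fun s => ?_
        rw [firstJumpDensity, hR.survivor_eq, ← ENNReal.ofReal_mul (by positivity),
          ← ENNReal.ofReal_mul (by positivity), sub_eq_add_neg, Real.exp_add]
        congr 1
        ring
    _ = _ := by
        rw [lintegral_const_mul _ hm, hR.setLIntegral_Ioc_rate_mul_exp hle,
          ← ENNReal.ofReal_mul (by positivity), mul_sub, ← Real.exp_add, ← Real.exp_add,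
          hR.survivor_eq, sub_eq_add_neg (cumulative R x), add_neg_cancel, Real.exp_zero]

theorem uniform01_Ici {a : ℝ} (h0 : 0 < a) : uniform01 (Ici a) = ENNReal.ofReal (1 - a) := by
  have h : Ici a ∩ Ioo 0 1 = Ico a 1 := by
    ext u; simp only [mem_inter_iff, mem_Ici, mem_Ioo, mem_Ico]
    exact ⟨fun h => ⟨h.1, h.2.2⟩, fun h => ⟨h.1, h0.trans_le h.1, h.2⟩⟩
  rw [uniform01, Measure.restrict_apply measurableSet_Ici, h, Real.volume_Ico]

/-- Inverse transform sampling. Divergence of `H` makes the jump time finite for `u > 0`, so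
`toReal` does not send an infinite time to `0`. -/
theorem map_survivorInv {R : ℝ → ℝ} (hR : IsRate R)
    (hH : Tendsto (cumulative R) atTop atTop) {x : ℝ} (hx : 0 < x) :
    uniform01.map (fun u => (survivorInv R x u).toReal) =
      (volume.restrict (Ioi 0)).withDensity (firstJumpDensity R x) := by
  have hm : Measurable fun u => (survivorInv R x u).toReal :=
    (hR.measurable_survivorInv.comp (measurable_const.prodMk measurable_id)).ennreal_toReal
  have : IsProbabilityMeasure (uniform01.map (fun u => (survivorInv R x u).toReal)) :=
    Measure.isProbabilityMeasure_map hm.aemeasurable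
  refine Measure.ext_of_Iic _ _ fun t => ?_
  rw [Measure.map_apply hm measurableSet_Iic, withDensity_apply _ measurableSet_Iic,
    Measure.restrict_restrict measurableSet_Iic, inter_comm, Ioi_inter_Iic]
  rcases lt_or_ge t 0 with ht | ht
  · rw [Ioc_eq_empty (not_lt.2 ht.le), Measure.restrict_empty, lintegral_zero_measure]
    convert! measure_empty (μ := uniform01)
    ext u
    simpa using ht.trans_le ENNReal.toReal_nonneg
  · rw [hR.setLIntegral_firstJumpDensity hx ht, ← uniform01_Ici (survivor_pos x t)]
    refine measure_congr ?_
    filter_upwards [ae_uniform01_mem] with u hu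
    refine propext ?_
    change (survivorInv R x u).toReal ≤ t ↔ survivor R x t ≤ u
    have h := hR.survivorInv_le_iff (u := u) hx.le (t := t.toNNReal)
    rw [Real.coe_toNNReal t ht] at h
    rw [← h]
    exact (ENNReal.le_ofReal_iff_toReal_le (hR.survivorInv_ne_top hH hx hu.1) ht).symm

end IsRate

/-! ### Decomposition at the first jump -/

theorem jumpProd_nonneg (ω : ℕ → ℝ) (k : ℕ) : 0 ≤ jumpProd ω k :=
  Finset.prod_nonneg fun _ _ => Real.sqrt_nonneg _

theorem measurable_jumpProd (k : ℕ) : Measurable fun ω => jumpProd ω k := by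
  unfold jumpProd
  exact Finset.measurable_prod _ fun j _ => (measurable_pi_apply (2 * j + 1)).sqrt

theorem jumpProd_seqCons (u v : ℝ) (ω : ℕ → ℝ) (k : ℕ) :
    jumpProd (seqCons u (seqCons v ω)) (k + 1) = √v * jumpProd ω k := by
  unfold jumpProd
  rw [Finset.prod_range_succ', mul_comm]
  rfl

theorem jumpTime_mono (R : ℝ → ℝ) (x : ℝ) (ω : ℕ → ℝ) : Monotone (jumpTime R x ω) :=
  monotone_nat_of_le_succ fun _ => le_self_add

theorem measurable_jumpTime {R : ℝ → ℝ} (hR : IsRate R) (k : ℕ) :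
    Measurable fun p : ℝ × (ℕ → ℝ) => jumpTime R p.1 p.2 k := by
  induction k with
  | zero => exact measurable_const
  | succ k ih =>
    simp only [jumpTime]
    have h1 := ih.ennreal_toReal
    have h2 := measurable_jumpProd k
    have h3 : Measurable fun p : ℝ × (ℕ → ℝ) =>
        (p.1 * Real.exp (jumpTime R p.1 p.2 k).toReal * jumpProd p.2 k, p.2 (2 * k)) := by fun_prop
    have h4 := hR.measurable_survivorInv.comp h3
    simp only [Function.comp_def] at h4
    exact ih.add h4

/-- Pathwise renewal: after its first jump the process is a fresh copy started at the new position
and driven by the remaining uniforms. -/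
theorem jumpTime_seqCons {R : ℝ → ℝ} {x u v : ℝ} (hT : survivorInv R x u ≠ ∞) (ω : ℕ → ℝ)
    (k : ℕ) :
    jumpTime R x (seqCons u (seqCons v ω)) (k + 1) = survivorInv R x u +
      jumpTime R (x * Real.exp (survivorInv R x u).toReal * √v) ω k := by
  induction k with
  | zero => simp [jumpTime, jumpProd, seqCons]
  | succ k ih =>
    rw [jumpTime, ih]
    conv_rhs => rw [jumpTime]
    by_cases hτ : jumpTime R (x * Real.exp (survivorInv R x u).toReal * √v) ω k = ∞
    · simp [hτ]
    · rw [ENNReal.toReal_add hT hτ, jumpProd_seqCons, Real.exp_add, add_assoc]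
      congr 3
      ring

/-- The event that exactly `n` jumps occur up to time `t`. -/
def jumpEvent (R : ℝ → ℝ) (n : ℕ) (t x : ℝ) : Set (ℕ → ℝ) :=
  {ω | jumpTime R x ω n ≤ ENNReal.ofReal t ∧ ENNReal.ofReal t < jumpTime R x ω (n + 1)}

theorem measurableSet_jumpEvent {R : ℝ → ℝ} (hR : IsRate R) (n : ℕ) :
    MeasurableSet {p : (ℝ × ℝ) × (ℕ → ℝ) | p.2 ∈ jumpEvent R n p.1.1 p.1.2} := by
  have h1 : ∀ k, Measurable fun p : (ℝ × ℝ) × (ℕ → ℝ) => jumpTime R p.1.2 p.2 k := fun k =>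
    (measurable_jumpTime hR k).comp (f := fun p : (ℝ × ℝ) × (ℕ → ℝ) => (p.1.2, p.2)) (by fun_prop)
  have h2 : Measurable fun p : (ℝ × ℝ) × (ℕ → ℝ) => ENNReal.ofReal p.1.1 := by fun_prop
  exact (measurableSet_le (h1 n) h2).inter (measurableSet_lt h2 (h1 (n + 1)))

theorem measurableSet_jumpEvent_prod {R : ℝ → ℝ} (hR : IsRate R) (n : ℕ) (t : ℝ) :
    MeasurableSet {p : ℝ × (ℕ → ℝ) | p.2 ∈ jumpEvent R n t p.1} :=
  (show Measurable fun p : ℝ × (ℕ → ℝ) => ((t, p.1), p.2) by fun_prop)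
    (measurableSet_jumpEvent hR n)

theorem measurableSet_jumpEvent' {R : ℝ → ℝ} (hR : IsRate R) (n : ℕ) (t x : ℝ) :
    MeasurableSet (jumpEvent R n t x) :=
  (show Measurable fun ω : ℕ → ℝ => ((t, x), ω) by fun_prop) (measurableSet_jumpEvent hR n)

theorem disjoint_jumpEvent (R : ℝ → ℝ) (t x : ℝ) :
    Pairwise (Function.onFun Disjoint fun n => jumpEvent R n t x) := by
  have key : ∀ m n, m < n → Disjoint (jumpEvent R m t x) (jumpEvent R n t x) := by
    intro m n hmn
    rw [Set.disjoint_left]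
    intro ω h1 h2
    exact absurd (h1.2.trans_le ((jumpTime_mono R x ω hmn).trans h2.1)) (lt_irrefl _)
  intro m n hmn
  rcases hmn.lt_or_gt with h | h
  · exact key m n h
  · exact (key n m h).symm

/-- The expectation of `g` at the position at time `t`, on the event of exactly `n` jumps. -/
def nJump (R : ℝ → ℝ) (n : ℕ) (t : ℝ) (g : ℝ → ℝ≥0∞) (x : ℝ) : ℝ≥0∞ :=
  ∫⁻ ω in jumpEvent R n t x, g (x * Real.exp t * jumpProd ω n) ∂uniformSeq

theorem measurable_nJump {R : ℝ → ℝ} (hR : IsRate R) (n : ℕ) {g : ℝ → ℝ≥0∞} (hg : Measurable g) :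
    Measurable fun p : ℝ × ℝ => nJump R n p.1 g p.2 := by
  have h : ∀ p : ℝ × ℝ, nJump R n p.1 g p.2 = ∫⁻ ω,
      {p : (ℝ × ℝ) × (ℕ → ℝ) | p.2 ∈ jumpEvent R n p.1.1 p.1.2}.indicator
        (fun p => g (p.1.2 * Real.exp p.1.1 * jumpProd p.2 n)) (p, ω) ∂uniformSeq := fun p => by
    rw [nJump, ← lintegral_indicator (measurableSet_jumpEvent' hR n _ _)]
    rfl
  simp only [h]
  refine Measurable.lintegral_prod_right' (Measurable.indicator ?_ (measurableSet_jumpEvent hR n))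
  have := measurable_jumpProd n
  fun_prop

theorem mem_jumpEvent_zero {R : ℝ → ℝ} (hR : IsRate R) {x t : ℝ} (hx : 0 < x) (ht : 0 ≤ t)
    (ω : ℕ → ℝ) : ω ∈ jumpEvent R 0 t x ↔ ω 0 < survivor R x t := by
  have h := hR.survivorInv_le_iff (u := ω 0) hx.le (t := t.toNNReal)
  rw [Real.coe_toNNReal t ht] at h
  rw [← not_le, ← h, not_le]
  simp [jumpEvent, jumpTime, jumpProd, ENNReal.ofReal]

theorem nJump_zero {R : ℝ → ℝ} (hR : IsRate R) {x t : ℝ} (hx : 0 < x) (ht : 0 ≤ t)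
    (g : ℝ → ℝ≥0∞) : nJump R 0 t g x = flow R t g x := by
  have h2 : jumpEvent R 0 t x = (fun ω => ω 0) ⁻¹' Iio (survivor R x t) := by
    ext ω; exact mem_jumpEvent_zero hR hx ht ω
  have h3 : uniformSeq (jumpEvent R 0 t x) = ENNReal.ofReal (survivor R x t) := by
    have h5 : uniformSeq ((fun ω => ω 0) ⁻¹' Iio (survivor R x t)) =
        uniform01 (Iio (survivor R x t)) :=
      (measurePreserving_eval_infinitePi (fun _ : ℕ => uniform01) 0).measure_preimage
        measurableSet_Iio.nullMeasurableSet
    rw [h2, h5, uniform01, Measure.restrict_apply measurableSet_Iio]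
    have h4 : Iio (survivor R x t) ∩ Ioo 0 1 = Ioo 0 (survivor R x t) := by
      have := hR.survivor_le_one hx.le ht
      ext u; simp only [mem_inter_iff, mem_Iio, mem_Ioo]
      exact ⟨fun h => ⟨h.2.1, h.1⟩, fun h => ⟨h.2, h.1, h.2.trans_le this⟩⟩
    rw [h4, Real.volume_Ioo, sub_zero]
  simp only [nJump, jumpProd, Finset.range_zero, Finset.prod_empty, mul_one]
  rw [setLIntegral_const, h3, flow, mul_comm]

theorem mem_jumpEvent_seqCons {R : ℝ → ℝ} {x u v t : ℝ} (hT : survivorInv R x u ≠ ∞)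
    (ω : ℕ → ℝ) (n : ℕ) :
    seqCons u (seqCons v ω) ∈ jumpEvent R (n + 1) t x ↔
      survivorInv R x u ≤ ENNReal.ofReal t ∧
        ω ∈ jumpEvent R n (t - (survivorInv R x u).toReal)
          (x * Real.exp (survivorInv R x u).toReal * √v) := by
  have hle : ∀ {a b c : ℝ≥0∞}, a ≠ ∞ → a ≤ c → (a + b ≤ c ↔ b ≤ c - a) := fun ha hac =>
    (ENNReal.cancel_of_ne ha).le_tsub_iff_left hac |>.symm
  simp only [jumpEvent, mem_ofPred_eq, jumpTime_seqCons hT]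
  by_cases h : survivorInv R x u ≤ ENNReal.ofReal t
  · rw [ENNReal.ofReal_sub _ ENNReal.toReal_nonneg, ENNReal.ofReal_toReal hT, hle hT h,
      ← not_le, hle hT h, not_le]
    tauto
  · simp only [h, false_and, iff_false, not_and]
    intro h'
    exact absurd (le_self_add.trans h') h

/-- Duhamel's formula, by conditioning on the time `s` of the first jump: its density is the
survival probability, which goes into `flow`, times the jump rate at `x e^s`, which goes into
`gain`. -/
theorem nJump_succ {R : ℝ → ℝ} (hR : IsRate R) (hH : Tendsto (cumulative R) atTop atTop)
    {x t : ℝ} (hx : 0 < x) (ht : 0 ≤ t) (n : ℕ) {g : ℝ → ℝ≥0∞} (hg : Measurable g) :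
    nJump R (n + 1) t g x =
      ∫⁻ s in Ioc 0 t, flow R s (gain R (nJump R n (t - s) g)) x := by
  -- The indicator is needed because for `s > t` the negative time `t - s` would be truncated to `0`
  -- by `ENNReal.ofReal`.
  set G : ℝ → ℝ≥0∞ := fun s => (Iic t).indicator
    (fun s => jump (nJump R n (t - s) g) (x * Real.exp s)) s with hG
  have hGm : Measurable G := by
    refine Measurable.indicator ?_ measurableSet_Iic
    unfold jump
    refine Measurable.lintegral_prod_right'
      (f := fun p : ℝ × ℝ => nJump R n (t - p.1) g (x * Real.exp p.1 * √p.2)) ?_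
    exact (measurable_nJump hR n hg).comp
      (f := fun p : ℝ × ℝ => (t - p.1, x * Real.exp p.1 * √p.2)) (by fun_prop)
  have hjm := measurableSet_jumpEvent' hR (n + 1) t x
  have hm : Measurable ((jumpEvent R (n + 1) t x).indicator
      fun ω => g (x * Real.exp t * jumpProd ω (n + 1))) := by
    refine Measurable.indicator ?_ hjm
    have := measurable_jumpProd (n + 1)
    fun_prop
  have hTm : Measurable fun u => (survivorInv R x u).toReal :=
    (hR.measurable_survivorInv.comp (measurable_const.prodMk measurable_id)).ennreal_toReal
  calc nJump R (n + 1) t g x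
      = ∫⁻ u, G (survivorInv R x u).toReal ∂uniform01 := by
        rw [nJump, ← lintegral_indicator hjm, lintegral_uniformSeq hm]
        refine lintegral_congr_ae ?_
        filter_upwards [ae_uniform01_mem] with u hu
        have hT := hR.survivorInv_ne_top hH hx hu.1
        by_cases h : survivorInv R x u ≤ ENNReal.ofReal t
        · have h' : (survivorInv R x u).toReal ∈ Iic t :=
            (ENNReal.le_ofReal_iff_toReal_le hT ht).1 h
          simp only [hG, indicator_of_mem h', jump]
          refine lintegral_congr fun v => ?_
          rw [nJump, ← lintegral_indicator (measurableSet_jumpEvent' hR n _ _)]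
          refine lintegral_congr fun ω => ?_
          have hiff := mem_jumpEvent_seqCons (v := v) (t := t) hT ω n
          by_cases hω : ω ∈ jumpEvent R n (t - (survivorInv R x u).toReal)
              (x * Real.exp (survivorInv R x u).toReal * √v)
          · rw [indicator_of_mem hω, indicator_of_mem (hiff.2 ⟨h, hω⟩), jumpProd_seqCons,
              Real.exp_sub]
            congr 1
            field_simp
          · rw [indicator_of_notMem hω, indicator_of_notMem fun h' => hω (hiff.1 h').2]
        · have h' : (survivorInv R x u).toReal ∉ Iic t := fun h' =>
            h ((ENNReal.le_ofReal_iff_toReal_le hT ht).2 h')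
          simp only [hG, indicator_of_notMem h']
          have : ∀ v ω, (jumpEvent R (n + 1) t x).indicator
              (fun ω => g (x * Real.exp t * jumpProd ω (n + 1)))
              (seqCons u (seqCons v ω)) = 0 := fun v ω =>
            indicator_of_notMem (fun h' => h ((mem_jumpEvent_seqCons hT ω n).1 h').1) _
          simp [this]
    _ = ∫⁻ s in Ioi 0, IsRate.firstJumpDensity R x s * G s := by
        rw [← lintegral_map hGm hTm, hR.map_survivorInv hH hx,
          lintegral_withDensity_eq_lintegral_mul _ (hR.measurable_firstJumpDensity x) hGm]
        rfl
    _ = ∫⁻ s in Ioc 0 t, flow R s (gain R (nJump R n (t - s) g)) x := by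
        rw [← Ioi_inter_Iic, inter_comm, ← Measure.restrict_restrict measurableSet_Iic,
          ← lintegral_indicator measurableSet_Iic]
        refine setLIntegral_congr_fun measurableSet_Ioi fun s _ => ?_
        by_cases hs : s ∈ Iic t
        · simp only [hG, indicator_of_mem hs, flow, gain, IsRate.firstJumpDensity]
          rw [← mul_assoc, ← ENNReal.ofReal_mul (IsRate.survivor_pos _ _).le,
            mul_comm (survivor _ _ _)]
        · simp only [hG, indicator_of_notMem hs, mul_zero]

instance (R : ℝ → ℝ) (c : ℝ) : SFinite (explicitLaw R c) := by unfold explicitLaw; infer_instance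

theorem ae_explicitLaw_pos (R : ℝ → ℝ) (c : ℝ) : ∀ᵐ x ∂(explicitLaw R c), 0 < x :=
  (withDensity_absolutelyContinuous _ _).ae_le (ae_restrict_mem measurableSet_Ioi)

/-- Under `explicitLaw R c`, the number of jumps up to time `t` is independent of the position at
time `t`, and has the Poisson distribution of parameter `2 * t`. -/
theorem lintegral_nJump {R : ℝ → ℝ} (hR : IsRate R) (hH : Tendsto (cumulative R) atTop atTop)
    {c : ℝ} (hc : 0 ≤ c) (n : ℕ) {t : ℝ} (ht : 0 ≤ t) {g : ℝ → ℝ≥0∞} (hg : Measurable g) :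
    ∫⁻ x, nJump R n t g x ∂(explicitLaw R c) =
      ENNReal.ofReal (Real.exp (-2 * t) * (2 * t) ^ n / n.factorial) *
        ∫⁻ x, g x ∂(explicitLaw R c) := by
  have hpos := ae_explicitLaw_pos R c
  induction n generalizing t with
  | zero =>
    rw [lintegral_congr_ae (hpos.mono fun x hx => nJump_zero hR hx ht g),
      lintegral_flow hR c t hc hg]
    simp
  | succ n ih =>
    have hmn : ∀ s, Measurable (nJump R n s g) := fun s =>
      (measurable_nJump hR n hg).comp (measurable_const.prodMk measurable_id)
    rw [lintegral_congr_ae (hpos.mono fun x hx => nJump_succ hR hH hx ht n hg),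
      lintegral_lintegral_swap]
    -- The flow contributes `e^{-2s}`, the gain `2`, and the induction hypothesis the Poisson weight
    -- at `t - s`. The exponentials combine to `e^{-2t}`, and `∫_0^t (t - s)^n ds` supplies the
    -- missing `t / (n + 1)`.
    · have h1 : ∀ s ∈ Ioc 0 t, ∫⁻ x, flow R s (gain R (nJump R n (t - s) g)) x ∂(explicitLaw R c) =
          ENNReal.ofReal (Real.exp (-2 * t) * 2 ^ (n + 1) / n.factorial * (t - s) ^ n) *
            ∫⁻ x, g x ∂(explicitLaw R c) := by
        intro s hs
        have hts : 0 ≤ t - s := sub_nonneg.2 hs.2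
        rw [lintegral_flow hR c s hc (measurable_gain hR (hmn _)),
          lintegral_gain hR hH c hc (hmn _), ih hts, ← mul_assoc, ← mul_assoc,
          show (2 : ℝ≥0∞) = ENNReal.ofReal 2 by simp, ← ENNReal.ofReal_mul (by positivity),
          ← ENNReal.ofReal_mul (by positivity)]
        congr 2
        rw [show -2 * t = -2 * s + -2 * (t - s) by ring, Real.exp_add, mul_pow, pow_succ]
        ring
      rw [setLIntegral_congr_fun measurableSet_Ioc h1, lintegral_mul_const _ (by fun_prop),
        ← ofReal_integral_eq_lintegral_ofReal]
      · congr 2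
        rw [← intervalIntegral.integral_of_le ht, intervalIntegral.integral_const_mul,
          intervalIntegral.integral_comp_sub_left (fun s => s ^ n) t, integral_pow,
          Nat.factorial_succ]
        push_cast
        simp only [sub_self, sub_zero, ne_eq, Nat.succ_ne_zero, not_false_eq_true, zero_pow]
        rw [mul_pow]
        field_simp
      · exact (Continuous.integrableOn_Icc (by fun_prop)).mono_set Ioc_subset_Icc_self
      · filter_upwards [ae_restrict_mem measurableSet_Ioc] with s hs
        have hts : 0 ≤ t - s := sub_nonneg.2 hs.2
        positivity
    · refine Measurable.aemeasurable ?_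
      have hs : Measurable fun p : ℝ × ℝ => survivor R p.1 p.2 := hR.measurable_survivor
      have hj : Measurable fun p : ℝ × ℝ =>
          jump (nJump R n (t - p.2) g) (p.1 * Real.exp p.2) := by
        unfold jump
        refine Measurable.lintegral_prod_right' (f := fun p : (ℝ × ℝ) × ℝ =>
          nJump R n (t - p.1.2) g (p.1.1 * Real.exp p.1.2 * √p.2)) ?_
        exact (measurable_nJump hR n hg).comp (f := fun p : (ℝ × ℝ) × ℝ =>
          (t - p.1.2, p.1.1 * Real.exp p.1.2 * √p.2)) (by fun_prop)
      have := hR.measurable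
      change Measurable fun p : ℝ × ℝ => ENNReal.ofReal (survivor R p.1 p.2) *
        (ENNReal.ofReal (p.1 * Real.exp p.2 * R (p.1 * Real.exp p.2)) *
          jump (nJump R n (t - p.2) g) (p.1 * Real.exp p.2))
      fun_prop

/-! ### Invariance of the stationary law -/

theorem cell_of_mem {R : ℝ → ℝ} {n : ℕ} {t x : ℝ} {ω : ℕ → ℝ} (h : ω ∈ jumpEvent R n t x) :
    cell R x t ω = x * Real.exp t * jumpProd ω n := by
  classical
  have hex : ∃ k, jumpTime R x ω k ≤ ENNReal.ofReal t ∧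
      ENNReal.ofReal t < jumpTime R x ω (k + 1) := ⟨n, h⟩
  have hfind : Nat.find hex = n := by
    by_contra hne
    exact Set.disjoint_left.1 (disjoint_jumpEvent R t x hne) (Nat.find_spec hex) h
  rw [cell, dif_pos hex, ← hfind]

theorem cell_of_notMem {R : ℝ → ℝ} {t x : ℝ} {ω : ℕ → ℝ} (h : ∀ n, ω ∉ jumpEvent R n t x) :
    cell R x t ω = 0 := dif_neg fun ⟨k, hk⟩ => h k hk

theorem measurable_cell {R : ℝ → ℝ} (hR : IsRate R) (t : ℝ) :
    Measurable fun p : ℝ × (ℕ → ℝ) => cell R p.1 t p.2 := by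
  intro B hB
  have hset : (fun p : ℝ × (ℕ → ℝ) => cell R p.1 t p.2) ⁻¹' B =
      (⋃ n, {p : ℝ × (ℕ → ℝ) | p.2 ∈ jumpEvent R n t p.1} ∩
        (fun p => p.1 * Real.exp t * jumpProd p.2 n) ⁻¹' B) ∪
      ((⋃ n, {p : ℝ × (ℕ → ℝ) | p.2 ∈ jumpEvent R n t p.1})ᶜ ∩ (fun _ => (0 : ℝ)) ⁻¹' B) := by
    ext p
    by_cases hp : ∃ n, p.2 ∈ jumpEvent R n t p.1
    · obtain ⟨n, hn⟩ := hp
      have huniq : ∀ m, p.2 ∈ jumpEvent R m t p.1 → m = n := fun m hm => by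
        by_contra hne
        exact Set.disjoint_left.1 (disjoint_jumpEvent R t p.1 hne) hm hn
      simp only [mem_preimage, cell_of_mem hn, mem_union, mem_iUnion, mem_inter_iff, mem_compl_iff,
        mem_ofPred_eq]
      constructor
      · exact fun h => Or.inl ⟨n, hn, h⟩
      · rintro (⟨m, hm, h⟩ | ⟨h, -⟩)
        · rwa [huniq m hm] at h
        · exact absurd ⟨n, hn⟩ h
    · have hp' : ∀ n, p.2 ∉ jumpEvent R n t p.1 := not_exists.1 hp
      simp [cell_of_notMem hp', hp']
  have hm : ∀ n, MeasurableSet {p : ℝ × (ℕ → ℝ) | p.2 ∈ jumpEvent R n t p.1} := fun n =>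
    measurableSet_jumpEvent_prod hR n t
  rw [hset]
  refine (MeasurableSet.iUnion fun n => (hm n).inter ?_).union
    ((MeasurableSet.iUnion hm).compl.inter (measurable_const hB))
  have := measurable_jumpProd n
  exact (show Measurable fun p : ℝ × (ℕ → ℝ) => p.1 * Real.exp t * jumpProd p.2 n by fun_prop) hB

/-- The rate `R` admits the stationary law `explicitLaw R c`. -/
structure IsStationaryRate (R : ℝ → ℝ) (c : ℝ) : Prop where
  rate : IsRate R
  tendsto : Tendsto (cumulative R) atTop atTop
  pos : 0 < c
  isProbabilityMeasure : IsProbabilityMeasure (explicitLaw R c)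

namespace IsStationaryRate

theorem tsum_poisson {t : ℝ} (ht : 0 ≤ t) :
    ∑' n : ℕ, ENNReal.ofReal (Real.exp (-2 * t) * (2 * t) ^ n / n.factorial) = 1 := by
  have h : HasSum (fun n : ℕ => Real.exp (-2 * t) * (2 * t) ^ n / n.factorial)
      (Real.exp (-2 * t) * Real.exp (2 * t)) := by
    have h1 := (NormedSpace.expSeries_div_hasSum_exp (2 * t)).mul_left (Real.exp (-2 * t))
    rw [← Real.exp_eq_exp_ℝ] at h1
    simpa only [mul_div_assoc] using h1
  rw [← ENNReal.ofReal_tsum_of_nonneg (fun n => by positivity) h.summable, h.tsum_eq,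
    ← Real.exp_add]
  simp

/-- Non-explosion: the probability of finitely many jumps before `t` is at most `1`, and its
`π`-integral is the sum of the Poisson weights, that is `1`; so it equals `1` almost everywhere. The
exceptional set of starting points does not depend on `g`. -/
theorem lintegral_cell_eq_tsum {R : ℝ → ℝ} {c : ℝ} (h : IsStationaryRate R c) {t : ℝ}
    (ht : 0 ≤ t) :
    ∀ᵐ x ∂(explicitLaw R c), ∀ g : ℝ → ℝ≥0∞, Measurable g →
      ∫⁻ ω, g (cell R x t ω) ∂uniformSeq = ∑' n, nJump R n t g x := by
  have hprob := h.isProbabilityMeasure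
  have hmeas : ∀ x n, MeasurableSet (jumpEvent R n t x) :=
    fun x n => measurableSet_jumpEvent' h.rate n t x
  have hsum : ∀ x, ∑' n, nJump R n t (fun _ => 1) x = uniformSeq (⋃ n, jumpEvent R n t x) := by
    intro x
    rw [measure_iUnion (disjoint_jumpEvent R t x) (hmeas x)]
    simp [nJump]
  have hm1 : ∀ n, Measurable (nJump R n t (fun _ => 1)) := fun n =>
    (measurable_nJump h.rate n (measurable_const (a := 1))).comp
      (measurable_const.prodMk measurable_id)
  have hint : ∫⁻ x, ∑' n, nJump R n t (fun _ => 1) x ∂(explicitLaw R c) = 1 := by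
    rw [lintegral_tsum fun n => (hm1 n).aemeasurable]
    simp_rw [fun n => lintegral_nJump h.rate h.tendsto h.pos.le n ht
      (measurable_const (a := (1 : ℝ≥0∞)))]
    rw [ENNReal.tsum_mul_right, tsum_poisson ht]
    simp
  have hae : (fun x => ∑' n, nJump R n t (fun _ => 1) x) =ᵐ[explicitLaw R c] fun _ => 1 := by
    refine ae_eq_of_ae_le_of_lintegral_le (Eventually.of_forall fun x => ?_) ?_
      aemeasurable_const ?_
    · simp only [hsum]; exact prob_le_one
    · rw [hint]; exact ENNReal.one_ne_top
    · rw [hint]; simp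
  filter_upwards [hae] with x hx g hg
  rw [hsum] at hx
  have hU : ∀ᵐ ω ∂uniformSeq, ω ∈ ⋃ n, jumpEvent R n t x :=
    (prob_compl_eq_zero_iff (MeasurableSet.iUnion (hmeas x))).2 hx
  have hU' : (⋃ n, jumpEvent R n t x : Set (ℕ → ℝ)) =ᵐ[uniformSeq] univ := eventuallyEq_univ.2 hU
  rw [← setLIntegral_univ, ← setLIntegral_congr hU',
    lintegral_iUnion (hmeas x) (disjoint_jumpEvent R t x)]
  refine tsum_congr fun n => setLIntegral_congr_fun (hmeas x n) fun ω hω => ?_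
  simp only [cell_of_mem hω]

/-- Invariance of the law, from summing `lintegral_nJump` over `n`. Well-definedness and
contractivity of `P_t` on `L¹` follow from it. -/
theorem measurePreserving_cell {R : ℝ → ℝ} {c : ℝ} (h : IsStationaryRate R c) {t : ℝ}
    (ht : 0 ≤ t) :
    MeasurePreserving (fun p : ℝ × (ℕ → ℝ) => cell R p.1 t p.2)
      ((explicitLaw R c).prod uniformSeq) (explicitLaw R c) := by
  have hprob := h.isProbabilityMeasure
  refine ⟨measurable_cell h.rate t, ?_⟩
  ext B hB
  set g : ℝ → ℝ≥0∞ := B.indicator fun _ => 1 with hg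
  have hgm : Measurable g := measurable_const.indicator hB
  have hmn : ∀ n, Measurable (nJump R n t g) := fun n =>
    (measurable_nJump h.rate n hgm).comp (measurable_const.prodMk measurable_id)
  calc _ = ∫⁻ y, g y ∂((explicitLaw R c).prod uniformSeq).map
        (fun p : ℝ × (ℕ → ℝ) => cell R p.1 t p.2) := (lintegral_indicator_one hB).symm
    _ = ∫⁻ x, ∑' n, nJump R n t g x ∂(explicitLaw R c) := by
        rw [lintegral_map hgm (measurable_cell h.rate t),
          lintegral_prod (fun p : ℝ × (ℕ → ℝ) => g (cell R p.1 t p.2))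
            (hgm.comp (measurable_cell h.rate t)).aemeasurable]
        exact lintegral_congr_ae ((h.lintegral_cell_eq_tsum ht).mono fun x hx => hx g hgm)
    _ = explicitLaw R c B := by
        rw [lintegral_tsum fun n => (hmn n).aemeasurable]
        simp_rw [fun n => lintegral_nJump h.rate h.tendsto h.pos.le n ht hgm]
        rw [ENNReal.tsum_mul_right, tsum_poisson ht, one_mul]
        exact lintegral_indicator_one hB

theorem integrable_cell {R : ℝ → ℝ} {c : ℝ} (h : IsStationaryRate R c) {t : ℝ} (ht : 0 ≤ t)
    {f : ℝ → ℝ} (hf : Integrable f (explicitLaw R c)) :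
    Integrable (fun p : ℝ × (ℕ → ℝ) => f (cell R p.1 t p.2))
      ((explicitLaw R c).prod uniformSeq) :=
  (h.measurePreserving_cell ht).integrable_comp_of_integrable hf

theorem ae_integrable_cell {R : ℝ → ℝ} {c : ℝ} (h : IsStationaryRate R c) {t : ℝ} (ht : 0 ≤ t)
    {f : ℝ → ℝ} (hf : Integrable f (explicitLaw R c)) :
    ∀ᵐ x ∂(explicitLaw R c), Integrable (fun ω => f (cell R x t ω)) uniformSeq :=
  (h.integrable_cell ht hf).prod_right_ae

theorem integrable_transition {R : ℝ → ℝ} {c : ℝ} (h : IsStationaryRate R c) {t : ℝ} (ht : 0 ≤ t)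
    {f : ℝ → ℝ} (hf : Integrable f (explicitLaw R c)) :
    Integrable (transition R t f) (explicitLaw R c) :=
  (h.integrable_cell ht hf).integral_prod_left

theorem integral_norm_transition_le {R : ℝ → ℝ} {c : ℝ} (h : IsStationaryRate R c) {t : ℝ}
    (ht : 0 ≤ t) {f : ℝ → ℝ} (hf : Integrable f (explicitLaw R c)) :
    ∫ x, |transition R t f x| ∂(explicitLaw R c) ≤ ∫ x, |f x| ∂(explicitLaw R c) := by
  have h1 := h.integrable_cell ht hf
  have h2 : ∫ x, |f x| ∂(explicitLaw R c) =
      ∫ x, ∫ ω, |f (cell R x t ω)| ∂uniformSeq ∂(explicitLaw R c) := by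
    have hmp := h.measurePreserving_cell ht
    have h3 : AEStronglyMeasurable (fun y => |f y|)
        (((explicitLaw R c).prod uniformSeq).map fun p : ℝ × (ℕ → ℝ) => cell R p.1 t p.2) := by
      rw [hmp.map_eq]; exact hf.abs.aestronglyMeasurable
    conv_lhs => rw [← hmp.map_eq]
    rw [integral_map hmp.measurable.aemeasurable h3, integral_prod _ h1.abs]
  rw [h2]
  exact integral_mono (h.integrable_transition ht hf).abs h1.abs.integral_prod_left
    fun x => abs_integral_le_integral_abs

end IsStationaryRate

/-! ### Strong continuity of the flow -/

namespace IsStationaryRate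

theorem lintegral_enorm_survivor_mul {R : ℝ → ℝ} {c : ℝ} (h : IsStationaryRate R c) (s : ℝ)
    {g : ℝ → ℝ} (hg : Measurable g) :
    ∫⁻ x, ‖survivor R x s * g (x * Real.exp s)‖ₑ ∂(explicitLaw R c) =
      ENNReal.ofReal (Real.exp (-2 * s)) * ∫⁻ x, ‖g x‖ₑ ∂(explicitLaw R c) := by
  rw [← lintegral_flow h.rate c s h.pos.le hg.enorm]
  refine lintegral_congr fun x => ?_
  rw [enorm_mul, flow, Real.enorm_of_nonneg (IsRate.survivor_pos _ _).le]

theorem measurable_survivor_mul {R : ℝ → ℝ} {c : ℝ} (h : IsStationaryRate R c) (s : ℝ)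
    {g : ℝ → ℝ} (hg : Measurable g) :
    Measurable fun x => survivor R x s * g (x * Real.exp s) := by
  have := h.rate.measurable_survivor_left s
  fun_prop

theorem tendsto_survivor_mul_of_bounded {R : ℝ → ℝ} {c : ℝ} (h : IsStationaryRate R c)
    (g : BoundedContinuousFunction ℝ ℝ) :
    Tendsto (fun s => ∫⁻ x, ‖survivor R x s * g (x * Real.exp s) - g x‖ₑ ∂(explicitLaw R c))
      (𝓝[>] 0) (𝓝 0) := by
  have := h.isProbabilityMeasure
  rw [← lintegral_zero (μ := explicitLaw R c)]
  refine tendsto_lintegral_filter_of_dominated_convergence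
    (fun _ => ENNReal.ofReal (2 * ‖g‖)) ?_ ?_ ?_ ?_
  · exact Eventually.of_forall fun s =>
      ((h.measurable_survivor_mul s g.continuous.measurable).sub g.continuous.measurable).enorm
  · filter_upwards [self_mem_nhdsWithin] with s hs
    filter_upwards [ae_explicitLaw_pos R c] with x hx
    rw [← ofReal_norm]
    refine ENNReal.ofReal_le_ofReal ?_
    have h1 := h.rate.survivor_le_one hx.le (le_of_lt hs)
    have h2 := IsRate.survivor_pos (R := R) x s
    calc ‖survivor R x s * g (x * Real.exp s) - g x‖
        ≤ ‖survivor R x s * g (x * Real.exp s)‖ + ‖g x‖ := norm_sub_le _ _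
      _ ≤ 1 * ‖g‖ + ‖g‖ := by
          rw [norm_mul, Real.norm_of_nonneg h2.le]
          gcongr
          · exact g.norm_coe_le_norm _
          · exact g.norm_coe_le_norm _
      _ = 2 * ‖g‖ := by ring
  · rw [lintegral_const, measure_univ, mul_one]
    exact ENNReal.ofReal_ne_top
  · refine Eventually.of_forall fun x => ?_
    have hcont : Continuous fun s => ‖survivor R x s * g (x * Real.exp s) - g x‖ₑ := by
      have h1 : Continuous fun s => survivor R x s :=
        h.rate.continuous_survivor.comp (Continuous.prodMk_right x)
      fun_prop
    have := hcont.tendsto 0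
    simp only [h.rate.survivor_zero, Real.exp_zero, mul_one, one_mul, sub_self, enorm_zero] at this
    exact this.mono_left nhdsWithin_le_nhds

/-- Bounded continuous functions are dense in `L¹`, and the factor `e^{-2s} ≤ 1` carries the
convergence over from them. -/
theorem tendsto_survivor_mul {R : ℝ → ℝ} {c : ℝ} (h : IsStationaryRate R c)
    {g : ℝ → ℝ} (hg : Measurable g) (hgi : Integrable g (explicitLaw R c)) :
    Tendsto (fun s => ∫⁻ x, ‖survivor R x s * g (x * Real.exp s) - g x‖ₑ ∂(explicitLaw R c))
      (𝓝[>] 0) (𝓝 0) := by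
  have := h.isProbabilityMeasure
  refine ENNReal.tendsto_nhds_zero.2 fun ε hε => ?_
  have hε3 : ε / 3 ≠ 0 := (ENNReal.div_pos hε.ne' (by simp)).ne'
  obtain ⟨g₀, hg₀, -⟩ := hgi.exists_boundedContinuous_lintegral_sub_le hε3
  filter_upwards [ENNReal.tendsto_nhds_zero.1 (h.tendsto_survivor_mul_of_bounded g₀) (ε / 3)
    (pos_iff_ne_zero.2 hε3), self_mem_nhdsWithin] with s hs hs0
  have hs0' : (0 : ℝ) < s := hs0
  have hd : Measurable fun x => g x - g₀ x := hg.sub g₀.continuous.measurable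
  calc ∫⁻ x, ‖survivor R x s * g (x * Real.exp s) - g x‖ₑ ∂(explicitLaw R c)
      ≤ ∫⁻ x, (‖survivor R x s * (g (x * Real.exp s) - g₀ (x * Real.exp s))‖ₑ +
          ‖survivor R x s * g₀ (x * Real.exp s) - g₀ x‖ₑ) + ‖g x - g₀ x‖ₑ ∂(explicitLaw R c) := by
        refine lintegral_mono fun x => ?_
        have heq : survivor R x s * g (x * Real.exp s) - g x =
          (survivor R x s * (g (x * Real.exp s) - g₀ (x * Real.exp s)) +
            (survivor R x s * g₀ (x * Real.exp s) - g₀ x)) - (g x - g₀ x) := by ring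
        rw [heq]
        refine (enorm_sub_le).trans ?_
        gcongr
        exact enorm_add_le _ _
    _ = ENNReal.ofReal (Real.exp (-2 * s)) * ∫⁻ x, ‖g x - g₀ x‖ₑ ∂(explicitLaw R c) +
          ∫⁻ x, ‖survivor R x s * g₀ (x * Real.exp s) - g₀ x‖ₑ ∂(explicitLaw R c) +
          ∫⁻ x, ‖g x - g₀ x‖ₑ ∂(explicitLaw R c) := by
        rw [lintegral_add_right _ hd.enorm, lintegral_add_left
          (h.measurable_survivor_mul s hd).enorm, h.lintegral_enorm_survivor_mul s hd]
    _ ≤ 1 * (ε / 3) + ε / 3 + ε / 3 := by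
        gcongr
        rw [ENNReal.ofReal_le_one]
        exact Real.exp_le_one_iff.2 (by linarith)
    _ = ε := by rw [one_mul, ENNReal.add_thirds]

/-- Along the flow `S_x(s) f(x e^s) = e^{H(x)} (e^{-H} f)(x e^s)`, so this is the fundamental
theorem for `e^{-H} f` after the substitution `y = x e^s`. It holds at every `x > 0`, although `R`
is only integrable. -/
theorem survivor_mul_sub_eq {R : ℝ → ℝ} (hR : IsRate R) {f : ℝ → ℝ} (hf : ContDiff ℝ 1 f)
    {x t : ℝ} (hx : 0 < x) (ht : 0 ≤ t) :
    IntegrableOn (fun s => survivor R x s * (x * Real.exp s * deriv f (x * Real.exp s) -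
        x * Real.exp s * R (x * Real.exp s) * f (x * Real.exp s))) (Ioc 0 t) ∧
    survivor R x t * f (x * Real.exp t) - f x =
      ∫ s in Ioc 0 t, survivor R x s * (x * Real.exp s * deriv f (x * Real.exp s) -
        x * Real.exp s * R (x * Real.exp s) * f (x * Real.exp s)) := by
  set G : ℝ → ℝ := fun y => Real.exp (cumulative R x) *
    (Real.exp (-cumulative R y) * (deriv f y - R y * f y)) with hG
  have hle : x ≤ x * Real.exp t := le_mul_of_one_le_right hx.le (Real.one_le_exp ht)
  have hd : ∀ s ∈ Ioc 0 t, HasDerivWithinAt (fun s => x * Real.exp s) (x * Real.exp s)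
      (Ioc 0 t) s := fun s _ => ((Real.hasDerivAt_exp s).const_mul x).hasDerivWithinAt
  have hinj : InjOn (fun s => x * Real.exp s) (Ioc 0 t) := fun s _ s' _ h =>
    Real.exp_injective (mul_left_cancel₀ hx.ne' h)
  have hderiv : Continuous (deriv f) := hf.continuous_deriv le_rfl
  have hHc := hR.continuous_cumulative
  have hGi : IntegrableOn G (Ioc x (x * Real.exp t)) := by
    rw [← intervalIntegrable_iff_integrableOn_Ioc_of_le hle]
    refine IntervalIntegrable.const_mul ?_ _
    refine IntervalIntegrable.continuousOn_mul ?_ (by fun_prop)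
    exact (hderiv.intervalIntegrable _ _).sub
      (hR.intervalIntegrable_rate_mul hf.continuous _ _)
  have hcongr : (fun s => survivor R x s * (x * Real.exp s * deriv f (x * Real.exp s) -
        x * Real.exp s * R (x * Real.exp s) * f (x * Real.exp s))) =
      fun s => |x * Real.exp s| • G (x * Real.exp s) := by
    ext s
    rw [abs_of_pos (by positivity), hR.survivor_eq, hG, smul_eq_mul, sub_eq_add_neg, Real.exp_add]
    ring
  rw [hcongr]
  constructor
  · rw [← integrableOn_image_iff_integrableOn_abs_deriv_smul measurableSet_Ioc hd hinj,
      image_mul_exp_Ioc hx]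
    exact hGi
  · rw [← integral_image_eq_integral_abs_deriv_smul measurableSet_Ioc hd hinj,
      image_mul_exp_Ioc hx, integral_const_mul, ← intervalIntegral.integral_of_le hle,
      ← hR.exp_mul_sub_exp_mul hf, mul_sub, ← mul_assoc, ← mul_assoc, ← Real.exp_add,
      ← Real.exp_add, hR.survivor_eq, add_neg_cancel, Real.exp_zero, one_mul, sub_eq_add_neg]
    rfl

/-- The generator of the flow with killing at rate `x R(x)`. -/
theorem tendsto_flow_generator {R : ℝ → ℝ} {c : ℝ} (h : IsStationaryRate R c) {f : ℝ → ℝ}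
    (hf : ContDiff ℝ 1 f)
    (hfi : Integrable (fun x => x * deriv f x - x * R x * f x) (explicitLaw R c)) :
    Tendsto (fun t => ∫⁻ x, ‖t⁻¹ * (survivor R x t * f (x * Real.exp t) - f x) -
      (x * deriv f x - x * R x * f x)‖ₑ ∂(explicitLaw R c)) (𝓝[>] 0) (𝓝 0) := by
  have := h.isProbabilityMeasure
  set g : ℝ → ℝ := fun x => x * deriv f x - x * R x * f x with hg
  have hgm : Measurable g := by
    have := h.rate.measurable; have := hf.continuous.measurable; have := measurable_deriv f
    fun_prop
  refine ENNReal.tendsto_nhds_zero.2 fun ε hε => ?_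
  have hsm := ENNReal.tendsto_nhds_zero.1 (h.tendsto_survivor_mul hgm hfi) ε hε
  obtain ⟨δ, hδ, hball⟩ := mem_nhdsGT_iff_exists_Ioc_subset.1 hsm
  filter_upwards [Ioc_mem_nhdsGT hδ] with t ht
  have ht0 : 0 < t := ht.1
  -- The difference quotient is the mean over `s ∈ (0, t]` of the killed flow applied to `g`, and
  -- for small `s` this is within `ε` of `g` in `L¹`.
  calc ∫⁻ x, ‖t⁻¹ * (survivor R x t * f (x * Real.exp t) - f x) - g x‖ₑ ∂(explicitLaw R c)
      ≤ ∫⁻ x, ENNReal.ofReal t⁻¹ * (∫⁻ s in Ioc 0 t,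
          ‖survivor R x s * g (x * Real.exp s) - g x‖ₑ) ∂(explicitLaw R c) := by
        refine lintegral_mono_ae ?_
        filter_upwards [ae_explicitLaw_pos R c] with x hx
        obtain ⟨h1, h2⟩ := survivor_mul_sub_eq h.rate hf hx ht0.le
        have h3 : t⁻¹ * (survivor R x t * f (x * Real.exp t) - f x) - g x =
            t⁻¹ * ∫ s in Ioc 0 t, (survivor R x s * g (x * Real.exp s) - g x) := by
          rw [integral_sub h1 (integrable_const _), ← h2, integral_const]
          simp only [MeasurableSet.univ, measureReal_restrict_apply, univ_inter, Real.volume_real_Ioc,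
            sub_zero, smul_eq_mul, max_eq_left ht0.le]
          field_simp
        rw [h3, enorm_mul, Real.enorm_of_nonneg (by positivity)]
        gcongr
        exact enorm_integral_le_lintegral_enorm _
    _ = ENNReal.ofReal t⁻¹ * ∫⁻ s in Ioc 0 t, ∫⁻ x,
          ‖survivor R x s * g (x * Real.exp s) - g x‖ₑ ∂(explicitLaw R c) := by
        rw [lintegral_const_mul' _ _ ENNReal.ofReal_ne_top, lintegral_lintegral_swap]
        have := h.rate.measurable_survivor
        refine Measurable.aemeasurable ?_
        change Measurable fun p : ℝ × ℝ => ‖survivor R p.1 p.2 * g (p.1 * Real.exp p.2) - g p.1‖ₑ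
        fun_prop
    _ ≤ ENNReal.ofReal t⁻¹ * ∫⁻ s in Ioc 0 t, ε := by
        gcongr 1
        exact setLIntegral_mono' measurableSet_Ioc fun s hs => hball ⟨hs.1, hs.2.trans ht.2⟩
    _ = ε := by
        rw [setLIntegral_const, Real.volume_Ioc, sub_zero, mul_comm ε, ← mul_assoc,
          ← ENNReal.ofReal_mul (by positivity), inv_mul_cancel₀ ht0.ne', ENNReal.ofReal_one,
          one_mul]

end IsStationaryRate

/-! ### Test functions belong to the domain of the generator -/

/-- The mean of `f` at the position after a jump from `x`. -/
def jumpMean (f : ℝ → ℝ) (x : ℝ) : ℝ := ∫ u, f (x * √u) ∂uniform01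

theorem jumpMean_eq (f : ℝ → ℝ) {x : ℝ} (hx : 0 < x) :
    jumpMean f x = ∫ u in (0 : ℝ)..x, 2 * u / x ^ 2 * f u := by
  rw [jumpMean, uniform01, ← image_div_sq_Ioo hx, integral_image_eq_integral_abs_deriv_smul
    measurableSet_Ioo (fun y _ => hasDerivWithinAt_div_sq _ y) (injOn_div_sq hx),
    intervalIntegral.integral_of_le hx.le, integral_Ioc_eq_integral_Ioo]
  refine setIntegral_congr_fun measurableSet_Ioo fun y hy => ?_
  have hy' := hy.1
  simp only [smul_eq_mul]
  rw [abs_of_pos (by positivity), Real.sqrt_sq (by positivity), mul_div_cancel₀ _ hx.ne']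

theorem abs_jumpMean_le {f : ℝ → ℝ} {M : ℝ} (hf : ∀ x, |f x| ≤ M) (x : ℝ) :
    |jumpMean f x| ≤ M := by
  have := norm_integral_le_of_norm_le_const (μ := uniform01) (f := fun u => f (x * √u)) (C := M)
    (Eventually.of_forall fun u => hf _)
  simpa [jumpMean] using this

theorem measurable_jumpMean {f : ℝ → ℝ} (hf : Measurable f) : Measurable (jumpMean f) := by
  have h : StronglyMeasurable fun p : ℝ × ℝ => f (p.1 * √p.2) :=
    (show Measurable fun p : ℝ × ℝ => f (p.1 * √p.2) by fun_prop).stronglyMeasurable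
  exact h.integral_prod_right.measurable

theorem exists_bound_of_mem_testFunctions {f : ℝ → ℝ} (hf : f ∈ testFunctions) :
    ∃ M, 0 ≤ M ∧ ∀ x, |f x| ≤ M := by
  obtain ⟨C, hC⟩ := hf.1.continuous.bounded_above_of_compact_support hf.2.1
  exact ⟨C, (norm_nonneg _).trans (hC 0), hC⟩

theorem continuous_mul_deriv {f : ℝ → ℝ} (hf : f ∈ testFunctions) :
    Continuous fun y => y * deriv f y :=
  continuous_id.mul (hf.1.continuous_deriv le_rfl)

theorem exists_bound_mul_deriv {f : ℝ → ℝ} (hf : f ∈ testFunctions) :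
    ∃ K, 0 ≤ K ∧ ∀ x, |x * deriv f x| ≤ K := by
  obtain ⟨C, hC⟩ := (continuous_mul_deriv hf).bounded_above_of_compact_support
    (hf.2.1.deriv.mul_left)
  exact ⟨C, (norm_nonneg _).trans (hC 0), hC⟩

theorem abs_dilation_sub_le {f : ℝ → ℝ} (hf : ContDiff ℝ 1 f) {K : ℝ}
    (hK : ∀ x, |x * deriv f x| ≤ K) (y : ℝ) {t : ℝ} (ht : 0 ≤ t) :
    |f (y * Real.exp t) - f y| ≤ K * t := by
  have hd : ∀ s ∈ (univ : Set ℝ), HasDerivWithinAt (fun s => f (y * Real.exp s))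
      (deriv f (y * Real.exp s) * (y * Real.exp s)) univ s := fun s _ =>
    ((hf.differentiable one_ne_zero _).hasDerivAt.comp s
      ((Real.hasDerivAt_exp s).const_mul y)).hasDerivWithinAt
  have h := convex_univ.norm_image_sub_le_of_norm_hasDerivWithin_le hd
    (fun s _ => by rw [Real.norm_eq_abs, mul_comm]; exact hK _) (mem_univ 0) (mem_univ t)
  simpa [abs_of_nonneg ht] using h

theorem integral_uniformSeq_pair {a : ℝ} (h0 : 0 < a) (h1 : a ≤ 1) (b : ℝ) {k : ℝ → ℝ}
    (hk : Measurable k) {M : ℝ} (hM : ∀ u, |k u| ≤ M) :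
    ∫ ω, (if ω 0 < a then b else k (ω 1)) ∂uniformSeq = a * b + (1 - a) * ∫ u, k u ∂uniform01 := by
  have hmap : uniformSeq.map (fun ω => (ω 0, ω 1)) = uniform01.prod uniform01 :=
    Measure.infinitePi_map_eval_prod (P := fun _ : ℕ => uniform01) zero_ne_one
  have hki : Integrable k uniform01 :=
    Integrable.of_bound hk.aestronglyMeasurable M (Eventually.of_forall hM)
  have hIio : uniform01.real (Iio a) = a := by
    have h4 : Iio a ∩ Ioo 0 1 = Ioo 0 a := by
      ext u; simp only [mem_inter_iff, mem_Iio, mem_Ioo]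
      exact ⟨fun h => ⟨h.2.1, h.1⟩, fun h => ⟨h.2, h.1, h.2.trans_le h1⟩⟩
    rw [uniform01, measureReal_restrict_apply measurableSet_Iio, h4, Real.volume_real_Ioo_of_le h0.le,
      sub_zero]
  have hIci : uniform01.real (Ici a) = 1 - a := by
    rw [← compl_Iio, probReal_compl_eq_one_sub measurableSet_Iio, hIio]
  have hm : Measurable fun p : ℝ × ℝ => if p.1 < a then b else k p.2 :=
    Measurable.ite (measurableSet_lt measurable_fst measurable_const) measurable_const
      (hk.comp measurable_snd)
  have hi1 : Integrable ((Iio a).indicator fun _ => (1 : ℝ)) uniform01 :=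
    (integrable_const 1).indicator measurableSet_Iio
  have hi2 : Integrable ((Ici a).indicator fun _ => (1 : ℝ)) uniform01 :=
    (integrable_const 1).indicator measurableSet_Ici
  calc ∫ ω, (if ω 0 < a then b else k (ω 1)) ∂uniformSeq
      = ∫ p : ℝ × ℝ, (if p.1 < a then b else k p.2) ∂(uniform01.prod uniform01) := by
        rw [← hmap, integral_map (by fun_prop) hm.aestronglyMeasurable]
    _ = ∫ p : ℝ × ℝ, ((Iio a).indicator (fun _ => (1 : ℝ)) p.1 * b +
          (Ici a).indicator (fun _ => (1 : ℝ)) p.1 * k p.2) ∂(uniform01.prod uniform01) := by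
        refine integral_congr_ae (Eventually.of_forall fun p => ?_)
        by_cases hp : p.1 < a
        · simp [hp]
        · simp [hp, not_lt.1 hp]
    _ = _ := by
        rw [integral_add (hi1.mul_prod (integrable_const b)) (hi2.mul_prod hki),
          integral_prod_mul (fun u => (Iio a).indicator (fun _ => (1 : ℝ)) u) (fun _ => b),
          integral_prod_mul (fun u => (Ici a).indicator (fun _ => (1 : ℝ)) u) k,
          integral_indicator_const _ measurableSet_Iio, integral_indicator_const _ measurableSet_Ici,
          hIio, hIci]
        simp

theorem nJump_one_eq (R : ℝ → ℝ) (n : ℕ) (t x : ℝ) :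
    nJump R n t (fun _ => 1) x = uniformSeq (jumpEvent R n t x) := by simp [nJump]

/-- Up to the first jump the process follows the flow; two jumps in a short time are unlikely. -/
theorem enorm_transition_sub_le {R : ℝ → ℝ} (hR : IsRate R) {f : ℝ → ℝ} (hf : Measurable f)
    {M K : ℝ} (hM : ∀ x, |f x| ≤ M) {t x : ℝ} (ht : 0 ≤ t)
    (hK : ∀ y, |f (y * Real.exp t) - f y| ≤ K * t) (hx : 0 < x) :
    ‖transition R t f x - (survivor R x t * f (x * Real.exp t) +
        (1 - survivor R x t) * jumpMean f x)‖ₑ ≤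
      ENNReal.ofReal (K * t) * (1 - nJump R 0 t (fun _ => 1) x) +
        ENNReal.ofReal (2 * M) * (1 - (nJump R 0 t (fun _ => 1) x + nJump R 1 t (fun _ => 1) x)) := by
  -- `Z` is a simplified process depending on two uniforms: after a jump it ignores the dilation.
  -- With exactly one jump the true position is `x e^t √(ω 1)`, whatever the jump time, so the error
  -- is at most `K t`; with more jumps it is at most `2 M`.
  set Z : (ℕ → ℝ) → ℝ := fun ω =>
    if ω 0 < survivor R x t then f (x * Real.exp t) else f (x * √(ω 1)) with hZ
  have hJ : ∀ n, MeasurableSet (jumpEvent R n t x) := fun n => measurableSet_jumpEvent' hR n t x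
  have hZm : Measurable Z :=
    Measurable.ite (measurableSet_lt (measurable_pi_apply 0) measurable_const) measurable_const
      (by fun_prop)
  have hcm : Measurable fun ω => f (cell R x t ω) :=
    hf.comp ((measurable_cell hR t).comp (measurable_const.prodMk measurable_id))
  have hZb : ∀ ω, |Z ω| ≤ M := fun ω => by
    simp only [hZ]; split_ifs <;> exact hM _
  have hZi : Integrable Z uniformSeq :=
    Integrable.of_bound hZm.aestronglyMeasurable M (Eventually.of_forall hZb)
  have hci : Integrable (fun ω => f (cell R x t ω)) uniformSeq :=
    Integrable.of_bound hcm.aestronglyMeasurable M (Eventually.of_forall fun ω => hM _)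
  have hEZ : ∫ ω, Z ω ∂uniformSeq = survivor R x t * f (x * Real.exp t) +
      (1 - survivor R x t) * jumpMean f x :=
    integral_uniformSeq_pair (IsRate.survivor_pos _ _) (hR.survivor_le_one hx.le ht) _
      (k := fun u => f (x * √u)) (by fun_prop) (fun u => hM _)
  have hdisj : Disjoint (jumpEvent R 0 t x) (jumpEvent R 1 t x) :=
    disjoint_jumpEvent R t x zero_ne_one
  rw [← hEZ, transition, ← integral_sub hci hZi, nJump_one_eq, nJump_one_eq,
    ← measure_union hdisj (hJ 1), ← prob_compl_eq_one_sub (hJ 0),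
    ← prob_compl_eq_one_sub ((hJ 0).union (hJ 1)), ← lintegral_indicator_const (hJ 0).compl,
    ← lintegral_indicator_const ((hJ 0).union (hJ 1)).compl,
    ← lintegral_add_left (measurable_const.indicator (hJ 0).compl)]
  refine (enorm_integral_le_lintegral_enorm _).trans (lintegral_mono fun ω => ?_)
  by_cases h0 : ω ∈ jumpEvent R 0 t x
  · have hZω : Z ω = f (x * Real.exp t) := if_pos ((mem_jumpEvent_zero hR hx ht ω).1 h0)
    simp only [cell_of_mem h0, hZω, jumpProd, Finset.range_zero, Finset.prod_empty, mul_one]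
    simp
  have hZω : Z ω = f (x * √(ω 1)) := if_neg fun h => h0 ((mem_jumpEvent_zero hR hx ht ω).2 h)
  rw [indicator_of_mem (show ω ∈ (jumpEvent R 0 t x)ᶜ from h0)]
  by_cases h1 : ω ∈ jumpEvent R 1 t x
  · refine le_add_right ?_
    have : x * Real.exp t * √(ω 1) = x * √(ω 1) * Real.exp t := by ring
    simp only [cell_of_mem h1, hZω, jumpProd, Finset.range_one, Finset.prod_singleton, mul_zero,
      zero_add, this]
    rw [← ofReal_norm]
    exact ENNReal.ofReal_le_ofReal (hK _)
  · refine le_add_left ?_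
    rw [indicator_of_mem (show ω ∈ (jumpEvent R 0 t x ∪ jumpEvent R 1 t x)ᶜ from
      fun h => h.elim h0 h1), ← ofReal_norm]
    refine ENNReal.ofReal_le_ofReal ((norm_sub_le _ _).trans ?_)
    have h2 := hM (cell R x t ω)
    have h3 := hZb ω
    rw [Real.norm_eq_abs, Real.norm_eq_abs]
    linarith

namespace IsStationaryRate

/-- The gain of the constant `1` is the jump rate, whose mean is therefore `2`. -/
theorem integrable_mul_rate {R : ℝ → ℝ} {c : ℝ} (h : IsStationaryRate R c) :
    Integrable (fun x => x * R x) (explicitLaw R c) := by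
  have := h.isProbabilityMeasure
  have hm := h.rate.measurable
  refine ⟨by fun_prop, ?_⟩
  have h1 := lintegral_gain h.rate h.tendsto c h.pos.le (measurable_const (a := (1 : ℝ≥0∞)))
  rw [hasFiniteIntegral_iff_ofReal]
  · have h2 : ∀ x, gain R (fun _ => 1) x = ENNReal.ofReal (x * R x) := fun x => by
      simp [gain, jump]
    simp only [h2] at h1
    rw [h1]
    simp
  · filter_upwards [ae_explicitLaw_pos R c] with x hx using mul_nonneg hx.le (h.rate.nonneg x)

theorem integrable_testFunction {R : ℝ → ℝ} {c : ℝ} (h : IsStationaryRate R c) {f : ℝ → ℝ}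
    (hf : f ∈ testFunctions) : Integrable f (explicitLaw R c) := by
  have := h.isProbabilityMeasure
  obtain ⟨M, -, hM⟩ := exists_bound_of_mem_testFunctions hf
  exact Integrable.of_bound hf.1.continuous.aestronglyMeasurable M (Eventually.of_forall hM)

theorem integrable_mul_rate_mul {R : ℝ → ℝ} {c : ℝ} (h : IsStationaryRate R c) {f : ℝ → ℝ}
    (hf : Measurable f) {M : ℝ} (hM : ∀ x, |f x| ≤ M) :
    Integrable (fun x => x * R x * f x) (explicitLaw R c) :=
  h.integrable_mul_rate.mul_bdd (c := M) hf.aestronglyMeasurable (Eventually.of_forall hM)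

theorem integrable_flow_generator {R : ℝ → ℝ} {c : ℝ} (h : IsStationaryRate R c) {f : ℝ → ℝ}
    (hf : f ∈ testFunctions) :
    Integrable (fun x => x * deriv f x - x * R x * f x) (explicitLaw R c) := by
  have := h.isProbabilityMeasure
  obtain ⟨M, -, hM⟩ := exists_bound_of_mem_testFunctions hf
  obtain ⟨K, -, hK⟩ := exists_bound_mul_deriv hf
  refine Integrable.sub ?_ (h.integrable_mul_rate_mul hf.1.continuous.measurable hM)
  exact Integrable.of_bound (continuous_mul_deriv hf).aestronglyMeasurable K
    (Eventually.of_forall hK)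

theorem generatorFormula_eq (R : ℝ → ℝ) (f : ℝ → ℝ) {x : ℝ} (hx : 0 < x) :
    generatorFormula R f x = (x * deriv f x - x * R x * f x) + x * R x * jumpMean f x := by
  rw [generatorFormula, ← jumpMean_eq f hx]
  ring

theorem integrable_mul_rate_mul_jumpMean {R : ℝ → ℝ} {c : ℝ} (h : IsStationaryRate R c)
    {f : ℝ → ℝ} (hf : f ∈ testFunctions) :
    Integrable (fun x => x * R x * jumpMean f x) (explicitLaw R c) := by
  obtain ⟨M, -, hM⟩ := exists_bound_of_mem_testFunctions hf
  exact h.integrable_mul_rate_mul (measurable_jumpMean hf.1.continuous.measurable)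
    (abs_jumpMean_le hM)

theorem integrable_generatorFormula {R : ℝ → ℝ} {c : ℝ} (h : IsStationaryRate R c) {f : ℝ → ℝ}
    (hf : f ∈ testFunctions) : Integrable (generatorFormula R f) (explicitLaw R c) := by
  refine ((h.integrable_flow_generator hf).add (h.integrable_mul_rate_mul_jumpMean hf)).congr ?_
  filter_upwards [ae_explicitLaw_pos R c] with x hx using (generatorFormula_eq R f hx).symm

/-- Averaged over the starting point, the number of jumps is Poisson of parameter `2t`: at least one
jump has probability at most `2t`, at least two have probability at most `1 - (1 + 2t)(1 - 2t) =
4t²`. -/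
theorem lintegral_bound_le {R : ℝ → ℝ} {c : ℝ} (h : IsStationaryRate R c) {M K t : ℝ}
    (hM : 0 ≤ M) (hK : 0 ≤ K) (ht : 0 < t) :
    ∫⁻ x, ENNReal.ofReal t⁻¹ * (ENNReal.ofReal (K * t) * (1 - nJump R 0 t (fun _ => 1) x) +
      ENNReal.ofReal (2 * M) * (1 - (nJump R 0 t (fun _ => 1) x + nJump R 1 t (fun _ => 1) x)))
        ∂(explicitLaw R c) ≤ ENNReal.ofReal ((2 * K + 8 * M) * t) := by
  have := h.isProbabilityMeasure
  have hm : ∀ n, Measurable (nJump R n t (fun _ => 1)) := fun n =>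
    (measurable_nJump h.rate n (measurable_const (a := 1))).comp
      (measurable_const.prodMk measurable_id)
  have hle : ∀ n x, nJump R n t (fun _ => 1) x ≤ 1 := fun n x => by
    rw [nJump_one_eq]; exact prob_le_one
  have hle2 : ∀ x, nJump R 0 t (fun _ => 1) x + nJump R 1 t (fun _ => 1) x ≤ 1 := fun x => by
    rw [nJump_one_eq, nJump_one_eq, ← measure_union (disjoint_jumpEvent R t x zero_ne_one)
      (measurableSet_jumpEvent' h.rate 1 t x)]
    exact prob_le_one
  have hI := fun n => lintegral_nJump h.rate h.tendsto h.pos.le n ht.le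
    (measurable_const (a := (1 : ℝ≥0∞)))
  have hI0 := hI 0
  have hI1 := hI 1
  simp only [lintegral_const, measure_univ, mul_one, pow_zero, Nat.factorial_zero, Nat.cast_one,
    div_one, pow_one, Nat.factorial_one] at hI0 hI1
  have he : 1 - 2 * t ≤ Real.exp (-2 * t) := by
    have := Real.add_one_le_exp (-2 * t); linarith
  rw [lintegral_const_mul _ (by have := hm 0; have := hm 1; fun_prop),
    lintegral_add_left (by have := hm 0; fun_prop),
    lintegral_const_mul _ (by have := hm 0; fun_prop),
    lintegral_const_mul _ (by have := hm 0; have := hm 1; fun_prop),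
    lintegral_sub (hm 0) (by rw [hI0]; exact ENNReal.ofReal_ne_top)
      (Eventually.of_forall (hle 0)),
    lintegral_sub (g := fun x => nJump R 0 t (fun _ => 1) x + nJump R 1 t (fun _ => 1) x)
      ((hm 0).add (hm 1)) (by
      rw [lintegral_add_left (hm 0), hI0, hI1]
      exact ENNReal.add_ne_top.2 ⟨ENNReal.ofReal_ne_top, ENNReal.ofReal_ne_top⟩)
      (Eventually.of_forall hle2), lintegral_add_left (hm 0), hI0, hI1,
    ← ENNReal.ofReal_add (by positivity) (by positivity), lintegral_const, measure_univ, mul_one,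
    ← ENNReal.ofReal_one, ← ENNReal.ofReal_sub _ (by positivity),
    ← ENNReal.ofReal_sub _ (by positivity)]
  calc _ ≤ ENNReal.ofReal t⁻¹ * (ENNReal.ofReal (K * t) * ENNReal.ofReal (2 * t) +
        ENNReal.ofReal (2 * M) * ENNReal.ofReal (4 * t ^ 2)) := by
        gcongr
        · linarith
        · nlinarith
    _ = ENNReal.ofReal ((2 * K + 8 * M) * t) := by
        rw [← ENNReal.ofReal_mul (by positivity), ← ENNReal.ofReal_mul (by positivity),
          ← ENNReal.ofReal_add (by positivity) (by positivity),
          ← ENNReal.ofReal_mul (by positivity)]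
        congr 1
        field_simp
        ring

theorem hasGenerator_testFunction {R : ℝ → ℝ} {c : ℝ} (h : IsStationaryRate R c) {f : ℝ → ℝ}
    (hf : f ∈ testFunctions) : HasGenerator R (explicitLaw R c) f (generatorFormula R f) := by
  refine ⟨h.integrable_testFunction hf, h.integrable_generatorFormula hf, ?_⟩
  have := h.isProbabilityMeasure
  obtain ⟨M, hM0, hM⟩ := exists_bound_of_mem_testFunctions hf
  obtain ⟨K, hK0, hK⟩ := exists_bound_mul_deriv hf
  have hfm : Measurable f := hf.1.continuous.measurable
  have hRm := h.rate.measurable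
  have hjm := measurable_jumpMean hfm
  have hdm := measurable_deriv f
  simp only [eLpNorm_one_eq_lintegral_enorm]
  -- The flow generator applied to the constant `1` gives `t⁻¹ (S_x(t) - 1) → -x R(x)` in `L¹`;
  -- multiplied by the bounded `-jumpMean f`, this produces the gain term.
  have hone : Integrable (fun x => x * deriv (fun _ : ℝ => (1 : ℝ)) x - x * R x * 1)
      (explicitLaw R c) := by
    simpa using h.integrable_mul_rate.neg
  have ht1 := h.tendsto_flow_generator hf.1 (h.integrable_flow_generator hf)
  have ht2 := h.tendsto_flow_generator (f := fun _ => 1) contDiff_const hone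
  have ht3 : Tendsto (fun t => ENNReal.ofReal ((2 * K + 8 * M) * t)) (𝓝[>] 0) (𝓝 0) := by
    have : Continuous fun t => ENNReal.ofReal ((2 * K + 8 * M) * t) :=
      ENNReal.continuous_ofReal.comp (by fun_prop)
    simpa using (this.tendsto 0).mono_left nhdsWithin_le_nhds
  have ht4 := ht3.add (ht1.add (ENNReal.Tendsto.const_mul (a := ENNReal.ofReal M) ht2
    (Or.inr ENNReal.ofReal_ne_top)))
  simp only [mul_zero, add_zero] at ht4
  refine tendsto_of_tendsto_of_tendsto_of_le_of_le' tendsto_const_nhds ht4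
    (Eventually.of_forall fun t => zero_le) ?_
  filter_upwards [self_mem_nhdsWithin] with t ht
  have ht0 : (0 : ℝ) < t := ht
  have hsm := h.rate.measurable_survivor_left t
  refine le_trans ?_ (add_le_add_left (h.lintegral_bound_le hM0 hK0 ht0) _)
  rw [← lintegral_const_mul' _ _ ENNReal.ofReal_ne_top, ← lintegral_add_left (by fun_prop),
    ← lintegral_add_right _ (by fun_prop)]
  refine lintegral_mono_ae ?_
  filter_upwards [ae_explicitLaw_pos R c] with x hx
  have hE := enorm_transition_sub_le h.rate hfm hM ht0.le
    (fun y => abs_dilation_sub_le hf.1 hK y ht0.le) hx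
  rw [generatorFormula_eq R f hx]
  have hdecomp : t⁻¹ * (transition R t f x - f x) -
      (x * deriv f x - x * R x * f x + x * R x * jumpMean f x) =
      t⁻¹ * (transition R t f x - (survivor R x t * f (x * Real.exp t) +
        (1 - survivor R x t) * jumpMean f x)) +
      ((t⁻¹ * (survivor R x t * f (x * Real.exp t) - f x) - (x * deriv f x - x * R x * f x)) -
        jumpMean f x * (t⁻¹ * (survivor R x t * 1 - 1) -
          (x * deriv (fun _ : ℝ => (1 : ℝ)) x - x * R x * 1))) := by
    simp only [deriv_const]
    ring
  rw [hdecomp]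
  refine (enorm_add_le _ _).trans (add_le_add ?_ (enorm_sub_le.trans ?_))
  · rw [enorm_mul, Real.enorm_of_nonneg (by positivity)]
    gcongr
  · gcongr
    rw [enorm_mul]
    gcongr
    rw [← ofReal_norm]
    exact ENNReal.ofReal_le_ofReal (abs_jumpMean_le hM x)

end IsStationaryRate

/-! ### Density of the range of the generator of the flow -/

theorem isRate_of_continuous {Q : ℝ → ℝ} (hQ : Continuous Q) (h0 : ∀ x, 0 ≤ Q x) : IsRate Q :=
  ⟨hQ.measurable, h0, hQ.locallyIntegrable⟩

/-- The solution `F` of the equation `F - x F' + x Q F = x² e^{H} k`, where `H` is the cumulative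
rate of `Q`. -/
def flowSolution (Q k : ℝ → ℝ) (x : ℝ) : ℝ :=
  -(x * Real.exp (cumulative Q x) * ∫ y in (0 : ℝ)..x, k y)

theorem hasDerivAt_flowSolution {Q k : ℝ → ℝ} (hQ : Continuous Q) (hk : Continuous k) (x : ℝ) :
    HasDerivAt (flowSolution Q k)
      (-((1 * Real.exp (cumulative Q x) + x * (Real.exp (cumulative Q x) * Q x)) *
        (∫ y in (0 : ℝ)..x, k y) + x * Real.exp (cumulative Q x) * k x)) x := by
  have h1 : HasDerivAt (cumulative Q) (Q x) x :=
    intervalIntegral.integral_hasDerivAt_right (hQ.intervalIntegrable _ _)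
      (hQ.stronglyMeasurableAtFilter _ _) hQ.continuousAt
  have h2 : HasDerivAt (fun x => ∫ y in (0 : ℝ)..x, k y) (k x) x :=
    intervalIntegral.integral_hasDerivAt_right (hk.intervalIntegrable _ _)
      (hk.stronglyMeasurableAtFilter _ _) hk.continuousAt
  exact (((hasDerivAt_id x).mul h1.exp).mul h2).neg

theorem contDiff_flowSolution {Q k : ℝ → ℝ} (hQ : Continuous Q) (h0 : ∀ x, 0 ≤ Q x)
    (hk : Continuous k) : ContDiff ℝ 1 (flowSolution Q k) := by
  rw [contDiff_one_iff_deriv]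
  refine ⟨fun x => (hasDerivAt_flowSolution hQ hk x).differentiableAt, ?_⟩
  rw [funext fun x => (hasDerivAt_flowSolution hQ hk x).deriv]
  have h1 := (isRate_of_continuous hQ h0).continuous_cumulative
  have h2 : Continuous fun x => ∫ y in (0 : ℝ)..x, k y :=
    intervalIntegral.continuous_primitive (fun a b => hk.intervalIntegrable a b) 0
  fun_prop

/-- With `F = x e^H w` the equation for the rate `Q` reduces to `-x² e^H w' = x² e^H k`. Using `R`
in place of `Q` leaves the error `x (R - Q) F`. -/
theorem flowSolution_sub_deriv {Q k : ℝ → ℝ} (hQ : Continuous Q) (hk : Continuous k)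
    (R : ℝ → ℝ) (x : ℝ) :
    flowSolution Q k x - (x * deriv (flowSolution Q k) x - x * R x * flowSolution Q k x) =
      x ^ 2 * Real.exp (cumulative Q x) * k x + x * (R x - Q x) * flowSolution Q k x := by
  rw [(hasDerivAt_flowSolution hQ hk x).deriv, flowSolution]
  ring

/-- The primitive of `k` vanishes to the right of `b` precisely because `k` has integral zero. -/
theorem flowSolution_eq_zero {Q k : ℝ → ℝ} (hk : Continuous k) {a b : ℝ} (ha : 0 < a)
    (hsupp : ∀ x, x ∉ Icc a b → k x = 0) (hint : ∫ y in (0 : ℝ)..b, k y = 0)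
    {x : ℝ} (hx : x ∉ Icc a b) : flowSolution Q k x = 0 := by
  have h0 : ∫ y in (0 : ℝ)..x, k y = 0 := by
    rcases lt_or_ge x a with h | h
    · rw [intervalIntegral.integral_congr (g := fun _ => 0), intervalIntegral.integral_zero]
      intro y hy
      refine hsupp y fun hy' => ?_
      have : y ≤ max 0 x := hy.2
      exact absurd (hy'.1.trans this) (not_le.2 (max_lt ha h))
    · have hbx : b < x := not_le.1 fun h' => hx ⟨h, h'⟩
      rw [← intervalIntegral.integral_add_adjacent_intervals (hk.intervalIntegrable 0 b)
        (hk.intervalIntegrable b x), hint, zero_add,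
        intervalIntegral.integral_congr_ae (g := fun _ => 0), intervalIntegral.integral_zero]
      refine Eventually.of_forall fun y hy => hsupp y fun hy' => ?_
      rw [uIoc_of_le hbx.le] at hy
      exact absurd hy'.2 (not_le.2 hy.1)
  rw [flowSolution, h0, mul_zero, neg_zero]

theorem mem_testFunctions_of_Icc {f : ℝ → ℝ} (hf : ContDiff ℝ 1 f) {a b : ℝ} (ha : 0 < a)
    (hsupp : ∀ x, x ∉ Icc a b → f x = 0) : f ∈ testFunctions := by
  have hs : tsupport f ⊆ Icc a b :=
    closure_minimal (fun x hx => by_contra fun h => hx (hsupp x h)) isClosed_Icc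
  exact ⟨hf, isCompact_Icc.of_isClosed_subset (isClosed_tsupport f) hs,
    fun x hx => ha.trans_le (hs hx).1⟩

theorem exists_continuous_bump : ∃ ψ : ℝ → ℝ, Continuous ψ ∧ (∀ x, 0 ≤ ψ x) ∧
    (∀ x, x ∉ Icc (1 : ℝ) 2 → ψ x = 0) ∧ ∫ x, ψ x = 1 := by
  let φ : ContDiffBump (3 / 2 : ℝ) := ⟨1 / 4, 1 / 2, by norm_num, by norm_num⟩
  refine ⟨φ.normed volume, φ.continuous_normed, φ.nonneg_normed, fun x hx => ?_,
    φ.integral_normed⟩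
  by_contra h
  have h1 : x ∈ Function.support (φ.normed volume) := h
  rw [φ.support_normed_eq, Real.ball_eq_Ioo] at h1
  refine hx ⟨?_, ?_⟩
  · have := h1.1; change 3 / 2 - 1 / 2 < x at this; linarith
  · have := h1.2; change x < 3 / 2 + 1 / 2 at this; linarith

/-- Bumps of integral `1` on `[δ, 2δ]`, of height of order `δ⁻¹`. -/
theorem exists_continuous_bump_scaled : ∃ B : ℝ, 0 ≤ B ∧ ∀ δ : ℝ, 0 < δ → ∃ ψ : ℝ → ℝ,
    Continuous ψ ∧ (∀ x, 0 ≤ ψ x) ∧ (∀ x, ψ x ≤ B / δ) ∧ (∀ x, x ∉ Icc δ (2 * δ) → ψ x = 0) ∧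
    ∫ x, ψ x = 1 := by
  obtain ⟨ψ, hc, h0, hs, hi⟩ := exists_continuous_bump
  have hcs : HasCompactSupport ψ := HasCompactSupport.intro isCompact_Icc hs
  obtain ⟨B, hB⟩ := hc.bounded_above_of_compact_support hcs
  refine ⟨B, (norm_nonneg _).trans (hB 0), fun δ hδ => ⟨fun x => ψ (x / δ) / δ, ?_, ?_, ?_, ?_, ?_⟩⟩
  · fun_prop
  · exact fun x => div_nonneg (h0 _) hδ.le
  · exact fun x => div_le_div_of_nonneg_right ((le_abs_self _).trans (hB _)) hδ.le
  · intro x hx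
    refine div_eq_zero_iff.2 (Or.inl (hs _ fun hx' => ?_))
    exact hx ⟨(one_le_div hδ).1 hx'.1, (div_le_iff₀ hδ).1 hx'.2⟩
  · rw [integral_div, Measure.integral_comp_div (fun x => ψ x) δ, hi, abs_of_pos hδ, smul_eq_mul,
      mul_one, div_self hδ.ne']

/-- The exact solution contains `e^H`, which need not be `C¹`; a continuous rate close to `R` in
`L¹` makes the solution a test function. -/
theorem IsRate.exists_continuous_approx {R : ℝ → ℝ} (hR : IsRate R) (b : ℝ) {ε : ℝ} (hε : 0 < ε) :
    ∃ Q : ℝ → ℝ, Continuous Q ∧ (∀ x, 0 ≤ Q x) ∧ ∫ x in Icc 0 b, |R x - Q x| ≤ ε := by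
  have hRi : IntegrableOn R (Icc 0 b) := hR.locallyIntegrable.integrableOn_isCompact isCompact_Icc
  obtain ⟨q, hq, hqi⟩ := hRi.exists_boundedContinuous_integral_sub_le hε
  have hpt : ∀ x, |R x - max (q x) 0| ≤ ‖R x - q x‖ := fun x => by
    have := hR.nonneg x
    have h1 := abs_max_sub_max_le_abs (R x) (q x) 0
    rwa [max_eq_left this] at h1
  refine ⟨fun x => max (q x) 0, by fun_prop, fun x => le_max_right _ _, le_trans ?_ hq⟩
  refine integral_mono_of_nonneg (Eventually.of_forall fun x => abs_nonneg _)
    (hRi.sub hqi).norm (Eventually.of_forall hpt)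

/-- A bound that involves only `R` and the quality of approximation, so that constants can be fixed
before `Q` is chosen. -/
theorem cumulative_le_of_approx {R Q : ℝ → ℝ} (hR : IsRate R) (hQ : IsRate Q) {b ε : ℝ}
    (h : ∫ x in Icc 0 b, |R x - Q x| ≤ ε) {x : ℝ} (hx : x ∈ Icc 0 b) :
    cumulative Q x ≤ cumulative R b + ε := by
  have hi : IntegrableOn (fun x => R x - Q x) (Icc 0 b) :=
    (hR.locallyIntegrable.sub hQ.locallyIntegrable).integrableOn_isCompact isCompact_Icc
  have h1 : cumulative Q x - cumulative R x ≤ ε := by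
    rw [cumulative, cumulative, ← intervalIntegral.integral_sub (hQ.intervalIntegrable _ _)
      (hR.intervalIntegrable _ _), intervalIntegral.integral_of_le hx.1]
    refine (le_abs_self _).trans (abs_integral_le_integral_abs.trans (le_trans ?_ h))
    simp_rw [abs_sub_comm (Q _)]
    exact setIntegral_mono_set hi.abs (Eventually.of_forall fun x => abs_nonneg _)
      (LE.le.eventuallyLE (Ioc_subset_Icc_self.trans (Icc_subset_Icc_right hx.2)))
  have h2 := hR.monotone_cumulative hx.2
  linarith

namespace IsStationaryRate

/-- On bounded intervals, the stationary law is dominated by a multiple of Lebesgue measure. -/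
theorem integral_le_of_support {R : ℝ → ℝ} {c : ℝ} (h : IsStationaryRate R c) {b : ℝ}
    (hb : 0 ≤ b) {g : ℝ → ℝ} (hg : Measurable g) (hg0 : ∀ x, 0 ≤ g x)
    (hgi : IntegrableOn g (Icc 0 b)) (hsupp : ∀ x, x ∉ Icc 0 b → g x = 0) :
    Integrable g (explicitLaw R c) ∧
      ∫ x, g x ∂(explicitLaw R c) ≤ c * b * ∫ x in Icc 0 b, g x := by
  have hc := h.pos.le
  have key : ∫⁻ x, ENNReal.ofReal (g x) ∂(explicitLaw R c) ≤
      ENNReal.ofReal (c * b * ∫ x in Icc 0 b, g x) := by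
    rw [ENNReal.ofReal_mul (by positivity), ofReal_integral_eq_lintegral_ofReal hgi
      (Eventually.of_forall hg0), lintegral_explicitLaw h.rate c hg.ennreal_ofReal,
      ← lintegral_const_mul' _ _ ENNReal.ofReal_ne_top, ← lintegral_indicator measurableSet_Icc,
      ← lintegral_indicator measurableSet_Ioi]
    refine lintegral_mono fun x => ?_
    by_cases hx : x ∈ Icc 0 b
    · rw [indicator_of_mem hx]
      refine (indicator_le_self _ _ x).trans (mul_le_mul' (ENNReal.ofReal_le_ofReal ?_) le_rfl)
      have h1 : Real.exp (-cumulative R x) ≤ 1 :=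
        Real.exp_le_one_iff.2 (neg_nonpos.2 (h.rate.cumulative_nonneg hx.1))
      calc c * x * Real.exp (-cumulative R x) ≤ c * x * 1 := by
            have := hx.1; gcongr
        _ ≤ c * b := by rw [mul_one]; have := hx.2; gcongr
    · rw [indicator_of_notMem hx]
      refine (indicator_le_self _ _ x).trans ?_
      rw [hsupp x hx]
      simp
  refine ⟨⟨hg.aestronglyMeasurable, ?_⟩, ?_⟩
  · rw [hasFiniteIntegral_iff_ofReal (Eventually.of_forall hg0)]
    exact key.trans_lt ENNReal.ofReal_lt_top
  rw [integral_eq_lintegral_of_nonneg_ae (Eventually.of_forall hg0) hg.aestronglyMeasurable]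
  refine ENNReal.toReal_le_of_le_ofReal ?_ key
  have : 0 ≤ ∫ x in Icc 0 b, g x := integral_nonneg hg0
  positivity

/-- The source `k₀ = g / (x² e^H)`, with `H` cumulative for `Q`, would solve the equation for `Q`
exactly, but its integral `m` need not vanish. Subtracting `m ψ`, with `ψ` a unit bump on `[δ, 2δ]`,
restores compact support at the price `m x² e^H ψ`, of order `δ² · δ⁻¹ = δ`. The other error is `x
(R - Q) F`, small in `L¹`. -/
theorem exists_testFunction_flow_of_continuous {R : ℝ → ℝ} {c : ℝ} (h : IsStationaryRate R c)
    {g : ℝ → ℝ} (hg : Continuous g) {a b : ℝ} (ha : 0 < a) (hab : a ≤ b)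
    (hsupp : ∀ x, x ∉ Icc a b → g x = 0) {ε : ℝ} (hε : 0 < ε) :
    ∃ F ∈ testFunctions, ∫ x, |F x - (x * deriv F x - x * R x * F x) - g x| ∂(explicitLaw R c)
      ≤ ε := by
  have hprob := h.isProbabilityMeasure
  have hc := h.pos
  have hb : 0 < b := ha.trans_le hab
  obtain ⟨M, hM⟩ := hg.bounded_above_of_compact_support
    (HasCompactSupport.intro isCompact_Icc hsupp)
  have hM0 : 0 ≤ M := (norm_nonneg _).trans (hM 0)
  obtain ⟨B, hB0, hbump⟩ := exists_continuous_bump_scaled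
  set E : ℝ := Real.exp (cumulative R b + 1) with hE
  have hE0 : 0 < E := Real.exp_pos _
  set M₁ : ℝ := M / a ^ 2 * b with hM₁
  have hM₁0 : 0 ≤ M₁ := by positivity
  -- the parameters of the approximation
  obtain ⟨δ, hδ, hδa, hδε⟩ : ∃ δ, 0 < δ ∧ 2 * δ ≤ a ∧ 4 * M₁ * B * E * δ ≤ ε / 2 := by
    refine ⟨min (a / 2) (ε / 2 / (4 * M₁ * B * E + 1)), by positivity, ?_, ?_⟩
    · have := min_le_left (a / 2) (ε / 2 / (4 * M₁ * B * E + 1)); linarith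
    · calc 4 * M₁ * B * E * min (a / 2) (ε / 2 / (4 * M₁ * B * E + 1))
          ≤ 4 * M₁ * B * E * (ε / 2 / (4 * M₁ * B * E + 1)) := by
            gcongr; exact min_le_right _ _
        _ ≤ ε / 2 := by
            rw [mul_div_assoc', div_le_iff₀ (by positivity)]
            nlinarith
  -- `κ` will bound the `L¹` distance from `R` to `Q`. The condition `κ ≤ 1` matches the `+ 1` in
  -- `E`, and `b * E * (2 * M₁)` will bound `|F|` uniformly in `Q`.
  obtain ⟨κ, hκ, hκ1, hκε⟩ : ∃ κ, 0 < κ ∧ κ ≤ 1 ∧ c * b * (b * (b * E * (2 * M₁)) * κ) ≤ ε / 2 := by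
    set D := c * b * (b * (b * E * (2 * M₁))) with hD
    have hD0 : 0 ≤ D := by positivity
    refine ⟨min 1 (ε / 2 / (D + 1)), by positivity, min_le_left _ _, ?_⟩
    calc c * b * (b * (b * E * (2 * M₁)) * min 1 (ε / 2 / (D + 1)))
        = D * min 1 (ε / 2 / (D + 1)) := by rw [hD]; ring
      _ ≤ D * (ε / 2 / (D + 1)) := by gcongr; exact min_le_right _ _
      _ ≤ ε / 2 := by
          rw [mul_div_assoc', div_le_iff₀ (by positivity)]
          nlinarith
  obtain ⟨ψ, hψc, hψ0, hψB, hψs, hψi⟩ := hbump δ hδ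
  obtain ⟨Q, hQc, hQ0, hQR⟩ := h.rate.exists_continuous_approx b hκ
  have hQ := isRate_of_continuous hQc hQ0
  have hHE : ∀ x ∈ Icc 0 b, Real.exp (cumulative Q x) ≤ E := fun x hx =>
    Real.exp_le_exp.2 ((cumulative_le_of_approx h.rate hQ hQR hx).trans (by linarith))
  have hHc := hQ.continuous_cumulative
  -- The maximum with `a` removes the singularity at `0` and changes nothing on the support of `g`.
  set k₀ : ℝ → ℝ := fun y => (max y a ^ 2)⁻¹ * Real.exp (-cumulative Q y) * g y with hk₀
  have hk₀c : Continuous k₀ := by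
    have : ∀ y, max y a ^ 2 ≠ 0 := fun y => by
      have : 0 < max y a := lt_max_of_lt_right ha
      positivity
    fun_prop (disch := exact this _)
  have hk₀s : ∀ x, x ∉ Icc a b → k₀ x = 0 := fun x hx => by simp [hk₀, hsupp x hx]
  have hk₀g : ∀ x, x ^ 2 * Real.exp (cumulative Q x) * k₀ x = g x := fun x => by
    by_cases hx : x ∈ Icc a b
    · have hx0 : 0 < x := ha.trans_le hx.1
      simp only [hk₀, max_eq_left hx.1, Real.exp_neg]
      field_simp
    · rw [hk₀s x hx, hsupp x hx, mul_zero]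
  have hk₀M : ∀ x, 0 ≤ x → |k₀ x| ≤ M / a ^ 2 := fun x hx => by
    simp only [hk₀]
    rw [abs_mul, abs_of_nonneg (by positivity), div_eq_mul_inv, mul_comm M]
    have h1 : (max x a ^ 2)⁻¹ ≤ (a ^ 2)⁻¹ := by
      gcongr; exact le_max_right _ _
    have h2 : Real.exp (-cumulative Q x) ≤ 1 :=
      Real.exp_le_one_iff.2 (neg_nonpos.2 (hQ.cumulative_nonneg hx))
    calc (max x a ^ 2)⁻¹ * Real.exp (-cumulative Q x) * |g x| ≤ (a ^ 2)⁻¹ * 1 * M := by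
          gcongr; exact hM x
      _ = (a ^ 2)⁻¹ * M := by ring
  have hk₀int : ∀ x ∈ Icc 0 b, |∫ y in (0 : ℝ)..x, k₀ y| ≤ M₁ := fun x hx => by
    have h1 := intervalIntegral.norm_integral_le_of_norm_le_const (a := 0) (b := x) (f := k₀)
      (C := M / a ^ 2) (fun y hy => by
        rw [uIoc_of_le hx.1] at hy
        exact hk₀M y hy.1.le)
    rw [sub_zero, abs_of_nonneg hx.1] at h1
    exact h1.trans (by rw [hM₁]; have := hx.2; gcongr)
  have hψint : ∀ x ∈ Icc 0 b, |∫ y in (0 : ℝ)..x, ψ y| ≤ 1 := fun x hx => by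
    have hψi' : Integrable ψ := hψc.integrable_of_hasCompactSupport
      (HasCompactSupport.intro isCompact_Icc hψs)
    rw [abs_of_nonneg (intervalIntegral.integral_nonneg hx.1 fun y _ => hψ0 y), ← hψi,
      intervalIntegral.integral_of_le hx.1]
    exact setIntegral_le_integral hψi' (Eventually.of_forall hψ0)
  have hψb : ∫ y in (0 : ℝ)..b, ψ y = 1 := by
    rw [← hψi, intervalIntegral.integral_of_le hb.le]
    refine setIntegral_eq_integral_of_forall_compl_eq_zero fun x hx => hψs x fun hx' => hx ⟨?_, ?_⟩
    · exact hδ.trans_le hx'.1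
    · exact hx'.2.trans (hδa.trans hab)
  set m : ℝ := ∫ y in (0 : ℝ)..b, k₀ y with hm
  have hmM : |m| ≤ M₁ := hk₀int b ⟨hb.le, le_rfl⟩
  set k : ℝ → ℝ := fun y => k₀ y - m * ψ y with hk
  have hkc : Continuous k := by fun_prop
  have hks : ∀ x, x ∉ Icc δ b → k x = 0 := fun x hx => by
    simp only [hk]
    rw [hk₀s x fun hx' => hx ⟨by linarith [hx'.1], hx'.2⟩,
      hψs x fun hx' => hx ⟨hx'.1, by linarith [hx'.2]⟩]
    simp
  have hkint : ∀ x, ∫ y in (0 : ℝ)..x, k y =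
      (∫ y in (0 : ℝ)..x, k₀ y) - m * ∫ y in (0 : ℝ)..x, ψ y := fun x => by
    rw [← intervalIntegral.integral_const_mul, ← intervalIntegral.integral_sub
      (hk₀c.intervalIntegrable _ _) ((hψc.const_mul m).intervalIntegrable _ _)]
  have hkb : ∫ y in (0 : ℝ)..b, k y = 0 := by rw [hkint, hψb, mul_one, sub_self]
  have hFs : ∀ x, x ∉ Icc δ b → flowSolution Q k x = 0 := fun x hx =>
    flowSolution_eq_zero hkc hδ hks hkb hx
  have hFC := contDiff_flowSolution hQc hQ0 hkc
  have hFM : ∀ x, |flowSolution Q k x| ≤ b * E * (2 * M₁) := fun x => by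
    by_cases hx : x ∈ Icc δ b
    · have hx' : x ∈ Icc 0 b := ⟨hδ.le.trans hx.1, hx.2⟩
      rw [flowSolution, abs_neg, abs_mul, abs_mul, abs_of_nonneg hx'.1, Real.abs_exp, hkint]
      have h1 : |(∫ y in (0 : ℝ)..x, k₀ y) - m * ∫ y in (0 : ℝ)..x, ψ y| ≤ 2 * M₁ := by
        refine (abs_sub _ _).trans ?_
        rw [abs_mul]
        have h2 : |m| * |∫ y in (0 : ℝ)..x, ψ y| ≤ M₁ * 1 := by
          gcongr
          exact hψint x hx'
        linarith [hk₀int x hx']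
      have := hHE x hx'
      have := hx'.1
      have := hx'.2
      gcongr
    · rw [hFs x hx, abs_zero]
      positivity
  refine ⟨flowSolution Q k, mem_testFunctions_of_Icc hFC hδ hFs, ?_⟩
  -- the error terms
  have hRm := h.rate.measurable
  have hFm : Measurable (flowSolution Q k) := hFC.continuous.measurable
  set e : ℝ → ℝ := fun x => |x * (R x - Q x) * flowSolution Q k x| with he
  have hem : Measurable e := by fun_prop
  have hes : ∀ x, x ∉ Icc 0 b → e x = 0 := fun x hx => by
    simp only [he]
    rw [hFs x fun hx' => hx ⟨hδ.le.trans hx'.1, hx'.2⟩, mul_zero, abs_zero]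
  have heb : ∀ x ∈ Icc 0 b, e x ≤ b * (b * E * (2 * M₁)) * |R x - Q x| := fun x hx => by
    simp only [he]
    rw [abs_mul, abs_mul, abs_of_nonneg hx.1]
    calc x * |R x - Q x| * |flowSolution Q k x| ≤ b * |R x - Q x| * (b * E * (2 * M₁)) := by
          have := hx.2
          have := hFM x
          gcongr
      _ = _ := by ring
  have hRQ : IntegrableOn (fun x => |R x - Q x|) (Icc 0 b) :=
    ((h.rate.locallyIntegrable.sub hQ.locallyIntegrable).integrableOn_isCompact
      isCompact_Icc).abs
  have hei : IntegrableOn e (Icc 0 b) := by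
    refine Integrable.mono' (hRQ.const_mul (b * (b * E * (2 * M₁)))) hem.aestronglyMeasurable ?_
    filter_upwards [ae_restrict_mem measurableSet_Icc] with x hx
    rw [Real.norm_of_nonneg (abs_nonneg _)]
    exact heb x hx
  obtain ⟨hei', heint'⟩ := h.integral_le_of_support hb.le hem (fun x => abs_nonneg _) hei hes
  have heint : ∫ x, e x ∂(explicitLaw R c) ≤ ε / 2 := by
    refine heint'.trans (le_trans ?_ hκε)
    gcongr
    calc ∫ x in Icc 0 b, e x ≤ ∫ x in Icc 0 b, b * (b * E * (2 * M₁)) * |R x - Q x| :=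
          setIntegral_mono_on hei (hRQ.const_mul _) measurableSet_Icc heb
      _ ≤ b * (b * E * (2 * M₁)) * κ := by
          rw [integral_const_mul]
          gcongr
  have hpt : ∀ x, |flowSolution Q k x - (x * deriv (flowSolution Q k) x -
      x * R x * flowSolution Q k x) - g x| ≤ ε / 2 + e x := fun x => by
    rw [flowSolution_sub_deriv hQc hkc]
    have h1 : x ^ 2 * Real.exp (cumulative Q x) * k x + x * (R x - Q x) * flowSolution Q k x - g x =
        -(m * (x ^ 2 * Real.exp (cumulative Q x) * ψ x)) +
          x * (R x - Q x) * flowSolution Q k x := by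
      rw [← hk₀g x]
      simp only [hk]
      ring
    rw [h1]
    refine (abs_add_le _ _).trans (add_le_add_left ?_ _)
    by_cases hx : x ∈ Icc δ (2 * δ)
    · have hx' : x ∈ Icc 0 b := ⟨hδ.le.trans hx.1, hx.2.trans (hδa.trans hab)⟩
      have hx0 := hx'.1
      rw [abs_neg, abs_mul, abs_of_nonneg (mul_nonneg (by positivity) (hψ0 x))]
      calc |m| * (x ^ 2 * Real.exp (cumulative Q x) * ψ x)
          ≤ M₁ * ((2 * δ) ^ 2 * E * (B / δ)) := by
            have := hx.2
            have := hHE x hx'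
            have := hψB x
            have := hψ0 x
            gcongr
        _ = 4 * M₁ * B * E * δ := by field_simp; ring
        _ ≤ ε / 2 := hδε
    · rw [hψs x hx]
      simp only [mul_zero, neg_zero, abs_zero]
      positivity
  calc _ ≤ ∫ x, (ε / 2 + e x) ∂(explicitLaw R c) :=
        integral_mono_of_nonneg (Eventually.of_forall fun x => abs_nonneg _)
          ((integrable_const _).add hei') (Eventually.of_forall hpt)
    _ ≤ ε := by
        rw [integral_add (integrable_const _) hei', integral_const]
        simp only [probReal_univ, one_smul]
        linarith

end IsStationaryRate

/-! ### The core -/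

namespace IsStationaryRate

theorem exists_continuous_Icc_approx {R : ℝ → ℝ} {c : ℝ} (h : IsStationaryRate R c) {f : ℝ → ℝ}
    (hf : Integrable f (explicitLaw R c)) {ε : ℝ} (hε : 0 < ε) :
    ∃ (g : ℝ → ℝ) (a b : ℝ), Continuous g ∧ 0 < a ∧ a ≤ b ∧ (∀ x, x ∉ Icc a b → g x = 0) ∧
      ∫ x, |f x - g x| ∂(explicitLaw R c) ≤ ε := by
  have hprob := h.isProbabilityMeasure
  obtain ⟨g, hgs, hfg, hgc, hgi⟩ := hf.exists_hasCompactSupport_integral_sub_le (half_pos hε)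
  -- A cutoff near `0`: it vanishes for `x ≤ 1/(n+1)` and equals `1` for `x ≥ 2/(n+1)`. It converges
  -- to `1` almost everywhere since the law charges only `(0, ∞)`.
  set θ : ℕ → ℝ → ℝ := fun n x => min 1 (max 0 ((n + 1) * x - 1)) with hθ
  have hθc : ∀ n, Continuous (θ n) := fun n => by fun_prop
  have hθ0 : ∀ n x, 0 ≤ θ n x := fun n x => le_min zero_le_one (le_max_left _ _)
  have hθ1 : ∀ n x, θ n x ≤ 1 := fun n x => min_le_left _ _
  have hlim : Tendsto (fun n => ∫ x, |g x - g x * θ n x| ∂(explicitLaw R c)) atTop (𝓝 0) := by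
    rw [← integral_zero ℝ ℝ (μ := explicitLaw R c)]
    refine tendsto_integral_of_dominated_convergence (fun x => |g x|)
      (fun n => (hgc.sub (hgc.mul (hθc n))).abs.aestronglyMeasurable) hgi.abs
      (fun n => Eventually.of_forall fun x => ?_) ?_
    · rw [Real.norm_eq_abs, abs_abs, ← mul_one_sub, abs_mul]
      refine mul_le_of_le_one_right (abs_nonneg _) ?_
      rw [abs_of_nonneg (by linarith [hθ1 n x])]
      linarith [hθ0 n x]
    · filter_upwards [ae_explicitLaw_pos R c] with x hx
      refine tendsto_const_nhds.congr' ?_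
      obtain ⟨N, hN⟩ := exists_nat_gt (2 / x)
      filter_upwards [eventually_ge_atTop N] with n hn
      have h1 : 2 ≤ (n + 1) * x := by
        rw [div_lt_iff₀ hx] at hN
        have : (N : ℝ) ≤ n := by exact_mod_cast hn
        nlinarith
      have h2 : θ n x = 1 := min_eq_left (le_max_of_le_right (by linarith))
      rw [h2, mul_one, sub_self, abs_zero]
  obtain ⟨n, hn⟩ := (hlim.eventually_lt_const (half_pos hε)).exists
  obtain ⟨r, hr⟩ := hgs.isCompact.isBounded.subset_closedBall 0
  have hn1 : (0 : ℝ) < n + 1 := by positivity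
  refine ⟨fun x => g x * θ n x, ((n : ℝ) + 1)⁻¹, max ((n : ℝ) + 1)⁻¹ r, hgc.mul (hθc n),
    by positivity, le_max_left _ _, fun x hx => ?_, ?_⟩
  · by_cases hxn : x < ((n : ℝ) + 1)⁻¹
    · have h1 : (n + 1) * x - 1 ≤ 0 := by
        rw [← one_div, lt_div_iff₀ hn1] at hxn
        linarith
      simp [hθ, max_eq_left h1]
    · have h2 : r < x := by
        by_contra h3
        exact hx ⟨not_lt.1 hxn, (not_lt.1 h3).trans (le_max_right _ _)⟩
      have h3 : g x = 0 := by
        by_contra h4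
        have h5 := hr (subset_tsupport g h4)
        rw [mem_closedBall_zero_iff, Real.norm_eq_abs] at h5
        exact absurd ((le_abs_self x).trans h5) (not_le.2 h2)
      exact mul_eq_zero_of_left h3 _
  · have hi : Integrable (fun x => g x - g x * θ n x) (explicitLaw R c) := by
      refine hgi.sub (hgi.mul_bdd (c := 1) (hθc n).aestronglyMeasurable
        (Eventually.of_forall fun x => ?_))
      rw [Real.norm_of_nonneg (hθ0 n x)]
      exact hθ1 n x
    calc ∫ x, |f x - g x * θ n x| ∂(explicitLaw R c)
        ≤ ∫ x, (|f x - g x| + |g x - g x * θ n x|) ∂(explicitLaw R c) :=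
          integral_mono_of_nonneg (Eventually.of_forall fun x => abs_nonneg _)
            ((hf.sub hgi).abs.add hi.abs)
            (Eventually.of_forall fun x => abs_sub_le (f x) (g x) (g x * θ n x))
      _ = ∫ x, |f x - g x| ∂(explicitLaw R c) +
            ∫ x, |g x - g x * θ n x| ∂(explicitLaw R c) := integral_add (hf.sub hgi).abs hi.abs
      _ ≤ ε := by
          have : ∫ x, |f x - g x| ∂(explicitLaw R c) ≤ ε / 2 := hfg
          linarith

theorem exists_testFunction_flow {R : ℝ → ℝ} {c : ℝ} (h : IsStationaryRate R c)
    {f : ℝ → ℝ} (hf : Integrable f (explicitLaw R c)) {ε : ℝ} (hε : 0 < ε) :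
    ∃ F ∈ testFunctions, ∫ x, |F x - (x * deriv F x - x * R x * F x) - f x| ∂(explicitLaw R c)
      ≤ ε := by
  have hprob := h.isProbabilityMeasure
  obtain ⟨g, a, b, hgc, ha, hab, hgs, hfg⟩ := h.exists_continuous_Icc_approx hf (half_pos hε)
  obtain ⟨F, hF, hFg⟩ := h.exists_testFunction_flow_of_continuous hgc ha hab hgs (half_pos hε)
  have hgi : Integrable g (explicitLaw R c) := by
    obtain ⟨M, hM⟩ := hgc.bounded_above_of_compact_support
      (HasCompactSupport.intro isCompact_Icc hgs)
    exact Integrable.of_bound hgc.aestronglyMeasurable M (Eventually.of_forall hM)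
  have hi := ((h.integrable_testFunction hF).sub (h.integrable_flow_generator hF)).sub hgi
  refine ⟨F, hF, ?_⟩
  calc _ ≤ ∫ x, (|F x - (x * deriv F x - x * R x * F x) - g x| + |f x - g x|)
          ∂(explicitLaw R c) := by
        refine integral_mono_of_nonneg (Eventually.of_forall fun x => abs_nonneg _)
          (hi.abs.add (hf.sub hgi).abs) (Eventually.of_forall fun x => ?_)
        have := abs_sub_le (F x - (x * deriv F x - x * R x * F x)) (g x) (f x)
        rwa [abs_sub_comm (g x)] at this
    _ = ∫ x, |F x - (x * deriv F x - x * R x * F x) - g x| ∂(explicitLaw R c) +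
          ∫ x, |f x - g x| ∂(explicitLaw R c) := integral_add hi.abs (hf.sub hgi).abs
    _ ≤ ε := by linarith

end IsStationaryRate

/-- Dissipativity of the derivative at `0` of a family of operators whose norm decreases at
rate `κ`. -/
theorem integral_abs_le_of_generator {μ : Measure ℝ} {f g : ℝ → ℝ} {T : ℝ → ℝ → ℝ} {r : ℝ → ℝ}
    {κ : ℝ} (hf : Integrable f μ) (hg : Integrable g μ)
    (hT : ∀ t, 0 < t → Integrable (T t) μ)
    (hTr : ∀ t, 0 < t → ∫ x, |T t x| ∂μ ≤ r t * ∫ x, |f x| ∂μ)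
    (hr : Tendsto (fun t => t⁻¹ * (1 - r t)) (𝓝[>] 0) (𝓝 κ))
    (hlim : Tendsto (fun t => ∫⁻ x, ‖t⁻¹ * (T t x - f x) - g x‖ₑ ∂μ) (𝓝[>] 0) (𝓝 0)) :
    (1 + κ) * ∫ x, |f x| ∂μ ≤ ∫ x, |f x - g x| ∂μ := by
  have hlim' : Tendsto (fun t => ∫ x, |f x - g x| ∂μ +
      (∫⁻ x, ‖t⁻¹ * (T t x - f x) - g x‖ₑ ∂μ).toReal) (𝓝[>] 0)
      (𝓝 (∫ x, |f x - g x| ∂μ + 0)) := by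
    refine tendsto_const_nhds.add ?_
    simpa [Function.comp_def] using (ENNReal.tendsto_toReal ENNReal.zero_ne_top).comp hlim
  rw [add_zero] at hlim'
  have hlim2 : Tendsto (fun t => (1 + t⁻¹ * (1 - r t)) * ∫ x, |f x| ∂μ) (𝓝[>] 0)
      (𝓝 ((1 + κ) * ∫ x, |f x| ∂μ)) := (tendsto_const_nhds.add hr).mul_const _
  refine le_of_tendsto_of_tendsto hlim2 hlim' ?_
  filter_upwards [self_mem_nhdsWithin] with t ht
  have ht0 : (0 : ℝ) < t := ht
  have hq : Integrable (fun x => t⁻¹ * (T t x - f x) - g x) μ :=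
    (((hT t ht0).sub hf).const_mul _).sub hg
  have hqe : (∫⁻ x, ‖t⁻¹ * (T t x - f x) - g x‖ₑ ∂μ).toReal =
      ∫ x, |t⁻¹ * (T t x - f x) - g x| ∂μ :=
    (integral_norm_eq_lintegral_enorm hq.aestronglyMeasurable).symm
  have h1 : (1 + t⁻¹) * ∫ x, |f x| ∂μ ≤ ∫ x, |f x - g x| ∂μ +
      ∫ x, |t⁻¹ * (T t x - f x) - g x| ∂μ + t⁻¹ * ∫ x, |T t x| ∂μ := by
    have i1 : Integrable (fun x => |f x - g x|) μ := (hf.sub hg).abs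
    have i2 : Integrable (fun x => |t⁻¹ * (T t x - f x) - g x|) μ := hq.abs
    have i3 : Integrable (fun x => t⁻¹ * |T t x|) μ := (hT t ht0).abs.const_mul _
    have i4 : Integrable (fun x => |f x - g x| + |t⁻¹ * (T t x - f x) - g x|) μ := i1.add i2
    rw [← integral_const_mul, ← integral_const_mul, ← integral_add i1 i2, ← integral_add i4 i3]
    refine integral_mono (hf.abs.const_mul _) (i4.add i3) fun x => ?_
    have hpos : 0 < t⁻¹ := by positivity
    -- Taking norms and inserting `‖T t‖ ≤ r t ‖f‖` moves the last term to the left, giving the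
    -- factor `1 + t⁻¹ (1 - r t)`, which tends to `1 + κ`.
    have h2 : (1 + t⁻¹) * f x = (f x - g x) - (t⁻¹ * (T t x - f x) - g x) + t⁻¹ * T t x := by ring
    change (1 + t⁻¹) * |f x| ≤ |f x - g x| + |t⁻¹ * (T t x - f x) - g x| + t⁻¹ * |T t x|
    rw [← abs_of_pos (show 0 < 1 + t⁻¹ by positivity), ← abs_mul, h2,
      ← abs_of_pos hpos, ← abs_mul, abs_of_pos hpos]
    exact (abs_add_le _ _).trans (add_le_add_left (abs_sub _ _) _)
  have h2 := mul_le_mul_of_nonneg_left (hTr t ht0) (inv_nonneg.2 ht0.le)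
  rw [hqe]
  nlinarith

namespace IsStationaryRate

theorem integral_abs_le_of_hasGenerator {R : ℝ → ℝ} {c : ℝ} (h : IsStationaryRate R c)
    {f g : ℝ → ℝ} (hfg : HasGenerator R (explicitLaw R c) f g) :
    ∫ x, |f x| ∂(explicitLaw R c) ≤ ∫ x, |f x - g x| ∂(explicitLaw R c) := by
  obtain ⟨hf, hg, hlim⟩ := hfg
  simp only [eLpNorm_one_eq_lintegral_enorm] at hlim
  have := integral_abs_le_of_generator (T := fun t => transition R t f) (r := fun _ => 1) (κ := 0)
    hf hg (fun t ht => h.integrable_transition ht.le hf)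
    (fun t ht => by rw [one_mul]; exact h.integral_norm_transition_le ht.le hf) (by simp) hlim
  simpa using this

/-- The `3` is `1 + 2`, where `2` is the decay rate of the killed flow. It exceeds the norm `2` of
the gain, and this gap makes the perturbation argument work. -/
theorem integral_abs_testFunction_le {R : ℝ → ℝ} {c : ℝ} (h : IsStationaryRate R c)
    {f : ℝ → ℝ} (hf : f ∈ testFunctions) :
    3 * ∫ x, |f x| ∂(explicitLaw R c) ≤
      ∫ x, |f x - (x * deriv f x - x * R x * f x)| ∂(explicitLaw R c) := by
  have hfi := h.integrable_testFunction hf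
  have hfm := hf.1.continuous.measurable
  have hTe := fun t => h.lintegral_enorm_survivor_mul t hfm
  have hTm := fun t => (h.measurable_survivor_mul t hfm).aestronglyMeasurable
    (μ := explicitLaw R c)
  have hTi : ∀ t, Integrable (fun x => survivor R x t * f (x * Real.exp t)) (explicitLaw R c) :=
    fun t => ⟨hTm t, by
      rw [HasFiniteIntegral, hTe]
      exact ENNReal.mul_lt_top ENNReal.ofReal_lt_top hfi.2⟩
  have hr : Tendsto (fun t : ℝ => t⁻¹ * (1 - Real.exp (-2 * t))) (𝓝[>] 0) (𝓝 2) := by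
    have h1 : HasDerivAt (fun t : ℝ => 1 - Real.exp (-2 * t)) 2 0 := by
      have := (((hasDerivAt_id (0 : ℝ)).const_mul (-2)).exp).const_sub 1
      simpa using this
    have h2 := h1.tendsto_slope_zero_right
    simpa using h2
  have h3 := integral_abs_le_of_generator
    (T := fun t x => survivor R x t * f (x * Real.exp t)) (r := fun t => Real.exp (-2 * t))
    hfi (h.integrable_flow_generator hf) (fun t _ => hTi t)
    (fun t _ => by
      have h4 : ∀ {k : ℝ → ℝ}, AEStronglyMeasurable k (explicitLaw R c) →
          ∫ x, |k x| ∂(explicitLaw R c) = (∫⁻ x, ‖k x‖ₑ ∂(explicitLaw R c)).toReal :=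
        fun hk => integral_norm_eq_lintegral_enorm hk
      rw [h4 (hTm t), h4 hfi.aestronglyMeasurable, hTe, ENNReal.toReal_mul,
        ENNReal.toReal_ofReal (Real.exp_pos _).le])
    hr (h.tendsto_flow_generator hf.1 (h.integrable_flow_generator hf))
  norm_num at h3
  exact h3

theorem integral_abs_mul_rate_mul_jumpMean_le {R : ℝ → ℝ} {c : ℝ} (h : IsStationaryRate R c)
    {f : ℝ → ℝ} (hf : f ∈ testFunctions) :
    ∫ x, |x * R x * jumpMean f x| ∂(explicitLaw R c) ≤ 2 * ∫ x, |f x| ∂(explicitLaw R c) := by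
  have hfi := h.integrable_testFunction hf
  have hfm := hf.1.continuous.measurable
  have hji := h.integrable_mul_rate_mul_jumpMean hf
  have h4 : ∀ {k : ℝ → ℝ}, AEStronglyMeasurable k (explicitLaw R c) →
      ∫ x, |k x| ∂(explicitLaw R c) = (∫⁻ x, ‖k x‖ₑ ∂(explicitLaw R c)).toReal :=
    fun hk => integral_norm_eq_lintegral_enorm hk
  rw [h4 hji.aestronglyMeasurable, h4 hfi.aestronglyMeasurable, ← ENNReal.toReal_ofNat,
    ← ENNReal.toReal_mul]
  refine ENNReal.toReal_mono (ENNReal.mul_ne_top ENNReal.ofNat_ne_top hfi.2.ne) ?_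
  rw [← lintegral_gain h.rate h.tendsto c h.pos.le hfm.enorm]
  refine lintegral_mono_ae ?_
  filter_upwards [ae_explicitLaw_pos R c] with x hx
  rw [enorm_mul, gain, Real.enorm_of_nonneg (mul_nonneg hx.le (h.rate.nonneg x))]
  gcongr
  exact enorm_integral_le_lintegral_enorm _

/-- The residual `f - (F - 𝓛 F)` can be reduced by a factor `3/4`. -/
theorem exists_testFunction_residual {R : ℝ → ℝ} {c : ℝ} (h : IsStationaryRate R c)
    {f : ℝ → ℝ} (hf : Integrable f (explicitLaw R c)) {r : ℝ} (hr : 0 < r)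
    (hfr : ∫ x, |f x| ∂(explicitLaw R c) ≤ r) :
    ∃ F ∈ testFunctions, ∫ x, |f x - (F x - generatorFormula R F x)| ∂(explicitLaw R c)
      ≤ 3 / 4 * r := by
  -- The tolerance is chosen so that `1/20 + (2/3)(1 + 1/20) = 3/4`.
  obtain ⟨F, hF, hFf⟩ := h.exists_testFunction_flow hf (show 0 < r / 20 by positivity)
  refine ⟨F, hF, ?_⟩
  have hFi := h.integrable_testFunction hF
  have hBi := hFi.sub (h.integrable_flow_generator hF)
  have hAi := h.integrable_mul_rate_mul_jumpMean hF
  have h1 := h.integral_abs_testFunction_le hF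
  have h2 := h.integral_abs_mul_rate_mul_jumpMean_le hF
  have h3 : ∫ x, |F x - (x * deriv F x - x * R x * F x)| ∂(explicitLaw R c) ≤ r / 20 + r := by
    calc _ ≤ ∫ x, (|F x - (x * deriv F x - x * R x * F x) - f x| + |f x|) ∂(explicitLaw R c) := by
          refine integral_mono hBi.abs ((hBi.sub hf).abs.add hf.abs) fun x => ?_
          have := abs_add_le (F x - (x * deriv F x - x * R x * F x) - f x) (f x)
          rwa [sub_add_cancel] at this
      _ = _ := integral_add (hBi.sub hf).abs hf.abs
      _ ≤ _ := add_le_add hFf hfr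
  calc _ ≤ ∫ x, (|F x - (x * deriv F x - x * R x * F x) - f x| + |x * R x * jumpMean F x|)
          ∂(explicitLaw R c) := by
        refine integral_mono_ae (hf.sub (hFi.sub (h.integrable_generatorFormula hF))).abs
          ((hBi.sub hf).abs.add hAi.abs) ?_
        filter_upwards [ae_explicitLaw_pos R c] with x hx
        rw [generatorFormula_eq R F hx, abs_sub_comm]
        have := abs_sub (F x - (x * deriv F x - x * R x * F x) - f x) (x * R x * jumpMean F x)
        refine le_trans (le_of_eq ?_) this
        congr 1
        ring
    _ = _ := integral_add (hBi.sub hf).abs hAi.abs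
    _ ≤ 3 / 4 * r := by linarith

theorem add_mem_testFunctions {f g : ℝ → ℝ} (hf : f ∈ testFunctions) (hg : g ∈ testFunctions) :
    (fun x => f x + g x) ∈ testFunctions :=
  ⟨hf.1.add hg.1, hf.2.1.add hg.2.1, (tsupport_add f g).trans (union_subset hf.2.2 hg.2.2)⟩

theorem zero_mem_testFunctions : (fun _ => (0 : ℝ)) ∈ testFunctions :=
  ⟨contDiff_const, HasCompactSupport.zero, by simp [tsupport]⟩

theorem generatorFormula_add (R : ℝ → ℝ) {f g : ℝ → ℝ} (hf : f ∈ testFunctions)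
    (hg : g ∈ testFunctions) (x : ℝ) :
    generatorFormula R (fun x => f x + g x) x = generatorFormula R f x + generatorFormula R g x := by
  have hi : ∀ {k : ℝ → ℝ}, k ∈ testFunctions →
      IntervalIntegrable (fun u => 2 * u / x ^ 2 * k u) volume 0 x := fun hk =>
    Continuous.intervalIntegrable (by have := hk.1.continuous; fun_prop) _ _
  simp only [generatorFormula, mul_add]
  rw [deriv_fun_add (hf.1.differentiable one_ne_zero x) (hg.1.differentiable one_ne_zero x),
    intervalIntegral.integral_add (hi hf) (hi hg)]
  ring

/-- A Neumann series: each step corrects the residual left by the previous one. The added `1` keeps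
the bound positive even when `f` vanishes almost everywhere. -/
theorem exists_testFunction_iterate {R : ℝ → ℝ} {c : ℝ} (h : IsStationaryRate R c)
    {f : ℝ → ℝ} (hf : Integrable f (explicitLaw R c)) (n : ℕ) :
    ∃ F ∈ testFunctions, ∫ x, |f x - (F x - generatorFormula R F x)| ∂(explicitLaw R c)
      ≤ (3 / 4) ^ n * (∫ x, |f x| ∂(explicitLaw R c) + 1) := by
  have hpos : 0 < ∫ x, |f x| ∂(explicitLaw R c) + 1 := by
    have : 0 ≤ ∫ x, |f x| ∂(explicitLaw R c) := integral_nonneg fun x => abs_nonneg _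
    linarith
  induction n with
  | zero =>
    refine ⟨_, zero_mem_testFunctions, ?_⟩
    simp [generatorFormula]
  | succ n ih =>
    obtain ⟨F, hF, hFr⟩ := ih
    have hi := hf.sub ((h.integrable_testFunction hF).sub (h.integrable_generatorFormula hF))
    obtain ⟨G, hG, hGr⟩ := h.exists_testFunction_residual hi (by positivity) hFr
    refine ⟨_, add_mem_testFunctions hF hG, ?_⟩
    rw [pow_succ', mul_assoc]
    refine le_trans (le_of_eq (integral_congr_ae ?_)) hGr
    filter_upwards with x
    simp only [Pi.sub_apply]
    rw [generatorFormula_add R hF hG x]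
    congr 1
    ring

theorem exists_testFunction_range {R : ℝ → ℝ} {c : ℝ} (h : IsStationaryRate R c)
    {f : ℝ → ℝ} (hf : Integrable f (explicitLaw R c)) {ε : ℝ} (hε : 0 < ε) :
    ∃ F ∈ testFunctions, ∫ x, |f x - (F x - generatorFormula R F x)| ∂(explicitLaw R c) < ε := by
  have hlim : Tendsto (fun n : ℕ => (3 / 4 : ℝ) ^ n * (∫ x, |f x| ∂(explicitLaw R c) + 1)) atTop
      (𝓝 (0 * (∫ x, |f x| ∂(explicitLaw R c) + 1))) :=
    (tendsto_pow_atTop_nhds_zero_of_lt_one (by norm_num) (by norm_num)).mul_const _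
  rw [zero_mul] at hlim
  obtain ⟨n, hn⟩ := (hlim.eventually_lt_const hε).exists
  obtain ⟨F, hF, hFr⟩ := h.exists_testFunction_iterate hf n
  exact ⟨F, hF, hFr.trans_lt hn⟩

theorem hasGenerator_sub {R : ℝ → ℝ} {c : ℝ} (h : IsStationaryRate R c) {f g f' g' : ℝ → ℝ}
    (hfg : HasGenerator R (explicitLaw R c) f g) (hfg' : HasGenerator R (explicitLaw R c) f' g') :
    HasGenerator R (explicitLaw R c) (fun x => f x - f' x) (fun x => g x - g' x) := by
  obtain ⟨hf, hg, hl⟩ := hfg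
  obtain ⟨hf', hg', hl'⟩ := hfg'
  refine ⟨hf.sub hf', hg.sub hg', ?_⟩
  have hl2 := hl.add hl'
  rw [add_zero] at hl2
  refine tendsto_of_tendsto_of_tendsto_of_le_of_le' tendsto_const_nhds hl2
    (Eventually.of_forall fun t => zero_le) ?_
  filter_upwards [self_mem_nhdsWithin] with t ht
  have ht0 : (0 : ℝ) ≤ t := le_of_lt ht
  have hi : ∀ {k l : ℝ → ℝ}, Integrable k (explicitLaw R c) → Integrable l (explicitLaw R c) →
      AEStronglyMeasurable (fun x => t⁻¹ * (transition R t k x - k x) - l x) (explicitLaw R c) :=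
    fun hk hl => ((((h.integrable_transition ht0 hk).sub hk).const_mul _).sub hl).1
  refine le_trans (le_of_eq (eLpNorm_congr_ae ?_)) (eLpNorm_sub_le (hi hf hg) (hi hf' hg') le_rfl)
  -- Linearity of `transition` is used only where both integrands are integrable, which is almost
  -- everywhere.
  filter_upwards [h.ae_integrable_cell ht0 hf, h.ae_integrable_cell ht0 hf'] with x hx hx'
  have : transition R t (fun x => f x - f' x) x = transition R t f x - transition R t f' x :=
    integral_sub hx hx'
  simp only [Pi.sub_apply]
  rw [this]
  ring

/-- Dissipativity applied to `F - f` bounds it by the residual of `1 - 𝓛`; the generators are then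
close by the triangle inequality. -/
theorem exists_testFunction_graph {R : ℝ → ℝ} {c : ℝ} (h : IsStationaryRate R c) {f g : ℝ → ℝ}
    (hfg : HasGenerator R (explicitLaw R c) f g) {ε : ℝ} (hε : 0 < ε) :
    ∃ F ∈ testFunctions, ∫ x, |F x - f x| ∂(explicitLaw R c) ≤ ε ∧
      ∫ x, |generatorFormula R F x - g x| ∂(explicitLaw R c) ≤ ε := by
  obtain ⟨F, hF, hFr⟩ := h.exists_testFunction_range (hfg.1.sub hfg.2.1) (half_pos hε)
  have hFG := h.hasGenerator_testFunction hF
  have hd := h.hasGenerator_sub hFG hfg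
  have h1 := h.integral_abs_le_of_hasGenerator hd
  have h2 : ∫ x, |F x - f x - (generatorFormula R F x - g x)| ∂(explicitLaw R c) ≤ ε / 2 := by
    refine le_trans (le_of_eq (integral_congr_ae (Eventually.of_forall fun x => ?_))) hFr.le
    simp only [Pi.sub_apply]
    rw [abs_sub_comm]
    congr 1
    ring
  refine ⟨F, hF, by linarith, ?_⟩
  calc _ ≤ ∫ x, (|F x - f x| + |F x - f x - (generatorFormula R F x - g x)|)
        ∂(explicitLaw R c) := by
        refine integral_mono hd.2.1.abs (hd.1.abs.add (hd.1.sub hd.2.1).abs) fun x => ?_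
        have := abs_sub (F x - f x) (F x - f x - (generatorFormula R F x - g x))
        rwa [sub_sub_cancel] at this
    _ = _ := integral_add hd.1.abs (hd.1.sub hd.2.1).abs
    _ ≤ ε := by linarith

theorem exists_seq_testFunctions {R : ℝ → ℝ} {c : ℝ} (h : IsStationaryRate R c) {f g : ℝ → ℝ}
    (hfg : HasGenerator R (explicitLaw R c) f g) :
    ∃ F : ℕ → ℝ → ℝ, (∀ n, F n ∈ testFunctions) ∧
      Tendsto (fun n => eLpNorm (fun x => F n x - f x) 1 (explicitLaw R c)) atTop (𝓝 0) ∧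
      Tendsto (fun n => eLpNorm (fun x => generatorFormula R (F n) x - g x) 1 (explicitLaw R c))
        atTop (𝓝 0) := by
  choose F hF h1 h2 using fun n : ℕ =>
    h.exists_testFunction_graph hfg (show (0 : ℝ) < 1 / (n + 1) by positivity)
  have hlim : Tendsto (fun n : ℕ => ENNReal.ofReal (1 / ((n : ℝ) + 1))) atTop (𝓝 0) := by
    simpa using ENNReal.tendsto_ofReal (tendsto_one_div_add_atTop_nhds_zero_nat (𝕜 := ℝ))
  have hle : ∀ {k : ℝ → ℝ} {ε : ℝ}, Integrable k (explicitLaw R c) →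
      ∫ x, |k x| ∂(explicitLaw R c) ≤ ε → eLpNorm k 1 (explicitLaw R c) ≤ ENNReal.ofReal ε := by
    intro k ε hk hkε
    rw [eLpNorm_one_eq_lintegral_enorm, ← ofReal_integral_norm_eq_lintegral_enorm hk]
    exact ENNReal.ofReal_le_ofReal hkε
  exact ⟨F, hF,
    tendsto_of_tendsto_of_tendsto_of_le_of_le tendsto_const_nhds hlim (fun n => zero_le)
      fun n => hle ((h.integrable_testFunction (hF n)).sub hfg.1) (h1 n),
    tendsto_of_tendsto_of_tendsto_of_le_of_le tendsto_const_nhds hlim (fun n => zero_le)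
      fun n => hle ((h.integrable_generatorFormula (hF n)).sub hfg.2.1) (h2 n)⟩

end IsStationaryRate

/-! ### Reduction to measurable rates -/

/-- Two rates which agree almost everywhere on `(0,∞)`. -/
def RateEq (R Q : ℝ → ℝ) : Prop := ∀ᵐ x, 0 < x → R x = Q x

namespace RateEq

theorem survivor_eq {R Q : ℝ → ℝ} (h : RateEq R Q) {z : ℝ} (hz : 0 ≤ z) (t : ℝ) :
    survivor R z t = survivor Q z t := by
  rw [survivor, survivor, intervalIntegral.integral_congr_ae]
  filter_upwards [h] with x hx hx'
  exact hx ((le_min hz (by positivity)).trans_lt hx'.1)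

theorem survivorInv_eq {R Q : ℝ → ℝ} (h : RateEq R Q) {z : ℝ} (hz : 0 ≤ z) (u : ℝ) :
    survivorInv R z u = survivorInv Q z u := by
  simp only [survivorInv, h.survivor_eq hz]

theorem jumpTime_eq {R Q : ℝ → ℝ} (h : RateEq R Q) {x : ℝ} (hx : 0 ≤ x) (ω : ℕ → ℝ) (k : ℕ) :
    jumpTime R x ω k = jumpTime Q x ω k := by
  induction k with
  | zero => rfl
  | succ k ih =>
    rw [jumpTime, jumpTime, ih, h.survivorInv_eq]
    exact mul_nonneg (by positivity) (jumpProd_nonneg ω k)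

theorem cell_eq {R Q : ℝ → ℝ} (h : RateEq R Q) {x : ℝ} (hx : 0 ≤ x) (t : ℝ) (ω : ℕ → ℝ) :
    cell R x t ω = cell Q x t ω := by
  have hiff : ∀ n, ω ∈ jumpEvent R n t x ↔ ω ∈ jumpEvent Q n t x := fun n => by
    simp only [jumpEvent, mem_ofPred_eq, h.jumpTime_eq hx]
  by_cases hex : ∃ n, ω ∈ jumpEvent R n t x
  · obtain ⟨n, hn⟩ := hex
    rw [cell_of_mem hn, cell_of_mem ((hiff n).1 hn)]
  · rw [cell_of_notMem (not_exists.1 hex),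
      cell_of_notMem fun n hn => hex ⟨n, (hiff n).2 hn⟩]

theorem transition_eq {R Q : ℝ → ℝ} (h : RateEq R Q) {x : ℝ} (hx : 0 ≤ x) (t : ℝ) (f : ℝ → ℝ) :
    transition R t f x = transition Q t f x := by
  simp only [transition, h.cell_eq hx]

theorem generatorFormula_ae_eq {R Q : ℝ → ℝ} (h : RateEq R Q) {π : Measure ℝ} (hπ : π ≪ volume)
    (hpos : ∀ᵐ x ∂π, 0 < x) (f : ℝ → ℝ) :
    generatorFormula R f =ᵐ[π] generatorFormula Q f := by
  filter_upwards [hπ.ae_le h, hpos] with x hx hx0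
  rw [generatorFormula, generatorFormula, hx hx0]

theorem hasGenerator_congr {R Q : ℝ → ℝ} (h : RateEq R Q) {π : Measure ℝ}
    (hpos : ∀ᵐ x ∂π, 0 < x) {f g k : ℝ → ℝ} (hgk : g =ᵐ[π] k)
    (hfg : HasGenerator R π f g) : HasGenerator Q π f k := by
  refine ⟨hfg.1, hfg.2.1.congr hgk, hfg.2.2.congr fun t => eLpNorm_congr_ae ?_⟩
  filter_upwards [hgk, hpos] with x hx hx0
  rw [hx, h.transition_eq hx0.le]

theorem isStationaryLaw {R Q : ℝ → ℝ} (h : RateEq R Q) {π : Measure ℝ}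
    (hπ : IsStationaryLaw R π) : IsStationaryLaw Q π := by
  refine ⟨hπ.1, hπ.2, hπ.3, fun t x ht hx => ?_⟩
  rw [hπ.4 t x ht hx]
  simp only [fragmentationOperator]
  congr 1
  refine lintegral_congr fun s => ?_
  congr 1
  refine setLIntegral_congr_fun_ae measurableSet_Ioi ?_
  filter_upwards [hπ.absolutelyContinuous.ae_le h] with z hz hz'
  have h0 : 0 ≤ Real.exp (s - t) * x := by positivity
  rw [hz (h0.trans_lt hz')]

end RateEq

/-- The given rate need only be almost everywhere measurable, and is arbitrary on the negative axis.
`Q` is a measurable nonnegative version that vanishes off `(0, ∞)`. -/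
theorem exists_isRate_rateEq {R : ℝ → ℝ} (hR_nonneg : ∀ x, 0 ≤ x → 0 ≤ R x)
    (hR_loc : LocallyIntegrableOn R (Ici 0) volume) : ∃ Q, IsRate Q ∧ RateEq R Q := by
  have hae : AEStronglyMeasurable R (volume.restrict (Ioi 0)) :=
    hR_loc.aestronglyMeasurable.mono_measure (Measure.restrict_mono Ioi_subset_Ici_self le_rfl)
  set Q : ℝ → ℝ := (Ioi 0).indicator fun x => max (hae.mk R x) 0 with hQ
  have hRQ : RateEq R Q := by
    have h1 := (ae_restrict_iff' measurableSet_Ioi).1 hae.ae_eq_mk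
    filter_upwards [h1] with x hx hx0
    rw [hQ, indicator_of_mem (show x ∈ Ioi 0 from hx0), ← hx hx0, max_eq_left (hR_nonneg x hx0.le)]
  refine ⟨Q, ⟨?_, ?_, ?_⟩, hRQ⟩
  · exact (hae.stronglyMeasurable_mk.measurable.max measurable_const).indicator measurableSet_Ioi
  · exact fun x => indicator_nonneg (fun x _ => le_max_right _ _) x
  · refine locallyIntegrable_iff.2 fun K hK => ?_
    have h1 : IntegrableOn R (K ∩ Ici 0) :=
      hR_loc.integrableOn_compact_subset inter_subset_right (hK.inter_right isClosed_Ici)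
    have h2 : IntegrableOn ((Ioi 0).indicator R) K := by
      rw [integrableOn_indicator_iff measurableSet_Ioi]
      exact h1.mono_set fun x hx => ⟨hx.2, le_of_lt (show (0 : ℝ) < x from hx.1)⟩
    refine h2.congr_fun_ae (ae_restrict_of_ae ?_)
    filter_upwards [hRQ] with x hx
    by_cases hx0 : x ∈ Ioi 0
    · rw [indicator_of_mem hx0, hx hx0]
    · rw [indicator_of_notMem hx0, hQ, indicator_of_notMem hx0]

end CellProcess

end

/-! ### Conclusion: transfer from the measurable version back to the given rate. -/

theorem proposition3p9 (R : ℝ → ℝ) (hR_nonneg : ∀ x, 0 ≤ x → 0 ≤ R x)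
    (hR_loc : LocallyIntegrableOn R (Ici 0) volume)
    (π : Measure ℝ) (hπ : CellProcess.IsStationaryLaw R π) :
    -- the operators `P_t` are well defined on `L¹(π)`, and are contractions
    (∀ (t : ℝ) (f : ℝ → ℝ), 0 ≤ t → Integrable f π →
      (∀ᵐ x ∂π, Integrable (fun ω => f (CellProcess.cell R x t ω)) CellProcess.uniformSeq) ∧
      Integrable (CellProcess.transition R t f) π ∧
      eLpNorm (CellProcess.transition R t f) 1 π ≤ eLpNorm f 1 π) ∧
    -- `C_c^1(0,∞)` is contained in the domain of the generator, which is `𝓛` there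
    (∀ f ∈ CellProcess.testFunctions,
      CellProcess.HasGenerator R π f (CellProcess.generatorFormula R f)) ∧
    -- `C_c^1(0,∞)` is dense in the domain for the graph norm
    (∀ f g : ℝ → ℝ, CellProcess.HasGenerator R π f g →
      ∃ F : ℕ → ℝ → ℝ, (∀ n, F n ∈ CellProcess.testFunctions) ∧
        Tendsto (fun n => eLpNorm (fun x => F n x - f x) 1 π) atTop (𝓝 0) ∧
        Tendsto (fun n => eLpNorm (fun x => CellProcess.generatorFormula R (F n) x - g x) 1 π)
          atTop (𝓝 0)) := by
  obtain ⟨Q, hQ, hRQ⟩ := CellProcess.exists_isRate_rateEq hR_nonneg hR_loc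
  have hQR : CellProcess.RateEq Q R := by
    filter_upwards [hRQ] with x hx hx0 using (hx hx0).symm
  obtain ⟨c, hc, hH, rfl⟩ := (hRQ.isStationaryLaw hπ).exists_eq_explicitLaw hQ
  have h : CellProcess.IsStationaryRate Q c := ⟨hQ, hH, hc, hπ.isProbabilityMeasure⟩
  have hpos := CellProcess.ae_explicitLaw_pos Q c
  have hac := hπ.absolutelyContinuous
  refine ⟨fun t f ht hf => ?_, fun f hf => ?_, fun f g hfg => ?_⟩
  · have htr : CellProcess.transition Q t f =ᵐ[CellProcess.explicitLaw Q c]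
        CellProcess.transition R t f := by
      filter_upwards [hpos] with x hx using hQR.transition_eq hx.le t f
    have hi := h.integrable_transition ht hf
    refine ⟨?_, hi.congr htr, ?_⟩
    · filter_upwards [hpos, h.ae_integrable_cell ht hf] with x hx hxi
      simpa only [hRQ.cell_eq hx.le] using hxi
    · rw [← eLpNorm_congr_ae htr, eLpNorm_one_eq_lintegral_enorm, eLpNorm_one_eq_lintegral_enorm,
        ← ofReal_integral_norm_eq_lintegral_enorm hi, ← ofReal_integral_norm_eq_lintegral_enorm hf]
      exact ENNReal.ofReal_le_ofReal (h.integral_norm_transition_le ht hf)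
  · exact hQR.hasGenerator_congr hpos (hQR.generatorFormula_ae_eq hac hpos f)
      (h.hasGenerator_testFunction hf)
  · obtain ⟨F, hF, h1, h2⟩ := h.exists_seq_testFunctions
      (hRQ.hasGenerator_congr hpos (ae_eq_refl g) hfg)
    refine ⟨F, hF, h1, h2.congr fun n => eLpNorm_congr_ae ?_⟩
    filter_upwards [hQR.generatorFormula_ae_eq hac hpos (F n)] with x hx
    rw [hx]
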